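/- Let $S$ be a finite set of points in the plane in general position (no three on a line). A plane spanning caterpillar of $S$ is a spanning tree of $S$, drawn with straight-line edges no two of which cross, whose non-leaf vertices form a (possibly empty or one-vertex) path. Two plane spanning caterpillars $C_1=(S,E_1)$ and $C_2=(S,E_2)$ are connected by a slide if $E_2=(E_1\setminus\{ab\})\cup\{ac\}$ for distinct points $a,b,c\in S$ with $ab\in E_1$, $ac\notin E_1$, $bc\in E_1\cap E_2$, such that the triangle $abc$ contains no point of $S$ other than $a,b,c$. The slide graph $G_{\mathcal C}^{\mathrm{slide}}(S)$ has the plane spanning caterpillars of $S$ as vertices, two of them being adjacent if they are connected by a slide. If $1\le n\le 7$, then $G_{\mathcal C}^{\mathrm{slide}}(S)$ is connected for every set $S$ of $n$ points in general position in the plane. For every $n\ge 8$ there is a set $S$ of $n$ points in general position in the plane such that $G_{\mathcal C}^{\mathrm{slide}}(S)$ has an isolated vertex (a vertex with no neighbours). -/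

import Mathlib

namespace SlideGraph

/-- The Euclidean plane. -/
abbrev Plane : Type := EuclideanSpace ℝ (Fin 2)

/-- No three distinct points of `S` lie on a common line. -/
def GeneralPosition (S : Finset Plane) : Prop :=
  ∀ a ∈ S, ∀ b ∈ S, ∀ c ∈ S, a ≠ b → a ≠ c → b ≠ c →
    ¬ Collinear ℝ ({a, b, c} : Set Plane)

/-- The straight-line drawing of `G` has no crossings: two distinct edges meet at most in a
common endpoint. -/
def IsPlane {S : Finset Plane} (G : SimpleGraph S) : Prop :=
  ∀ a b c d : S, G.Adj a b → G.Adj c d → s(a, b) ≠ s(c, d) →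
    segment ℝ (a : Plane) (b : Plane) ∩ segment ℝ (c : Plane) (d : Plane) ⊆
      ({(a : Plane), (b : Plane)} ∩ {(c : Plane), (d : Plane)} : Set Plane)

/-- A leaf is a vertex with exactly one neighbour. -/
def IsLeaf {V : Type*} (G : SimpleGraph V) (v : V) : Prop :=
  ∃! w, G.Adj v w

/-- A caterpillar is a tree whose non-leaf vertices form a (possibly empty or one-vertex) path;
the list `l` is that path, the spine. -/
def IsCaterpillar {V : Type*} (G : SimpleGraph V) : Prop :=
  G.IsTree ∧ ∃ l : List V, l.Nodup ∧ l.IsChain G.Adj ∧ ∀ v, v ∈ l ↔ ¬ IsLeaf G v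

/-- The plane spanning caterpillars of `S`. -/
def PlaneCaterpillar (S : Finset Plane) : Type :=
  {G : SimpleGraph S // IsPlane G ∧ IsCaterpillar G}

/-- The triangle spanned by `a, b, c` contains no further point of `S`. -/
def EmptyTriangle (S : Finset Plane) (a b c : Plane) : Prop :=
  ∀ p ∈ S, p ∈ convexHull ℝ ({a, b, c} : Set Plane) → p = a ∨ p = b ∨ p = c

/-- `H` arises from `G` by a slide: an edge `ab` of `G` is exchanged for a new edge `ac`, where
`bc` is an edge of both graphs and the triangle `abc` is empty. -/
def IsSlide {S : Finset Plane} (G H : SimpleGraph S) : Prop :=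
  ∃ a b c : S, G.Adj a b ∧ ¬ G.Adj a c ∧
    H.edgeSet = (G.edgeSet \ {s(a, b)}) ∪ {s(a, c)} ∧
    G.Adj b c ∧ H.Adj b c ∧ EmptyTriangle S a b c

theorem IsSlide.symm {S : Finset Plane} {G H : SimpleGraph S} (h : IsSlide G H) :
    IsSlide H G := by
  obtain ⟨a, b, c, hab, hac, hE, hbc, hbc', hT⟩ := h
  have hne : s(a, b) ≠ s(a, c) := by
    intro h
    apply hac
    rw [← SimpleGraph.mem_edgeSet, ← h]
    exact hab
  refine ⟨a, c, b, ?_, ?_, ?_, hbc'.symm, hbc.symm, ?_⟩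
  · rw [← SimpleGraph.mem_edgeSet, hE]
    exact Or.inr rfl
  · rw [← SimpleGraph.mem_edgeSet, hE]
    rintro (h | h)
    · exact h.2 rfl
    · exact hne h
  · rw [hE]
    ext e
    have h1 : s(a, b) ∈ G.edgeSet := hab
    have h2 : s(a, c) ∉ G.edgeSet := hac
    simp only [Set.mem_union, Set.mem_sdiff, Set.mem_singleton_iff]
    constructor
    · intro he
      by_cases h : e = s(a, b)
      · exact Or.inr h
      · exact Or.inl ⟨Or.inl ⟨he, h⟩, fun h' => h2 (h' ▸ he)⟩
    · rintro (⟨⟨he, -⟩ | he, hn⟩ | he)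
      · exact he
      · exact absurd he hn
      · exact he ▸ h1
  · intro p hp hp'
    rw [Set.pair_comm] at hp'
    rcases hT p hp hp' with h | h | h
    · exact Or.inl h
    · exact Or.inr (Or.inr h)
    · exact Or.inr (Or.inl h)

theorem IsSlide.irrefl {S : Finset Plane} (G : SimpleGraph S) : ¬ IsSlide G G := by
  rintro ⟨a, b, c, -, hac, hE, -⟩
  apply hac
  rw [← SimpleGraph.mem_edgeSet, hE]
  exact Or.inr rfl

/-- The slide graph of plane spanning caterpillars of `S`. -/
def slideGraph (S : Finset Plane) : SimpleGraph (PlaneCaterpillar S) where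
  Adj C D := IsSlide C.1 D.1
  symm := ⟨fun _ _ h => h.symm⟩
  loopless := ⟨fun C => IsSlide.irrefl C.1⟩

end SlideGraph

/-! At most seven points. Slides, crossings and empty triangles depend only on the orientations of
triples, so the first claim is finite. Let `0` be the lexicographically smallest point and number
the others by angle around it (`exists_labelling`). Every triple `0, i, j` with `0 < i < j` is then
counterclockwise, and at most twenty signs remain, those of the triples from `1, …, 6`. For `i < j <
k < l` the three-term relations between determinants, with the positive coefficients `det 0 i j` and
the like, show that the signs of `ijk, ijl, ikl, jkl`, in this order, change at most once. Every
sign pattern with this property occurs among the 908 columns of `orientationTable`, hence every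
point set is represented by a column (`exists_realizes`). It does no harm that a column need not
come from points.

A spanning tree rooted at `0` is a parent function, stored as octal digits. A set of columns is a
bit mask, so that one bitwise operation tests a crossing or an empty triangle in all columns
together. The search runs through all plane trees, caterpillars or not. In each column a tree is the
star at `0`, or some vertex can slide from its parent to its grandparent, or a listed path of slides
ends in a tree that precedes it by depth sum and then by code. The listed paths are certificates:
they are checked step by step, and their origin is irrelevant. The soundness of this computation is
`search_sound`, which rests on `walk_sound` and `Realizes.step`. Well-founded induction then leads
from every plane caterpillar to the star (`Realizes.reaches_star`), and any two of them are
connected through it (`slideGraph_connected`).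

At least eight points. The caterpillar `spineGraph` consists of the paths `0, 1, 2, 3` and `0, 4, 5,
6` and of leaves `7, 8, …` at `0`. A slide uses two edges with a common vertex. For most such pairs
the triangle contains another of the points. The remaining pairs are `01, 04` and two leaf edges at
`0`; sliding there creates a vertex with three non-leaf neighbours, which a caterpillar does not
have. In the first case the third non-leaf neighbour is `0` itself, by virtue of its leaf `7`: this
is where eight points are needed (`not_step_spineGraph`).

Both halves use that a tree is a caterpillar exactly if no vertex has three non-leaf neighbours
(`isCaterpillar_of_forall`, `isLeaf_of_isCaterpillar`). -/

namespace SlideGraph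

open SimpleGraph

/-! ### Plane geometry -/

/-- Twice the signed area of the triangle `abc`; positive iff `a, b, c` is counterclockwise. -/
def det (a b c : Plane) : ℝ := (b 0 - a 0) * (c 1 - a 1) - (c 0 - a 0) * (b 1 - a 1)

theorem det_rotate (a b c : Plane) : det b c a = det a b c := by unfold det; ring

theorem det_swap_left (a b c : Plane) : det b a c = -det a b c := by unfold det; ring

theorem det_swap_right (a b c : Plane) : det a c b = -det a b c := by unfold det; ring

theorem plane_ext {a b : Plane} (h0 : a 0 = b 0) (h1 : a 1 = b 1) : a = b := by
  ext i; fin_cases i <;> assumption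

theorem collinear_of_det_eq_zero {a b c : Plane} (hab : a ≠ b) (h : det a b c = 0) :
    Collinear ℝ ({a, b, c} : Set Plane) := by
  rw [collinear_iff_of_mem (p₀ := a) (by simp)]
  refine ⟨b - a, ?_⟩
  simp only [Set.mem_insert_iff, Set.mem_singleton_iff, forall_eq_or_imp, forall_eq, vadd_eq_add]
  refine ⟨⟨0, by simp⟩, ⟨1, by simp⟩, ?_⟩
  unfold det at h
  by_cases h0 : b 0 - a 0 = 0
  · have h1 : b 1 - a 1 ≠ 0 := by
      intro h1
      exact hab (plane_ext (by linarith) (by linarith))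
    refine ⟨(c 1 - a 1) / (b 1 - a 1), plane_ext ?_ ?_⟩
    · have : c 0 - a 0 = 0 := by
        rw [h0] at h
        simpa [h1] using h
      simp [h0]
      linarith
    · simp
      field_simp
      ring
  · refine ⟨(c 0 - a 0) / (b 0 - a 0), plane_ext ?_ ?_⟩
    · simp
      field_simp
      ring
    · simp
      field_simp
      linarith

theorem det_eq_zero_of_collinear {a b c : Plane} (h : Collinear ℝ ({a, b, c} : Set Plane)) :
    det a b c = 0 := by
  rw [collinear_iff_of_mem (p₀ := a) (by simp)] at h
  obtain ⟨v, hv⟩ := h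
  obtain ⟨s, rfl⟩ := hv b (by simp)
  obtain ⟨t, rfl⟩ := hv c (by simp)
  unfold det
  simp
  ring

theorem mem_segment_iff_coords {a b x : Plane} : x ∈ segment ℝ a b ↔
    ∃ s t : ℝ, 0 ≤ s ∧ 0 ≤ t ∧ s + t = 1 ∧
      x 0 = s * a 0 + t * b 0 ∧ x 1 = s * a 1 + t * b 1 := by
  constructor
  · rintro ⟨s, t, hs, ht, hst, rfl⟩
    exact ⟨s, t, hs, ht, hst, by simp, by simp⟩
  · rintro ⟨s, t, hs, ht, hst, h0, h1⟩
    exact ⟨s, t, hs, ht, hst, plane_ext (by simp [h0]) (by simp [h1])⟩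

/-- Crossing segments meet. -/
theorem exists_mem_segment_inter {a b c d : Plane} (h1 : det a b c * det a b d < 0)
    (h2 : det c d a * det c d b < 0) : ∃ x, x ∈ segment ℝ a b ∧ x ∈ segment ℝ c d := by
  -- An affine function with values `u`, `v` of opposite sign at the ends of a segment vanishes at
  -- the point with weights `v / (v - u)` and `-u / (v - u)`, which are nonnegative.
  have key : ∀ u v : ℝ, u * v < 0 → 0 ≤ v / (v - u) ∧ 0 ≤ -u / (v - u) ∧ v - u ≠ 0 := by
    intro u v huv
    rcases mul_neg_iff.1 huv with ⟨hu, hv⟩ | ⟨hu, hv⟩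
    · exact ⟨div_nonneg_of_nonpos hv.le (by linarith),
        div_nonneg_of_nonpos (by linarith) (by linarith), by linarith⟩
    · exact ⟨div_nonneg hv.le (by linarith), div_nonneg (by linarith) (by linarith),
        by linarith⟩
  obtain ⟨p1, p2, p3⟩ := key _ _ h1
  obtain ⟨q1, q2, q3⟩ := key _ _ h2
  have p4 : det a b d / (det a b d - det a b c) + -det a b c / (det a b d - det a b c) = 1 := by
    field_simp; ring
  have q4 : det c d b / (det c d b - det c d a) + -det c d a / (det c d b - det c d a) = 1 := by
    field_simp; ring
  -- The witness is the point of `cd` at which `det a b` vanishes.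
  refine ⟨(det a b d / (det a b d - det a b c)) • c + (-det a b c / (det a b d - det a b c)) • d,
    ?_, ⟨_, _, p1, p2, p4, rfl⟩⟩
  rw [mem_segment_iff_coords]
  -- Both differences are the cross product of `b - a` and `d - c`, in opposite orders, so the two
  -- descriptions of the point have the same denominator up to sign.
  have e : det a b d - det a b c = -(det c d b - det c d a) := by unfold det; ring
  refine ⟨_, _, q1, q2, q4, ?_, ?_⟩
  · simp only [PiLp.add_apply, PiLp.smul_apply, smul_eq_mul]
    rw [e]
    field_simp
    unfold det
    ring
  · simp only [PiLp.add_apply, PiLp.smul_apply, smul_eq_mul]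
    rw [e]
    field_simp
    unfold det
    ring

/-- The affine function `det a b` vanishes at `x`, which lies on the line `ab`, and its value there
is a convex combination of its nonzero values at `c` and `d`. These must differ in sign. -/
theorem det_mul_neg_of_segment_inter {a b c d x : Plane} (hx : x ∈ segment ℝ a b)
    (hy : x ∈ segment ℝ c d) (hc : det a b c ≠ 0) (hd : det a b d ≠ 0) :
    det a b c * det a b d < 0 := by
  obtain ⟨s, t, -, -, hst, h0, h1⟩ := mem_segment_iff_coords.1 hx
  obtain ⟨u, v, hu, hv, huv, k0, k1⟩ := mem_segment_iff_coords.1 hy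
  have e1 : det a b x = 0 := by
    unfold det
    rw [h0, h1]
    obtain rfl : s = 1 - t := by linarith
    ring
  have e2 : det a b x = u * det a b c + v * det a b d := by
    unfold det
    rw [k0, k1]
    obtain rfl : u = 1 - v := by linarith
    ring
  rw [e1] at e2
  by_contra hcon
  push Not at hcon
  have hu0 : u ≠ 0 := by
    rintro rfl
    have : v = 1 := by linarith
    subst this
    simp at e2
    exact hd e2.symm
  have : 0 < u * (det a b c * det a b c) :=
    mul_pos (lt_of_le_of_ne hu hu0.symm) (mul_self_pos.2 hc)
  have e3 : u * (det a b c * det a b c) + v * (det a b c * det a b d) = 0 := by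
    linear_combination -det a b c * e2
  linarith [mul_nonneg hv hcon]

/-- Along `ad` the value of `det a b` is the weight of `d` times `det a b d`; it vanishes on the
line `ab`, so this weight is zero. -/
theorem eq_of_mem_segment_inter {a b d x : Plane} (hx : x ∈ segment ℝ a b)
    (hy : x ∈ segment ℝ a d) (hd : det a b d ≠ 0) : x = a := by
  obtain ⟨s, t, -, -, hst, h0, h1⟩ := mem_segment_iff_coords.1 hx
  obtain ⟨u, v, hu, hv, huv, k0, k1⟩ := mem_segment_iff_coords.1 hy
  have e1 : det a b x = 0 := by
    unfold det
    rw [h0, h1]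
    obtain rfl : s = 1 - t := by linarith
    ring
  have e2 : det a b x = v * det a b d := by
    unfold det
    rw [k0, k1]
    obtain rfl : u = 1 - v := by linarith
    ring
  have hv0 : v = 0 := by
    rw [e1] at e2
    rcases mul_eq_zero.1 e2.symm with h | h
    · exact h
    · exact absurd h hd
  subst hv0
  obtain rfl : u = 1 := by linarith
  exact plane_ext (by linarith) (by linarith)

theorem mem_convexHull_triple_iff {a b c p : Plane} :
    p ∈ convexHull ℝ ({a, b, c} : Set Plane) ↔ ∃ u v w : ℝ, 0 ≤ u ∧ 0 ≤ v ∧ 0 ≤ w ∧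
      u + v + w = 1 ∧ p 0 = u * a 0 + v * b 0 + w * c 0 ∧ p 1 = u * a 1 + v * b 1 + w * c 1 := by
  rw [convexHull_insert (by simp), convexHull_pair, mem_convexJoin]
  simp only [Set.mem_singleton_iff, exists_eq_left]
  constructor
  · rintro ⟨y, hy, hp⟩
    obtain ⟨s, t, hs, ht, hst, h0, h1⟩ := mem_segment_iff_coords.1 hy
    obtain ⟨u, v, hu, hv, huv, k0, k1⟩ := mem_segment_iff_coords.1 hp
    refine ⟨u, v * s, v * t, hu, mul_nonneg hv hs, mul_nonneg hv ht, ?_, ?_, ?_⟩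
    · rw [add_assoc, ← mul_add, hst, mul_one, huv]
    · rw [k0, h0]; ring
    · rw [k1, h1]; ring
  · rintro ⟨u, v, w, hu, hv, hw, huvw, h0, h1⟩
    by_cases h : v + w = 0
    · have hv0 : v = 0 := by linarith
      have hw0 : w = 0 := by linarith
      subst hv0 hw0
      refine ⟨b, left_mem_segment ℝ b c, ?_⟩
      rw [mem_segment_iff_coords]
      exact ⟨u, 0, hu, le_rfl, by linarith, by linarith, by linarith⟩
    · have hpos : 0 < v + w := lt_of_le_of_ne (by linarith) (Ne.symm h)
      refine ⟨(v / (v + w)) • b + (w / (v + w)) • c,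
        ⟨_, _, by positivity, by positivity, by field_simp, rfl⟩, ?_⟩
      rw [mem_segment_iff_coords]
      refine ⟨u, v + w, hu, hpos.le, by linarith, ?_, ?_⟩
      · simp only [PiLp.add_apply, PiLp.smul_apply, smul_eq_mul]
        rw [h0]; field_simp; ring
      · simp only [PiLp.add_apply, PiLp.smul_apply, smul_eq_mul]
        rw [h1]; field_simp; ring

/-- The three determinants divided by `det a b c` are the barycentric coordinates of `p`. -/
theorem mem_convexHull_of_det_pos {a b c p : Plane} (h1 : 0 ≤ det a b p) (h2 : 0 ≤ det b c p)
    (h3 : 0 ≤ det c a p) (h : 0 < det a b c) : p ∈ convexHull ℝ ({a, b, c} : Set Plane) := by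
  rw [mem_convexHull_triple_iff]
  refine ⟨det b c p / det a b c, det c a p / det a b c, det a b p / det a b c, by positivity,
    by positivity, by positivity, ?_, ?_, ?_⟩
  · rw [← add_div, ← add_div, div_eq_one_iff_eq h.ne']
    unfold det; ring
  · field_simp
    unfold det; ring
  · field_simp
    unfold det; ring

theorem det_nonneg_of_mem_convexHull {a b c p : Plane}
    (hp : p ∈ convexHull ℝ ({a, b, c} : Set Plane)) : 0 ≤ det a b c * det a b p := by
  obtain ⟨u, v, w, hu, hv, hw, huvw, h0, h1⟩ := mem_convexHull_triple_iff.1 hp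
  have : det a b p = w * det a b c := by
    unfold det
    rw [h0, h1]
    obtain rfl : u = 1 - v - w := by linarith
    ring
  rw [this, mul_left_comm]
  exact mul_nonneg hw (mul_self_nonneg _)

/-! ### Caterpillars -/

variable {V : Type*}

theorem not_isLeaf_of_adj {G : SimpleGraph V} {v x y : V} (hx : G.Adj v x) (hy : G.Adj v y)
    (hxy : x ≠ y) : ¬ IsLeaf G v := fun h => hxy (h.unique hx hy)

/-- A path that leaves a vertex set towards a non-leaf leaves it through a non-leaf. -/
theorem exists_adj_not_mem {G : SimpleGraph V} {s : V → Prop} {a u : V} (w : G.Walk a u)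
    (hw : w.IsPath) (ha : s a) (hu : ¬ s u) (hl : ¬ IsLeaf G u) :
    ∃ x y, s x ∧ ¬ s y ∧ G.Adj x y ∧ ¬ IsLeaf G y := by
  induction w with
  | nil => exact absurd ha hu
  | @cons a b u h p ih =>
    rw [Walk.cons_isPath_iff] at hw
    by_cases hb : s b
    · exact ih hw.1 hb hu hl
    · refine ⟨a, b, ha, hb, h, ?_⟩
      cases p with
      | nil => exact hl
      | @cons _ c _ h' q =>
        -- The path goes on from `b` to a vertex other than `a`, so `b` has two neighbours.
        refine not_isLeaf_of_adj h.symm h' ?_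
        rintro rfl
        exact hw.2 (by simp)

theorem isChain_concat {G : SimpleGraph V} {l : List V} {x y : V}
    (h : (l ++ [x]).IsChain G.Adj) (hxy : G.Adj x y) : (l ++ [x] ++ [y]).IsChain G.Adj := by
  rw [List.isChain_append]
  refine ⟨h, by simp, ?_⟩
  simp [hxy]

/-- A tree in which no vertex has three non-leaf neighbours is a caterpillar. -/
theorem isCaterpillar_of_forall [Finite V] {G : SimpleGraph V} (hG : G.IsTree)
    (h : ∀ v x y z, G.Adj v x → G.Adj v y → G.Adj v z → x ≠ y → x ≠ z → y ≠ z →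
      IsLeaf G x ∨ IsLeaf G y ∨ IsLeaf G z) : IsCaterpillar G := by
  classical
  have := Fintype.ofFinite V
  refine ⟨hG, ?_⟩
  -- The spine will be a longest path of non-leaves; its length is bounded by the number of
  -- vertices.
  let p : ℕ → Prop := fun k => ∃ l : List V, l.Nodup ∧ l.IsChain G.Adj ∧
    (∀ v ∈ l, ¬ IsLeaf G v) ∧ l.length = k
  have hp0 : p 0 := ⟨[], by simp⟩
  have hbound : ∀ k, p k → k ≤ Fintype.card V := by
    rintro k ⟨l, hl, -, -, rfl⟩
    exact hl.length_le_card
  obtain ⟨l, hnd, hch, hnl, hlen⟩ := Nat.findGreatest_spec (P := p)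
    (Nat.zero_le (Fintype.card V)) hp0
  have hmax : ∀ l' : List V, l'.Nodup → l'.IsChain G.Adj → (∀ v ∈ l', ¬ IsLeaf G v) →
      l'.length ≤ l.length := by
    intro l' h1 h2 h3
    rw [hlen]
    exact Nat.le_findGreatest (hbound _ ⟨l', h1, h2, h3, rfl⟩) ⟨l', h1, h2, h3, rfl⟩
  refine ⟨l, hnd, hch, fun v => ⟨hnl v, fun hv => ?_⟩⟩
  by_contra hvl
  rcases l with _ | ⟨a, l₀⟩
  · have := hmax [v] (by simp) (by simp) (by simpa using hv)
    simp at this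
  -- If a non-leaf `v` were missing, the tree path from `a` to `v` would leave the list at some `x`
  -- towards a non-leaf `y`. If `x` is an end of the list, then `y` extends it; otherwise `x` has
  -- three non-leaf neighbours.
  obtain ⟨w, hw, -⟩ := hG.existsUnique_path a v
  obtain ⟨x, y, hx, hy, hxy, hyl⟩ :=
    exists_adj_not_mem (s := fun z => z ∈ a :: l₀) w hw (by simp) hvl hv
  obtain ⟨l₁, l₂, hl⟩ := List.append_of_mem hx
  rw [hl] at hnd hch hnl hmax hy
  rcases List.eq_nil_or_concat l₁ with rfl | ⟨l₁', u, rfl⟩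
  · have := hmax (y :: x :: l₂) (by simpa using ⟨by simpa using hy, by simpa using hnd⟩)
      (by simpa using ⟨hxy.symm, by simpa using hch⟩)
      (by
        intro z hz
        rcases List.mem_cons.1 hz with rfl | hz
        · exact hyl
        · exact hnl z (by simpa using hz))
    simp at this
  rcases l₂ with _ | ⟨t, l₂'⟩
  · have := hmax (l₁'.concat u ++ [x] ++ [y])
      (by
        rw [List.nodup_append]
        refine ⟨hnd, by simp, ?_⟩
        rintro z hz z' hz' rfl
        rw [List.mem_singleton] at hz'
        exact hy (hz' ▸ hz))
      (isChain_concat hch hxy)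
      (by
        intro z hz
        rcases List.mem_append.1 hz with hz | hz
        · exact hnl z hz
        · rw [List.mem_singleton.1 hz]; exact hyl)
    simp at this
  · have hux : G.Adj u x := by
      simp only [List.concat_eq_append, List.append_assoc] at hch
      have := (List.isChain_append.1 hch).2.1
      simp at this
      exact this.1
    have hxt : G.Adj x t := by
      have := (List.isChain_append.1 hch).2.1
      simp at this
      exact this.1
    have hut : u ≠ t := by
      rintro rfl
      simp [List.nodup_append] at hnd
    have hu : u ∈ l₁'.concat u ++ x :: t :: l₂' := by simp
    have ht : t ∈ l₁'.concat u ++ x :: t :: l₂' := by simp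
    rcases h x u t y hux.symm hxt hxy hut (by rintro rfl; exact hy hu)
      (by rintro rfl; exact hy ht) with h | h | h
    · exact hnl u hu h
    · exact hnl t ht h
    · exact hyl h

/-- In an acyclic graph, adjacent vertices of a path given as a list are consecutive. -/
theorem head_eq_of_adj_of_isChain {G : SimpleGraph V} (hG : G.IsAcyclic) {v x : V} {l : List V}
    (hnd : (v :: l).Nodup) (hch : (v :: l).IsChain G.Adj) (hx : x ∈ l) (hvx : G.Adj v x) :
    l.head? = some x := by
  obtain ⟨l₁, l₂, rfl⟩ := List.append_of_mem hx
  rcases l₁ with _ | ⟨b, l₁⟩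
  · simp
  exfalso
  have hsub : (v :: b :: l₁ ++ [x]).Sublist (v :: (b :: l₁ ++ x :: l₂)) := by
    simp
  have hpre : (v :: b :: l₁ ++ [x]) <+: (v :: (b :: l₁ ++ x :: l₂)) := ⟨l₂, by simp⟩
  have hnd' : (v :: b :: l₁ ++ [x]).Nodup := hnd.sublist hsub
  have hch' : (v :: b :: l₁ ++ [x]).IsChain G.Adj := hch.prefix hpre
  -- The initial part of the list up to `x` and the single edge `vx` are both paths from `v` to `x`;
  -- in an acyclic graph they coincide, which contradicts the length of the former.
  have aux : ∀ (a c : V) (p : G.Walk a c), p.IsPath → a = v → c = x → p.length = 1 := by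
    rintro a c p hp rfl rfl
    have h1 : (⟨p, hp⟩ : G.Path a c) = ⟨Walk.cons hvx .nil, by simp [hvx.ne]⟩ :=
      (hG.subsingleton_path a c).elim _ _
    rw [Subtype.mk.injEq] at h1
    rw [h1]
    rfl
  have h3 := aux _ _ (Walk.ofSupport _ (List.cons_ne_nil _ _) hch')
    (by rw [Walk.isPath_def, Walk.support_ofSupport]; exact hnd') rfl (by simp)
  rw [Walk.length_ofSupport] at h3
  simp at h3

/-- A vertex with two neighbours lies on the spine, and its non-leaf neighbours lie there too. By
acyclicity they are next to it on the spine, where there are only two places. -/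
theorem isLeaf_of_isCaterpillar {G : SimpleGraph V} (hG : IsCaterpillar G) {v x y z : V}
    (hx : G.Adj v x) (hy : G.Adj v y) (hz : G.Adj v z) (hxy : x ≠ y) (hxz : x ≠ z)
    (hyz : y ≠ z) : IsLeaf G x ∨ IsLeaf G y ∨ IsLeaf G z := by
  obtain ⟨ht, l, hnd, hch, hl⟩ := hG
  by_contra hcon
  push Not at hcon
  have hv : v ∈ l := (hl v).2 (not_isLeaf_of_adj hx hy hxy)
  obtain ⟨l₁, l₂, rfl⟩ := List.append_of_mem hv
  have key : ∀ u, G.Adj v u → ¬ IsLeaf G u → l₁.reverse.head? = some u ∨ l₂.head? = some u := by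
    intro u hu hul
    have hmem := (hl u).2 hul
    simp only [List.mem_append, List.mem_cons] at hmem
    rcases hmem with h | rfl | h
    · left
      have hnd' : (l₁ ++ v :: l₂).reverse.Nodup := List.nodup_reverse.2 hnd
      have hch' : (l₁ ++ v :: l₂).reverse.IsChain G.Adj := by
        rw [List.isChain_reverse]
        exact hch.imp fun _ _ h => h.symm
      rw [List.reverse_append, List.reverse_cons, List.append_assoc] at hnd' hch'
      exact head_eq_of_adj_of_isChain ht.isAcyclic (List.nodup_append.1 hnd').2.1
        (List.isChain_append.1 hch').2.1 (by simpa using h) hu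
    · exact absurd hu (G.irrefl)
    · right
      exact head_eq_of_adj_of_isChain ht.isAcyclic (List.nodup_append.1 hnd).2.1
        (List.isChain_append.1 hch).2.1 h hu
  have h1 := key x hx hcon.1
  have h2 := key y hy hcon.2.1
  have h3 := key z hz hcon.2.2
  grind

theorem not_adj_of_isTree {G : SimpleGraph V} (hG : G.IsTree) {a b c : V} (hab : G.Adj a b)
    (hbc : G.Adj b c) : ¬ G.Adj a c := by
  classical
  intro hac
  exact hG.isAcyclic.cliqueFree le_rfl {a, b, c} (is3Clique_triple_iff.2 ⟨hab, hac, hbc⟩)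

/-- Exchanging an edge `ab` of a tree for `ac`, where `bc` is an edge, yields a tree. -/
theorem isTree_of_exchange [Finite V] {G H : SimpleGraph V} (hG : G.IsTree) {a b c : V}
    (hab : G.Adj a b) (hbc : G.Adj b c) (hca : a ≠ c)
    (hE : H.edgeSet = (G.edgeSet \ {s(a, b)}) ∪ {s(a, c)}) : H.IsTree := by
  classical
  have := Fintype.ofFinite V
  have hac : ¬ G.Adj a c := not_adj_of_isTree hG hab hbc
  have mem : ∀ u v, H.Adj u v ↔ (G.Adj u v ∧ s(u, v) ≠ s(a, b)) ∨ s(u, v) = s(a, c) := by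
    intro u v
    rw [← mem_edgeSet, hE]
    rfl
  have hHac : H.Adj a c := (mem a c).2 (Or.inr rfl)
  have hHbc : H.Adj b c := (mem b c).2 (Or.inl ⟨hbc, by
    intro h
    have := hab.ne
    grind⟩)
  rw [isTree_iff_connected_and_card] at hG ⊢
  refine ⟨?_, ?_⟩
  -- The lost edge `ab` is replaced by the walk `a, c, b` in `H`; the number of edges does not
  -- change.
  · have key : ∀ u v, G.Adj u v → H.Reachable u v := by
      intro u v huv
      by_cases h : s(u, v) = s(a, b)
      · have hr : H.Reachable a b := hHac.reachable.trans hHbc.symm.reachable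
        rcases Sym2.eq_iff.1 h with ⟨rfl, rfl⟩ | ⟨rfl, rfl⟩
        · exact hr
        · exact hr.symm
      · exact ((mem u v).2 (Or.inl ⟨huv, h⟩)).reachable
    have := hG.1.nonempty
    refine ⟨fun u v => ?_⟩
    obtain ⟨w⟩ := hG.1.preconnected u v
    induction w with
    | nil => exact Reachable.refl _
    | cons h _ ih => exact (key _ _ h).trans ih
  · rw [← hG.2, hE]
    congr 1
    rw [Nat.card_coe_set_eq, Nat.card_coe_set_eq, Set.union_singleton,
      Set.ncard_insert_of_notMem, Set.ncard_sdiff_singleton_of_mem (by exact hab)]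
    · have : 0 < G.edgeSet.ncard := (Set.ncard_pos (Set.toFinite _)).2 ⟨s(a, b), hab⟩
      omega
    · simp [hac]

/-! ### Parent functions -/

/-- The graph on `Fin n` in which every vertex `v ≠ 0` is joined to `q v`. -/
def parentGraph (n : ℕ) (q : ℕ → ℕ) : SimpleGraph (Fin n) where
  Adj u v := u ≠ v ∧ ((u.val ≠ 0 ∧ q u = v) ∨ (v.val ≠ 0 ∧ q v = u))
  symm := ⟨fun _ _ h => ⟨h.1.symm, h.2.symm⟩⟩
  loopless := ⟨fun _ h => h.1 rfl⟩

theorem parentGraph_adj {n : ℕ} {q : ℕ → ℕ} {u v : Fin n} : (parentGraph n q).Adj u v ↔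
    u ≠ v ∧ ((u.val ≠ 0 ∧ q u = v) ∨ (v.val ≠ 0 ∧ q v = u)) := Iff.rfl

/-- `q` is a parent function on `{0, …, n - 1}` with root `0` and depth at most `d`. -/
structure IsParent (n d : ℕ) (q : ℕ → ℕ) : Prop where
  lt : ∀ v < n, q v < n
  zero : q 0 = 0
  rooted : ∀ v < n, q^[d] v = 0

theorem iterate_eq_zero_of_le {q : ℕ → ℕ} (h0 : q 0 = 0) {v i j : ℕ} (h : q^[i] v = 0)
    (hij : i ≤ j) : q^[j] v = 0 := by
  obtain ⟨k, rfl⟩ := Nat.exists_eq_add_of_le hij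
  rw [add_comm, Function.iterate_add_apply, h]
  exact Function.iterate_fixed h0 k

/-- No vertex other than the root lies on a cycle of a parent function. -/
theorem IsParent.iterate_ne {n d : ℕ} {q : ℕ → ℕ} (h : IsParent n d q) {v : ℕ} (hv : v < n)
    (hv0 : v ≠ 0) (k : ℕ) : q^[k + 1] v ≠ v := by
  intro hk
  -- A cycle of length `k + 1` through `v` returns to `v` after `(k + 1) * d` steps, by which time
  -- the root has been reached.
  have h1 : ∀ m, q^[(k + 1) * m] v = v := by
    intro m
    rw [Function.iterate_mul]
    exact Function.iterate_fixed hk m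
  have h2 := iterate_eq_zero_of_le h.zero (h.rooted v hv)
    (show d ≤ (k + 1) * d from Nat.le_mul_of_pos_left d (Nat.succ_pos k))
  exact hv0 ((h1 d).symm.trans h2)

/-- Every vertex is connected to the root by its chain of parents, and every edge is the parent edge
of some vertex other than the root, which leaves at most `n - 1` edges. -/
theorem IsParent.isTree {n d : ℕ} {q : ℕ → ℕ} (hn : 0 < n) (h : IsParent n d q) :
    (parentGraph n q).IsTree := by
  classical
  have hconn : (parentGraph n q).Connected := by
    have : Nonempty (Fin n) := ⟨⟨0, hn⟩⟩
    have key : ∀ k (v : Fin n), q^[k] v = 0 → (parentGraph n q).Reachable v ⟨0, hn⟩ := by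
      intro k
      induction k with
      | zero =>
        intro v hv
        obtain rfl : v = ⟨0, hn⟩ := Fin.ext hv
        exact Reachable.refl _
      | succ k ih =>
        intro v hv
        by_cases h0 : v.val = 0
        · obtain rfl : v = ⟨0, hn⟩ := Fin.ext h0
          exact Reachable.refl _
        · have hadj : (parentGraph n q).Adj v ⟨q v, h.lt v v.2⟩ :=
            ⟨fun e => h.iterate_ne v.2 h0 0 (congrArg Fin.val e).symm, Or.inl ⟨h0, rfl⟩⟩
          exact hadj.reachable.trans (ih ⟨q v, h.lt v v.2⟩ (by simpa using hv))
    exact ⟨fun u v => (key _ u (h.rooted u u.2)).trans (key _ v (h.rooted v v.2)).symm⟩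
  rw [isTree_iff_connected_and_card]
  refine ⟨hconn, le_antisymm ?_ hconn.card_vert_le_card_edgeSet_add_one⟩
  have hsub : (parentGraph n q).edgeSet ⊆
      (fun v : Fin n => s(v, ⟨q v, h.lt v v.2⟩)) '' {v | v ≠ ⟨0, hn⟩} := by
    intro e
    induction e with
    | h u v =>
      rintro ⟨-, ⟨h0, e⟩ | ⟨h0, e⟩⟩
      · exact ⟨u, fun e' => h0 (by rw [e']), by simp [e]⟩
      · exact ⟨v, fun e' => h0 (by rw [e']), by simp [e, Sym2.eq_swap]⟩
  have h1 := Set.ncard_le_ncard hsub (Set.toFinite _)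
  have h2 := Set.ncard_image_le (f := fun v : Fin n => s(v, (⟨q v, h.lt v v.2⟩ : Fin n)))
    (Set.toFinite {v : Fin n | v ≠ ⟨0, hn⟩})
  have h3 : {v : Fin n | v ≠ ⟨0, hn⟩}.ncard = n - 1 := by
    rw [show {v : Fin n | v ≠ ⟨0, hn⟩} = {⟨0, hn⟩}ᶜ from rfl, Set.ncard_compl]
    simp
  rw [Nat.card_coe_set_eq, Nat.card_eq_fintype_card, Fintype.card_fin]
  omega

/-- Both trees have one edge fewer than there are vertices. -/
theorem eq_of_isTree_of_le {V : Type*} [Finite V] {G H : SimpleGraph V} (hG : G.IsTree)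
    (hH : H.IsTree) (h : G ≤ H) : G = H := by
  rw [isTree_iff_connected_and_card] at hG hH
  rw [← edgeSet_inj]
  refine Set.eq_of_subset_of_ncard_le (edgeSet_subset_edgeSet.2 h) ?_ (Set.toFinite _)
  rw [← Nat.card_coe_set_eq, ← Nat.card_coe_set_eq]
  omega

/-- The parent of a vertex is a neighbour nearer to the root. The resulting parent graph is a tree
contained in `G`, hence equal to it. The depth bound holds because a path has fewer edges than there
are vertices. -/
theorem exists_isParent {n : ℕ} (hn : 0 < n) {G : SimpleGraph (Fin n)} (hG : G.IsTree) :
    ∃ q : ℕ → ℕ, IsParent n (n - 1) q ∧ G = parentGraph n q := by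
  classical
  let r : Fin n := ⟨0, hn⟩
  have hstep : ∀ v : Fin n, ∃ w : Fin n, v ≠ r → G.Adj v w ∧ G.dist w r + 1 = G.dist v r := by
    intro v
    by_cases hv : v = r
    · exact ⟨v, fun h => absurd hv h⟩
    obtain ⟨p, hp⟩ := (hG.connected.preconnected v r).exists_walk_length_eq_dist
    cases p with
    | nil => exact absurd rfl hv
    | @cons _ w _ h p =>
      refine ⟨w, fun _ => ⟨h, ?_⟩⟩
      have h1 := dist_le p
      rw [Walk.length_cons] at hp
      have h2 := h.diff_dist_adj (u := r)
      rw [dist_comm (u := r) (v := w), dist_comm (u := r) (v := v)] at h2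
      omega
  choose w hw using hstep
  let q : ℕ → ℕ := fun v => if h : v < n then (if v = 0 then 0 else w ⟨v, h⟩) else 0
  have hqw : ∀ v : Fin n, v ≠ r → q v = w v := by
    intro v hv
    have : v.val ≠ 0 := fun h => hv (Fin.ext h)
    simp [q, this]
  have hq0 : q 0 = 0 := by simp [q]
  have hit : ∀ k (v : Fin n), G.dist v r = k → q^[k] v = 0 := by
    intro k
    induction k with
    | zero =>
      intro v hv
      rw [(hG.connected.preconnected v r).dist_eq_zero_iff] at hv
      rw [hv]; rfl
    | succ k ih =>
      intro v hv
      have hvr : v ≠ r := by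
        rintro rfl
        simp at hv
      rw [Function.iterate_succ_apply, hqw v hvr]
      exact ih _ (by have := (hw v hvr).2; omega)
  have hpar : IsParent n (n - 1) q := by
    refine ⟨fun v hv => ?_, hq0, fun v hv => ?_⟩
    · simp only [q, hv, dif_pos]
      split
      · exact hn
      · exact (w _).2
    · refine iterate_eq_zero_of_le hq0 (hit _ ⟨v, hv⟩ rfl) ?_
      obtain ⟨p, hp, hl⟩ := hG.connected.exists_path_of_dist ⟨v, hv⟩ r
      have := hp.length_lt
      rw [Fintype.card_fin] at this
      omega
  refine ⟨q, hpar, (eq_of_isTree_of_le (hpar.isTree hn) hG ?_).symm⟩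
  rintro u v ⟨-, ⟨h0, e⟩ | ⟨h0, e⟩⟩
  · have hu : u ≠ r := fun h => h0 (by rw [h])
    rw [hqw u hu] at e
    rw [← Fin.ext e]
    exact (hw u hu).1
  · have hu : v ≠ r := fun h => h0 (by rw [h])
    rw [hqw v hu] at e
    rw [← Fin.ext e]
    exact (hw v hu).1.symm

/-! ### Data: the orientations of all configurations, and the slide paths -/

/-- Bit `m` of the entry with index `tripleIndex i j k` is the orientation of the triple
`i < j < k` in the `m`-th configuration. -/
def orientationTable : List ℕ := [
  2163894399531684849059183759018052020301198647443953754636127064173256304872345024407213080115843841616586321892381199068702095603722999914060529300865359511860028152827634626122077212414286844537814510431118588445923231010883151201413877808548398606665762281142630609846272,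
  2163894399531684849059183759018052020301198647443953754636127064173256304872345024407213080115843841616586318206871018578915618805329854510739547224647162189243369725766114294077366987335765046013095692401636652518567458106197614747886460646568748107036152012637233188175872,
  2163894399531684849059183759018052020301198647443953754636127064132161493141498356381892846655842836416974292182825153291371776048498530051649942087940021687504815787281410579199279054508034246113999037872261361408993763344469108673445454327562631652717566270334033387847680,
  2163894399531684849059183759018052017045332225139337409870574431985142146110255999838898548672358581966177514364240539146127778771909381480274640603753217065704334129816743792742001432963835452123658843680870045836307472470459700800960319636436286442406165756494055567523840,
  2163894399531684849059183759018038687528199310040021939698098169724696561074659969328688926421647929092033879434454222298815998550321074664895622114126880962036882779824134784357183004615367664924281390040292266128025802238232173477539903482197856161995033022160269828161536,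
  2163894399531684849059183758144062035810636810336375765482747342152005525243956602454766182192282215962565142485916744090024099200592916410324372970450245160415627151698881461279147399631498282323355250232496662931453802849661496835731412747987891709611657281446389198356480,
  2163894399531684848941878808567978582463567008440423470199984383378729828163488129330326931037476053549322786248590417234589484772120078903566048746644743024822529012819261297575749938133430341398786336000545781151248585011404787955156161369076103677750846645019328789872640,
  2163894399531623347598569863556004591004113959340826660774317424388519851983073082411981821344961133635602510916109832690073397398697457918892904633378482458991150487130905790297100777024353146972891106544393384465432965748230426102227731897041285445187430911973520704536576,
  2163894397516401145691320117842439440715128545896695356695199778035019500458009328259432515582641761440768145674095318264913052622358402823524414937622367532111452242012108004127575953924660607311848772316612751556505976991602114187106273653463678415402623517326068959674368,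
  2163861381123488869981286737781494741269157641789212245176163484923110653869709141763909939300840943786587508323080619971170981324076829672175787036196713821546481028044979028227076444655625334354336462977782086535839635365174825508120493581716063088554154238429509195857920,
  2163861379108143664683589396721477541871803319300307867087085269739901215657869002091675517463209088577468619514440754490222926915858577583721599821962550503028074708739228726169167266798849629218899263016363909081871498540314356938611468003951048511190230985110650750009344,
  2163795338261061295228570964180827478896051969924078230055931817753488827523915475452091856303729414408152593161501425895208479711148435047239589336646417076257538278690522649435884635007825800627416958651112190060345392619139641310068043721851089997889903822978943880839168,
  2162870766399940063907952648860137607491886993017079165066789350727546889867925753169572802349127777244305675634941587707236739981112741454277895619390411198877387556758118195704861253917070591460047377755112446051540177254283588805541908874250799182725966104164467734542336,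
  2162606603011609675816126139402112584558052263766070912838866388028825596810085431585142096604788595442989683835684917285338490633312750184840776727473070154450127891783501684690102539293983664483270770339243606101752758434801201245418328277037910201873866730981161959482368,
  2155474191292509176437882432707968561917990615028818968035101489125659386634013141758508995753318273436265211616474643836942680469360352102429176681848740178648324880235498308895321851757875663356843508402969273314418671681692552774840140796279635186666667203932218735001344,
  2096289209758090289596576496372921649738835908808657923000491832682326192092588564860510373233304734572328712019868836920999025413410220465527855497239050266577275951317598894301339719917763076873625790590319552941280338817440945021220155923853601235108878789488901240061920,
  2084154204116545315833303517504831936992917578038652737721501190111788524087833636440755374584026721405741674335823265183629589651476350258005248031886641792751279943545187219364788500723103378271964168449270887367116031471879894549505303539212137322497860165872036589139600,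
  1927249406292956937201679958045795781974783090312238584630610412161711244464126622937800481312625806628999645707620329558370582250660099493799243681348348134640935520029830559490826391322184005013510137843110375341583542240490446962076571217053847323440139654424195859808216,
  1622945565092379080715985251308070949333753517042366910262075453291897403879032325803527363640089649689849279490998661764156423739880464892483280132897853062406086861296489500694365682985028283103305914432172255462663239162765156759942177858226289686776522758156110775779324,
  1081976092858838321299677387247428349017271196509417988401681409364765731924282793866447653576614473556337247885431484037170420537395725184288476100414005462998745762463317275969505720157124345822107509451873006654975168957613372937639689334474957504400609953301906306170878]

/-- Slide paths for 4 points. -/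
def pathsFour : List ℕ := [
  66195, 99914]

/-- Slide paths for 5 points. -/
def pathsFive : List ℕ := [
  6399562, 1661548463324, 99036, 1547, 18886453303850402524, 66195, 99548, 103644,
  99548, 1058, 6850698, 99914, 9154269678700170, 99914, 133267, 152337271192398050931914]

/-- Slide paths for 6 points. -/
def pathsSix : List ℕ := [
  143179496085578, 779162549692849074645464631695590929225101860390713419, 37120077724790163237, 6871178,
  132389, 34698430484, 140938, 9159011323926154, 2155281483433739683109, 9095847919749140,
  143109551915741, 133437448550272779151374862107763030492453, 103644, 164573492799993648195233011335973,
  99548, 54347, 154845566809163, 1417285901195399660898, 2212529047333, 71316, 71827, 137363,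
  34570765658, 2060, 28256478829907936037, 540018187, 2237160752651, 115730930263617423148837,
  1579, 2060, 131877, 2060, 166547, 133267, 68243,
  421222107733011708597518639827234875722786492513523901801825061, 2068, 2068, 99036, 6399562,
  99036, 1661548463324, 99036, 66196, 1547, 1547, 18886453303850402524, 86675, 86675,
  9316426, 9132887366698186, 132901, 66195, 66195, 66195, 2237179626145, 155386866872979,
  37408308100941795987, 9840715, 34704982681, 2068, 295072341128512805, 99548, 8796307,
  8534163, 2298428396837, 2221118981925, 115933, 6669972, 136485, 132389, 460339157440661588,
  144677, 105180, 76256540531420, 21627759871929055772856340805358589221, 27169916459, 132389,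
  2068, 136485, 1670155208779, 28256514014280025381, 120028, 104669, 27169655381, 103644,
  103644, 99548, 99548, 87260, 136997, 132901, 1058, 35912942626, 1066, 279447083,
  1066, 1058, 1058, 203511365607960463184250142196770, 1058, 1066, 2518739987344522741852, 141093,
  439794525892806730, 114944230168357, 133194, 6851210, 132901, 1795869379165, 6850698,
  6850698, 1579, 150128602224861, 6866038363785829, 99914, 99914, 2234624613084,
  2399736871859020465738, 12130147719273409014695562, 9154269678700170, 99914, 166548,
  434714678931785354, 99914, 155077629217354, 841343082080381816338674415890369162, 133267,
  3221841411083680343313805773386, 133267, 133267, 629403140694266942993901706, 166547,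
  53844666943289729653204781838858225802, 152337271192398050931914, 166620,
  3199700972640483857683946965578,
  1293665032404591482416299555006888909324915637568086471876194151697375030586680502181213386]

/-- Slide paths for seven points when the parent of `1` is `6`. -/
def pathsSevenSix : List ℕ := [
  3002990099437765880467, 16343445128210758810284105849703014965569356703185057947380298,
  159270910812109561938735081143848075780916111642304414445838409963259336183374350404851229282140597263402995555074822923371265195972039073895297602319289202622254057845100513606964752639332645405654017691234311759855416259694182784699760642977604357252810257661844714399943546995372186003019273846324744749446144927598735357784562686936880934998428236,
  780276660328549473174325614, 155489946102346, 292531432470293495859077260455343446265692777221498411215498,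
  165742, 782577144573006221531154973, 178387, 3223176065638174281140258531402, 168675495700554,
  796547507377719202298812998480988014,
  18624125184310161358011119187162561864143945928883864935345913529782697154841117,
  254169318199671660069934255203732693263906477615242, 178922213927498,
  117638704216157376819321007179233201232735031172905603840324233148901918010213266251494756207550429473648638897092618443,
  4655995986940117293163547529153754974659312309391775674652218908897793838366412932974,
  671297091714543365790878247979059741, 50362126018643678377025792586,
  4598472438944830949593734091555597725513335937867425961458094593195995431718,
  839099086353787829414789446046935557646897214130434109373319022, 2244348090519556516490,
  2525657516378606274652, 141093, 547880916949723210, 3453802712097388576043253259590575384650,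
  115906420283173, 14043021065364728081773736180331762406049416224694475317135481118033262, 115356547023654,
  132901, 166254, 43305404949, 1802311830109, 6908049, 1935217591792888350062,
  3272501264684429665866, 588820218554072453329080586657597355, 124687531173450, 46363997985925400942,
  108765, 694283020491875914, 109276, 174812, 43314055075, 2581, 480601929295128138, 165230,
  580005621095991829, 22, 631268581200783938477418058, 190459182892522795173908,
  18850071523388452424646764452675991158252463557381023378054836436995187906094730, 46921403644366030868,
  1973566027474170422971475324488995451897183810803093368358783841443415198876228303745988060578061263263123195524943433973106603,
  2776203238790168013490928600790006401390, 151090792339677, 36946053653, 200269392564423270598764,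
  9004689, 140938, 2581, 768832296856905802, 165230, 36179886668746957315747613205,
  186266574494428, 886333887088231410131428027161287388, 11553428714954768025970314,
  303273522160216592020988891925841827, 12189387702983999689853453, 2088595793546, 68356896330977321812774,
  819089422, 190789043325318705095648839698277069094206853809525, 13088017703443301741244609513654292,
  787210524136503760686417940,
  1205461973197137373377230124605066419206219185312798363547235546114476384094259212,
  781434080026884158680115083874989807909671127207807342, 2525657516237742336586, 2100, 25962220053,
  165230, 7345493925724917125614093, 2646941542538, 68956415513372882207454, 818794510,
  2820661307330946860405, 11352045914425877, 199900, 166620, 818790414, 178852269785894,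
  6981624296637201,
  14053356414251067530852696081110890931628616668163081461597763077994288833090904239467176197625370317587822,
  2589, 2589, 136485, 3453636187810114889478857643955874596718, 8529805724355101, 132389,
  2305899103893, 37533645850522682899, 11652396606670117,
  2004400975247976203036490446975964881563081966136287016335467744374413455498489791342,
  190698621324209063887726, 115933, 164718, 1748493142165, 2068, 136485, 10610094, 3230,
  132389, 2597, 27169916843, 9861820445896181089995118, 3063955046868117096532, 2068, 592597035,
  164718, 105180, 76256540531420, 29644666221508643020036849081436476709,
  46441709094822869838654224425939596636907012974, 27169917533, 4123564501545951083776886820683861067045,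
  25962220045, 99549, 2068, 43, 3421, 35778726501, 164994295705188348780938268967797, 2765,
  2095451173778042653669912567022008566638, 58444, 124124, 980527736028, 58444, 31464622172, 2076,
  58444, 11424888360011034, 1684, 1555, 2597, 58444, 166254, 104669, 2573, 1764483926613,
  103644, 7122361959319644, 2573, 82582, 25104495218500446568341410944677658936003727252665828206,
  25962219532, 2252, 58444, 2573, 3356, 82582, 99548, 15320483050, 58443, 91356,
  46652226570488472796, 58443, 58443, 43448272098, 2589, 58443, 58443, 401792350435412509,
  30, 58443, 22874686557, 2076, 136997, 10577838, 3286, 132901, 2195, 178992158141003,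
  1206396554161950647305828296282833991279800118862852542404422161352658994908443723,
  555486416381617683439418003883096750271796330810735040008413289797160276686958779298396484604232678278882565987116268288385047598639879030186,
  46363997994515335534, 40904898010514982314, 2589, 840951868363434059, 165742, 43439622685,
  14026805203998961952254706362615916, 9299161, 43604495148620465605795984459, 11387436148460061,
  50126018247690028450, 272904818877318894719976393513773506427189281686626,
  112380301592301177930852929280839930130947191080354, 235697683193873080074891611126367650,
  580005621230995981, 3189326253751508481099, 14048676711221081755373536682, 14,
  190789043325318705096282664997579401236397395478389, 2597, 18695325098, 3063936752083525961820,
  577916970, 164718, 32600519808291701858, 154135494992528672617687628781349,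
  15095695098004553883187140991033209536019068913976738, 18695326293, 132901, 2597, 58956, 166254,
  2573, 2295031401053, 71316, 4900798580918356, 1643, 42, 34, 26, 1643,
  51421119799907583386, 254162272838036878868820779935906415772762,
  30992697297628884254095547174011566030140505903319222187, 724437468798518682, 40670684467516146778,
  195344042718028812189692896319709, 2573, 339303434206533568351439461, 71827, 4935914231432787,
  2573, 36008887386, 805925188601254810496272997, 137363, 36008887386,
  236551198025437420612977279736540, 920486543535464229970689991719000133391784668,
  4060626212776964222879774548528802674283090569377748216019, 164718, 2573, 18963236435, 44733040273,
  9863562357890212049716634, 674498572, 50986430079689558028, 238858182880404177242556428, 14,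
  165475100508910435271845823580533, 18829543977, 2100, 164718, 2573, 18963499937, 44733302929,
  43179836834, 14, 2573, 199964, 166620, 101596,
  102813876012086649847564157279046348111608095363727332901742, 176815753659915, 787215836654365141612889611,
  66968009602183995841820898115810184674806347843637756590417774091, 177677536247370102522716738328784407791982,
  40616606092965447179, 17353410059, 197854, 165742, 2349984786214, 2100, 12683125,
  11387436444943883, 46760986123, 1077462288271011481099, 818499598, 2820679603204433053557,
  191049480994195011537437, 199828, 212786437327508, 818495502, 178921006039846, 1803,
  5471058089184355255878320858577390302003554379039378270578586871387411089262, 17353411085, 191052, 1582,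
  577916970, 35912944229, 165073678950217910592942312194933, 132901, 17353410572, 1574, 166254,
  164718, 107230, 1587, 42, 34, 26, 416024628, 1587, 1579, 943785307567422221646825011,
  1579, 1587, 674498572, 50988681888227395596, 241313813451496392888158220, 818499598,
  2082684020941461326197, 27438352989, 164718, 2100, 2573, 27572308060, 44752177369, 43179837347,
  818495502, 2573, 199956, 166548, 55927162992997860206, 674498572, 68755, 155086219316371,
  166547, 818491406, 2796714723340, 2252, 154110696642087294765422, 53, 9243347, 51, 2100,
  49878293913325537933, 2573, 143094362886196, 133267, 51, 166611, 133331,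
  3561145690924469363566, 11446280047954131, 199901, 140070, 133267, 818491406, 2573, 199891,
  166547, 164718, 18023713485, 2573, 68243, 1153517685980, 166620, 199900, 172910,
  190717039861707917313811, 199973, 68755,
  1314951122544154540500585469450544960362906668327646196365607194223909139112133374839925228190980471910956262848820146430425418542675397081450635347098713914918608764776561715667792014967847272188267775296366]

/-- Slide paths for seven points when the parent of `1` is `5`. -/
def pathsSevenFive : List ℕ := [
  92819, 2581, 43441195549, 140069, 13200495440066778605859067883948573, 104654152835449522227741,
  131877, 1867, 434830503820396043, 1867, 142675139528046, 2581, 680790036, 28109440939, 43,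
  189098, 2581, 2717, 131877, 676595732, 2380, 34507851788, 2581, 2581, 27170180190,
  131877, 26096437781, 99037, 2380, 1687040559116, 43, 2725, 99037, 2581, 25961958749,
  99037, 2773, 2581, 165230, 2589, 2589, 43448271882, 2589, 131877, 165742,
  143179496085578, 9159011329059914, 779536684098971104777040647936913658575852620516309067, 131877,
  37408308092351939877, 37120077724790163237, 6871178, 132389, 43582489610, 132364, 132364,
  140938, 3788515498403914, 120394, 131877, 2155281483433739715884, 99037, 166254, 132362,
  435569366885730316, 9095847919749140, 153674, 99037, 143109551915741, 13, 214594987623205,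
  133437448550272779151374862107763030492453, 678692892, 2717, 27169654876,
  123785728329256902685443913581356, 2837, 99037, 99548, 680790044, 20574373098, 2725,
  178900068131563, 2589, 2773, 131877, 54347, 2773, 17327982604, 2589, 2589, 18695588950,
  131877, 1547, 154845566809163, 836213462873548784994, 78923, 34570765682, 2212529080108,
  18695063636, 18829018707, 36008887953, 1241, 1681, 34570765658, 18829806678, 99037, 2060,
  2060, 2060, 2397, 2193, 13, 49990345703971281930140386085, 66197, 2757547788300, 2789,
  66197, 42, 2589, 17353149781, 66197, 2717, 2589, 165742, 1547, 1547, 1547,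
  540018187, 540018187, 1547, 1547, 2237160752651, 13, 214663723877157,
  115730930263617423148837, 2845, 66197, 42, 1587, 1579, 107229, 1579, 17353149781,
  66197, 2060, 2060, 2060, 2389, 1877, 131877, 2714, 166254, 13, 2060, 2060, 199891,
  44, 43659299982, 140069, 166547, 133267, 17889496270, 68243, 68243,
  421222107733011708597518639827234875722786492513523901801825061]

/-- Slide paths for seven points when the parent of `1` is `4`. -/
def pathsSevenFour : List ℕ := [
  90772, 50973804150180119238756282900947231380, 780276660760893779613967068, 92307, 2068, 2076,
  23795336971, 11424888093148939, 12, 25917654539, 676596261, 156322, 1522901617006,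
  7368652563941532, 676595732, 90772, 90772, 26096437268, 90772, 2260, 90772, 2581,
  25961696540, 99036, 99036, 678692892, 2068, 25915557387, 2204, 27169917533, 166254,
  2068, 99549, 2068, 99036, 99036, 32538362641, 180892239645861847762186,
  191087527441436122547466, 12, 1034, 1800298562321, 1034, 3444538487874370193994,
  314530236233462892543587263959321523732819854828405271949025371833994, 166254, 30486823697,
  12572445167961738, 46796341620946018316, 6399562, 6399562, 6399562, 47960072204,
  11424888223433489, 99036, 182858, 99036, 99036, 1661548463324, 131811, 2220011651804,
  1661548463324, 680790557, 687727640244806371, 46652228379256939228, 5393379739830484, 2260,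
  32404145450, 123612, 18695326293, 20689191705, 835060542202299811114, 46796341629538054156,
  1619, 1681, 166254, 3356, 2833, 2844, 2705, 99036, 25961694514, 99036, 123612,
  2204, 3330562712284, 2589, 17352887572, 66196, 66196, 66196, 66196, 47976853516,
  11424888093148939, 1547, 1547, 1547, 1547, 1547, 1547, 1547, 1547, 1587, 2100, 3348,
  1812, 2836, 1812, 1843, 2202, 199891, 166547, 166254, 2202, 2100, 12, 213362784961244,
  214486992650972, 18886453303850402524]

/-- Slide paths for seven points when the parent of `1` is `3`. -/
def pathsSevenThree : List ℕ := [
  23795073769, 90771, 177418535967026719496511712608083252439099323277971, 46508113182591115923,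
  90771, 43448271585, 2581, 123546, 90771, 23795075605, 90771, 90771, 726614482034100765,
  90771, 30, 90771, 2076, 132901, 91796, 11, 680790044, 35778726501, 165742, 2589,
  132389, 1555, 86675, 86675, 86675, 678693413, 124124, 124124, 21647591187,
  23243924046341054492, 206363908300436343211534837876138, 862665602570653577964421841,
  71515954491756420654571428086989463963089668221828334794, 191677823216610439333066, 39409355516585444049,
  3444538769289217358410, 3971289736747710162035989981835819038858, 165742, 2589, 38137234129,
  12290970191018122, 43995577929187543643803394059, 2589, 206208261836154365321227,
  472938866269615649739768529, 640219920012599307, 19, 142701367173131, 9132887499080401, 11,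
  1034, 1258, 2645, 1258, 2132, 2193, 2796752470761, 195588985504476, 670, 3339152689006,
  11455052, 43448271585, 2100, 670, 2589, 199956, 166548, 441479539726649198, 669, 132901,
  166254, 66195, 66195, 17352625363, 66195, 2771, 2100, 3283, 2259, 2771, 2259,
  2292, 98970, 66195, 98970, 66195, 66195, 66195, 66195, 4548886497856750, 66195,
  66195, 66195, 66195, 66195]

/-- Slide paths for seven points when the parent of `1` is `2`. -/
def pathsSevenTwo : List ℕ := [
  178992158173843, 294532810551061023608645841850315696018557885092372804523260253988799109923497,
  1206388412340878122325428867954578246147809125890753577129989308532988333883699859, 46652228362077112686,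
  2438122177193, 2589, 840946912105425043, 165742, 11387985702685213, 50126022638201471649,
  181113934532688092392037, 15149181425234401242151898592576161, 437193369299079554322137761, 43441719837,
  14066746101463663318586650650740908, 43756857581112002206532416147, 582257421046778389,
  46903384866792407721, 3198407762408690987667, 22, 5316274944780995482182125103407763, 2597,
  141093, 32474383835408106145, 43273351504061603814094902871197221537, 35912944229, 165230, 132901,
  2597, 91796, 91796, 51421124190419026585, 35096419963483360608170280875,
  15149172778693969907838120811561625, 731192867971138201, 108765, 40544548494632551065, 109276,
  174812, 16266488144497198487874406737506437540473035, 165230, 2581, 37063754393,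
  902657553214726400019270309, 163181249333337269047306, 2581, 1675, 187717099062566,
  7377872945286652152513177, 1707, 2653, 1707, 2140, 2265, 676595732, 733146931876071444,
  51128328643618539540, 22, 2585548483223667777410435320181, 2602, 2100, 2581, 2978,
  187785835283678, 43314053793, 22, 2581, 199964, 166620, 101596,
  25102024370392062325436100564197848821427082129492313454, 533, 2589, 2589, 132389, 1555,
  2237179626145, 155386866872979, 34704982705, 132389, 46633650462633546387, 151974381151662, 730,
  10, 34704982681, 99549, 2068, 2068, 2068, 2397, 21, 316831513775314039491134757,
  32538362537, 124124, 836063986345, 11983914266, 14020551467248726036, 166254, 3356, 2844,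
  99548, 26095911601, 99548, 99548, 681, 681]

/-- Slide paths for seven points when the parent of `1` is `0`. -/
def pathsSevenZero : List ℕ := [
  183390204684947, 178992158173843, 998472565420400743319306730990083787645894539216341652,
  974519375679212798604969089901637704467561362265131668, 47805149952583308654, 46508113182591191406,
  9267923, 9267923, 531091810524071763, 147716223101075, 169838, 197342, 165742,
  3065065878011625158111208579899334300619122054997, 165717, 178387, 178387, 6362000843795155,
  6362000848501395, 40324640790, 2829905227676874085742, 37533645859055994387, 38686567364314792982,
  2829905227049691449205, 2669733909545555234596752460373, 7466323, 47977148438, 203868457800998,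
  2795659593235, 9519915629807443, 81964162285440745020709,
  1230909451698029688673777074110202808088673171396164525449543834986438627013334894, 3644903918217450752052,
  13582667656300405, 11387848763902493, 48056306389058847766, 178922213999910, 233275021737074264050764,
  227878178190061448890956, 177686309191659366098481972967166139598702, 91797, 2388,
  108804783184382523141714111255846, 3302, 36986686117, 36986686117, 31465147486,
  170145521709021773075210452538741, 165074919308108837454825130231157, 91797, 1582, 31465147486,
  18578357541, 136997, 561139753, 120030, 2221135792716, 132901, 91796, 91796, 1574,
  91796, 3358, 2837, 103654952927918404253604242375902, 3310, 171308, 115934, 33, 115934,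
  165230, 2325623948161290327603964936528331325609324222805, 195056275408532, 195056275408532,
  1510837205254733301675, 1510837206489502844843, 22, 1877430216201546701173, 51713148948,
  29334847136126469142, 2772099598709, 28512094877, 28512094877, 40073956454,
  129097848197968179219781042509173, 1584642477345631111075, 28646049948, 28646049948, 45825919194,
  45825919194, 44387796899, 43314055075, 22, 492459371988433693914434133, 51713149461,
  47609023598, 7690182823862421500812212, 270328207306717818063171289694830392939886, 35778988084,
  165230, 29352865932682200086, 2581, 169326, 2793003943206, 55927198177369949550,
  533336133367390751519244652305975380, 5448460233750901, 46920187926, 53443178866199234644,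
  2796733597716, 2388, 81962865266065236237533,
  78537415131864188254431951140584429038142972927481647260939349159859752646267635796,
  957940527012678649940805171, 13654135910061422, 40073956454, 18595138781, 104669, 41,
  3813518688420820945621, 52, 38463081061, 55642949740,
  6473613874981179980883076533097728161712941371110694, 930432343519436011, 37926471796, 25,
  592601139, 165230, 38210719766, 722509455201142578867604053, 2581, 46535281774, 2305953455027,
  57243943064177907054, 103646, 165230, 2837, 21486068638011087077831084757,
  4354059242571401571109848801015151056256259833892703169404044266547487371506417482496772409941,
  121854592145326752664181, 311974728581618396, 105180, 33, 311693169970519267,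
  168979492596104779168791553116789, 170716, 25, 432429583300060586368042161064254757,
  173926272924880505651473521320624428176743994380542874574457279716572,
  156972040202324360901685442322110679505039533078343387201429016289396421065613654529663855672797624999132,
  8197466178059703388725450592892962492091024715932660640356798765301921027097520887987454161956431876624713633754464124545552984572281527626020503983222405466304426614527695241552922717566606025588429510562803246611186073593657364626406024778328832828916426298529134,
  105692, 76333849976028, 1489127925775148093884857982325727911496555169844, 165230,
  960396158011051323342194227, 2246613404181, 52, 727113779, 132390, 27706787371,
  76333866753245, 6087775836723441692828178497342165027854435497805363, 9956385687472703019, 27170178611,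
  37768684462900675950, 676595732, 48074325185614578710, 2796733597716, 233874540953829680286795,
  55634034965850359828, 154110698893895698385262, 152870, 2592545260509830677726, 51, 2100,
  38722604957426254870, 2581, 169326, 1670172019275, 165230, 61465661066528957101851282005,
  3316046891541, 195006558588980, 1670171985995, 51, 138533, 1280690036833941326027,
  23223027964498697129507715618544147700115477870, 40780184735253549647070, 199901, 136486,
  478873010272929078208267630, 2581, 199900, 166620, 199900, 169326,
  552097546980511684485986653514656988818179366, 101596,
  630175167029382878815337658619941160848692008222628904230356334, 113954458967525860298071832945957, 2388,
  2789, 2789, 32538626653, 2589, 2845, 32538626653, 1070, 136485, 559042601, 32538626653,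
  2589, 132389, 132389, 548789549684754259, 40324640789, 147577542743958, 8796307,
  2305899103253, 2237179627027, 8534163, 9484799977195347, 21, 2298428396837, 136485,
  2298428396837, 11652396606670117, 1555, 1045, 132389, 9131758685620012, 2221118981925, 2845,
  2845, 203572, 3350, 115933, 115933, 115933, 33, 41147435621, 21, 111903561161110,
  6669972, 1748493141013, 2068, 35778726998, 136485, 136485, 1045, 132389, 132389, 2789,
  41147435621, 2597, 27169916459, 424529961, 2388, 21, 460339157440661588, 27169917012,
  460339157440661588, 3063955046868117096532, 2068, 38329125990, 894965947906071283, 3562345598166,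
  144677, 144677, 592597035, 25, 4213064915785822273939102876665982884646, 3350, 27572309102,
  105180, 105180, 60752529875096571094, 38419236497570925678, 76256540531420, 76256540531420,
  6536589332400055265231034526510184789515412024656370509024342, 103645, 136485,
  21627759316093978133846979640194897189, 21669298246797334393884584775992349989, 27572831795,
  743461932141905451, 27169916459, 27169916459, 132389, 132389, 132389, 41147435621, 99549,
  99549, 1045, 2068, 2068, 2068, 43, 138022, 38988950645414562902, 136485, 136485,
  99549, 37421160957149, 1670155208779, 28398658936843142437, 28256514014280025381,
  6792205840003793154073820, 124124, 124124, 38, 124124, 1062, 32538363996, 124124, 203125,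
  37, 120028, 120028, 31464622172, 2076, 548477288365688595, 47977148436, 47977148436,
  11706363204339475, 11424888360011034, 20, 1044, 1044, 1555, 1555, 1254,
  6746270350694041152653925, 2597, 46803717230, 53211978675, 4223862662196419402314547117640210618734,
  27438614067, 166254, 27438353510, 104669, 104669, 20, 103644, 7122362274679381,
  27169655381, 27169655381, 1764483926613, 103644, 27169655894, 103644, 103644, 103644,
  2286324288598, 27169654836, 103644, 23967564902, 170350, 166475, 166254, 1125, 1044,
  99548, 99548, 99548, 99548, 99548, 99548, 99548, 99548,
  386542164199580929179595914096138171357160668, 2111721964778, 2796752471274, 195597575472348,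
  195597575472348, 30, 57174607493760902364, 1054, 23948428382, 56021685920434578652, 40208174182,
  891032994847070069, 2034295375074, 11455124, 11455124, 44522013922, 43448272098, 30,
  6740957688686694299601501, 1054, 47743241326, 53094767540,
  5228911207207724123762215056205825708840271453686425536563459037038, 35913205812, 165742, 23948690526,
  2589, 169838, 2793003943718, 441479539726649198, 41281653349, 29, 87260, 87260,
  22874686557, 2076, 35912944734, 136997, 136997, 1117, 132901, 132901, 1043, 1043, 1043,
  1074, 1066, 5300118820918127346844714, 1074, 1066, 4283733, 1066, 41, 1074, 44522013738,
  1066, 17, 1058, 4656569878053922, 1058, 71799303903892, 1058, 33, 1058, 1058, 17,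
  36315595810, 320406502320374826, 88870445680750544628921508421336014783522,
  118128435061204929245495278878328009140366448457614003445391328367626542384162, 1058, 4656569464129588,
  1058, 1074, 1066, 5037732333213709309051954, 593446831146, 1074, 1074, 1066, 41, 17,
  36181640226, 1058, 1058, 1058, 1058, 9414362984350754, 1066, 35912943636, 35912942626,
  67754, 1066, 18695324714, 1066, 1074, 1074, 44656231466, 1058, 1058, 2581, 18695063604,
  1066, 1066, 1050, 25, 1555, 17, 279447083, 279447083, 11706363141424683, 281544243,
  279446554, 407635499, 1050, 1050, 2581, 18829018675, 1555, 1555, 2589, 36008887346,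
  275252258, 407635491, 277349402, 542115868, 407635491, 542115868, 73805134039092,
  281544243, 18963236403, 44733039666, 279447083, 17891329579, 26496205866,
  4721335909749482268081020631215770253344617586375407699499, 279447083, 281544243, 1074, 1074, 1066,
  11402768456181017655124119289070642, 2769904469034, 1074, 1066, 1066, 40508519670655222826, 1066,
  1066, 1058, 834400468488486918992430130, 1058, 1058, 46702658008283874338, 1058, 1058, 1058,
  1058, 11726566669681698, 1058, 786279553719003320574805034, 15741778014194733897224518113952802,
  3414354139259724167295533683664652600354,
  3901557481681919557971698015504954666969041758609881961835915204597187157399897113634,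
  203511365607960463184250142196770, 1058, 1058, 1058, 254840866512778148530039600710690, 1058, 1074,
  1074, 1066, 1066, 1066, 254850789375914768813526815867946, 1066, 1074,
  60140286002979801411287302381940081110735296357, 49227563306620290698, 235679566508218573859341124765265,
  10668764, 238670694383590699994186, 48107652154212629465570377895077171545662273129034,
  4366493553505259362821472873580394958480559073631989839711139530844, 166474, 2518884102532732815452,
  2780689500526, 153382, 137809, 164692681449525, 150678475544430, 150128602286666,
  39875843078431966858, 190035498662540431577602445280849, 173934, 9487526322235279946, 169838,
  166474, 109706, 165742, 62722943902122927818411608733,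
  806923481744364060752350810892293007683303608409079155293, 745988148, 170065, 142629,
  1953996195593059338314, 544445371970087585331473261401516117520983918,
  627694367111282030922501432825080993178756739802250064068381258, 723215635852258427198186071865198666,
  577921074, 13008945201352265619703297114564703795582118736757603650537546, 36986947636,
  439799482285066314, 165742, 3280608435219605626877656776230438043674480744988867562077, 2589,
  51263914482824831028, 11077777, 133194, 550006145550265752945858830550469194, 712433714,
  5095162979000890116855840879584714424904319446949697241031049775690, 138533, 2469370122482110040202,
  262235218855467595645492994626738292451017938326576984921966, 2430618631800970, 199829, 115502693357350,
  2234624673646, 3109179912891438467677, 2589, 173934, 7378612063908444585888330, 2229725727380,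
  199828, 115502693390190, 3189797111651730944998909282086, 6851722, 37626574724709648238,
  41281653386, 41281653349, 170350, 6851210, 1674, 2704476468193044765245933033884,
  7503755103700561, 2518739987344522741852, 2518739987344522741852, 142118,
  699894553549450969560550334998442444874, 40144123915475094686, 141093, 577916970, 141093,
  123791153933200361998536157957214, 9469507379650398282, 439794525892806730, 138022,
  32353924510092544429754158174, 6883985, 114944230168357, 115494103422757, 2230410, 133194,
  175242, 1796003597406, 199828, 6883985, 6851210, 132901, 132901, 132901, 32691718282,
  8569937921837137, 174446, 41726736783019615817316327000650, 170350, 166474, 142474, 166254,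
  1674, 138022, 1928300063418870830965, 7468570866091601, 1795869379165, 1795869379165, 138533,
  1795869379678, 6850698, 6850698, 6883473, 1795869379678, 199829, 6883473, 6850698, 1579,
  101107, 1579, 50, 1587, 42, 34, 26, 34, 26, 416024628, 50, 42, 26,
  9011988019, 1587, 1579, 1579, 4105742541066911328086456498362765805099, 1579, 1579,
  9011988019, 1587, 56010005998406374276433297206399208037, 28123294239725932595, 106680830499038,
  99914, 1820916233949700721226, 714530866, 30544846314583726515000740426, 1800487905999464793738,
  132065016888953805991927829225143959460206, 2359150384360074, 199829, 150687065413854, 99914,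
  42257444813205977855859100774, 150678475479261, 150128602224861, 150678475479261, 28123294231133896755,
  106680830499550, 28123293680304308267, 28123293138066755619, 99914, 6866038363785829,
  6866038363785829, 106680830500061, 99978, 6866038630647924, 8488522, 99914, 99914,
  6866038365883494, 140938, 99914, 99914, 50, 42, 34, 2100, 2399736872417366214282,
  4149146898991739714170121206830836357926, 7293263849302466757921902, 141873792522972, 178156485057244,
  2234624613084, 215836, 107282427911388, 9829322222269071860697717, 151745402914927219481308,
  2399736871859020465738, 2545865402319794369234974416165, 3414333046145319756617238996121244769500,
  2733602160071929800435060064714462797020, 15621429194468040016395218693686922, 12130147719273409014695562,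
  1780581994458609982684, 2399736872417366214218, 199829, 32242476328404508454018371548855961226,
  9154269678700170, 99914, 3266016080421028301972, 7831133367804628285483137418500830, 99914,
  6866038500363374, 173706, 99914, 99914, 166548, 166548, 3865744617908798402991696677450,
  166548, 166548, 7831123464322083710931858532441309, 1800487905999464793674, 199828,
  1522958471169229791779888447837326105643556444274878174770324739910030224164685450, 434714678931785354,
  99914, 99914, 6980277654031434, 434715228687599242, 99914, 53556410268910879768125639333,
  87855271964488259558913075476126116508848081515006833817645678436649076627155717309258533477, 178542,
  9839555317839370072951443, 74339355848600938669801047946229153178302876671035902611,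
  2611140340247100041582, 5845590780469316015683716439743144552073802, 166547, 2601914997893998251155,
  16903083638553828878795966257017490608658798, 190125570542588867425482, 155086219152458,
  734969302433364604586189075562138762, 166254, 40652670033554050214, 155627502505041, 155077629250129,
  155077629217354, 1041532288083070786901765242185919810487141937639951010928004198, 199827,
  841343082080381816338678813936913041, 841343082080381816338674415890369162, 2100, 3201436150597215726374,
  133267, 9158039224716462, 133267, 133267, 133267, 2794195135781, 50341272069584090756823517331,
  68882575578747664826201129849184833990593383498, 3221841409921535466670104021578,
  3221841411083680343313805773386, 133267, 133267, 3865589573163047043701623785546, 133267, 133267,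
  133267, 199901, 163571266901876409481724396866634, 133267, 133267, 3192210808252703902867,
  16947320346253551036206561505920597560007462, 779163348717402462729433330795213490834830700087348334,
  174218, 205402131300800423010794555902097, 629403140694266942993901706, 166547, 166547,
  3865744315677325203460916808266, 166547, 166547, 3459514886038149597709564590103334100261,
  3436934017887912833115131120741216233349936568251257870713949986085, 199827,
  5905132199041103998361610176449611553175337127958496449442368004574507627772828747914,
  53844666943289729653204781838858225802, 629403140694266942993934474, 199901,
  3833702780646775144219133643850, 3315340410892693916797909777576957980764423930310620380694666,
  152337271192398050931914, 195219618335891, 16947321699217036659801124924072684209343562,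
  539409859295458398060440265129602006406257519627209839065668325076154315919441758552703457173291141708161269631133632975141962550410,
  166620, 3866984977552165951869556952211, 166620, 166620, 166620,
  13202140662428490064561564062616138, 199900, 18196684923295777267691095434884329927740585324612682,
  3199700972640483857683946965578, 3199700972640483857683946965578,
  7310266897655028946953033986267139986776129636558838108739308946110560626036147457414965698197114731335294069386,
  199900, 3833683433111294827212899912778,
  8428086389001715727481325319820597657357709852282318773834488239101634012963210703707063585302065554609999634721004987052299560138,
  521347329413318780946690328718566144580933319888643146394502740387509164351131928726910154, 199973,
  3843606641635528056904171457683,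
  13086670343320069881720931434337709877047119804931080030835589387636846710239237652836687085079626,
  11380582643430840667827010987811246287933231431539854010066315739741069935582275107488727533237398366980803468299278001405269738385812031318354052785829692995210198631752979752704776586257568146049250248259236518175382195082466387677976240498554746262835145120282579796199949239665358603200362635417747361832793966761635430247848162089205019850]
/-! ### The search for slide paths

Trees are coded by parent functions, and all point configurations are treated at once by masks. The
definitions use recursors and operations that the kernel evaluates efficiently. -/

/-- `if b then x else y`, by the recursor of `Bool`. -/
noncomputable def sel {β : Type} (b : Bool) (x y : β) : β := Bool.rec y x b

/-- `k x`, arranged so that the kernel evaluates `x` before it is passed to `k`. -/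
noncomputable def force {β : Type} (x : ℕ) (k : ℕ → β) : β :=
  Nat.rec (k 0) (fun m _ => k (Nat.succ m)) x

/-- Entry `i` of `l`, or `0`. -/
noncomputable def nth (l : List ℕ) : ℕ → ℕ :=
  List.rec (fun _ => 0) (fun h _ ih i => Nat.rec h (fun j _ => ih j) i) l

/-- The number with bits `0, …, k - 1`. -/
def allOnes (k : ℕ) : ℕ := Nat.sub (Nat.pow 2 k) 1

/-- The mask of all configurations. A mask is a set of configurations, as the bits of a number. -/
def fullMask : ℕ := allOnes 908

/-- The position of `1 ≤ i < j < k` in the colexicographic order. -/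
def tripleIndex (i j k : ℕ) : ℕ :=
  (i - 1) + (j - 1) * (j - 2) / 2 + (k - 1) * (k - 2) * (k - 3) / 6

/-- The configurations in which `i < j < k` are in counterclockwise order. -/
noncomputable def sortedMask (i j k : ℕ) : ℕ :=
  sel (Nat.beq i 0) fullMask (nth orientationTable (tripleIndex i j k))

/-- The configurations in which `a, b, c` are in counterclockwise order. -/
noncomputable def orientationMask (a b c : ℕ) : ℕ :=
  sel (Nat.blt a b)
    (sel (Nat.blt b c) (sortedMask a b c)
      (sel (Nat.blt a c) (Nat.xor fullMask (sortedMask a c b)) (sortedMask c a b)))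
    (sel (Nat.blt a c) (Nat.xor fullMask (sortedMask b a c))
      (sel (Nat.blt b c) (sortedMask b c a) (Nat.xor fullMask (sortedMask c b a))))

/-- The configurations in which the distinct edges `ab`, `cd` do not cross. -/
noncomputable def noncrossMask (a b c d : ℕ) : ℕ :=
  sel (Nat.beq a c || Nat.beq a d || Nat.beq b c || Nat.beq b d) fullMask
    (Nat.xor fullMask (Nat.land (Nat.xor (orientationMask a b c) (orientationMask a b d))
      (Nat.xor (orientationMask c d a) (orientationMask c d b))))

/-- The configurations in which no point `p < n` lies in the triangle `abc`. -/
noncomputable def emptyMask (n a b c : ℕ) : ℕ :=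
  Nat.rec fullMask (fun p acc =>
    sel (Nat.beq p a || Nat.beq p b || Nat.beq p c) acc
      (Nat.land acc (Nat.lor (Nat.xor (orientationMask a b p) (orientationMask b c p))
        (Nat.xor (orientationMask b c p) (orientationMask c a p))))) n

/-- The parent of `v` in the tree coded by the octal digits of `P`. -/
def par (P v : ℕ) : ℕ := Nat.land (Nat.shiftRight P (Nat.mul 3 v)) 7

/-- The code `P` with the parent of `x` changed to `y`. -/
def put (P x y : ℕ) : ℕ := Nat.xor P (Nat.shiftLeft (Nat.xor (par P x) y) (Nat.mul 3 x))

/-- The configurations of `mask` in which `xy` crosses none of the edges at `1, …, k` in `P`. -/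
noncomputable def planeMask (P x y mask k : ℕ) : ℕ :=
  Nat.rec mask (fun w acc => force (par P (Nat.succ w)) fun u =>
    Nat.land acc (noncrossMask x y (Nat.succ w) u)) k

/-- The sets of children of the vertices, eight bits for each. -/
noncomputable def childCode (P k : ℕ) : ℕ :=
  Nat.rec 0 (fun w acc => Nat.lor acc
    (Nat.shiftLeft 1 (Nat.add (Nat.mul 8 (par P (Nat.succ w))) (Nat.succ w)))) k

/-- The set of children of `v`. -/
def children (C v : ℕ) : ℕ := Nat.land (Nat.shiftRight C (Nat.mul 8 v)) 255

/-- The number `r` without its lowest bit. -/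
def dropBit (r : ℕ) : ℕ := Nat.land r (Nat.sub r 1)

/-- The set of non-leaf vertices. -/
noncomputable def innerMask (C k : ℕ) : ℕ :=
  Nat.rec (sel (Nat.beq (force (children C 0) dropBit) 0) 0 1)
    (fun w acc => sel (Nat.beq (children C (Nat.succ w)) 0) acc
      (Nat.lor acc (Nat.shiftLeft 1 (Nat.succ w)))) k

/-- The number `r` has at most two bits. -/
noncomputable def atMostTwo (r : ℕ) : Bool :=
  force r fun r => force (dropBit r) fun r => Nat.beq (dropBit r) 0

/-- No vertex of the tree `P` on `0, …, k` has three non-leaf neighbours. -/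
noncomputable def isCat (P k : ℕ) : Bool :=
  force (childCode P k) fun C => force (innerMask C k) fun I =>
    Nat.rec (atMostTwo (Nat.land I (children C 0)))
      (fun w acc => sel acc (atMostTwo (Nat.land I (Nat.lor (children C (Nat.succ w))
        (Nat.shiftLeft 1 (par P (Nat.succ w)))))) false) k

/-- The configurations of `mask` in which `x` can slide along `b` to the parent of `b`. -/
noncomputable def upMask (n P x b mask : ℕ) : ℕ :=
  force (par P b) fun c => force (planeMask P x c (Nat.land mask (emptyMask n x b c)) (n - 1))
    fun cover => sel (Nat.beq cover 0) 0
      (force (put P x c) fun P' => sel (isCat P' (n - 1)) cover 0)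

/-- The configurations of `mask` in which no vertex `1, …, k` can slide up. -/
noncomputable def upRem (n P mask k : ℕ) : ℕ :=
  Nat.rec mask (fun x r => force r fun r => sel (Nat.beq r 0) 0
    (force (par P (Nat.succ x)) fun b => sel (Nat.beq b 0) r
      (Nat.xor r (Nat.land r (upMask n P (Nat.succ x) b r))))) k

/-- The distance of a vertex from the root. -/
noncomputable def depth (P fuel : ℕ) : ℕ → ℕ :=
  Nat.rec (fun _ => 1000) (fun _ ih v => sel (Nat.beq v 0) 0
    (force (par P v) fun u => Nat.succ (ih u))) fuel

/-- The sum of the depths of `1, …, k`. -/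
noncomputable def depthSum (P k : ℕ) : ℕ :=
  Nat.rec 0 (fun w acc => Nat.add acc (depth P 7 (Nat.succ w))) k

/-- The first tree precedes the second: its depth sum is smaller, or equal with a smaller code. -/
noncomputable def lower (P' P k : ℕ) : Bool :=
  force (depthSum P' k) fun s' => force (depthSum P k) fun s =>
    sel (Nat.blt s' s) true (sel (Nat.beq s' s) (Nat.blt P' P) false)

/-- The slide paths in `c` lead from `P` to trees preceding it, for all configurations in `rem`. A
step `xy` is coded by two octal digits, and the end of a path by two zeros. -/
noncomputable def walk (n P : ℕ) (fuel : ℕ) : ℕ → ℕ → ℕ → ℕ → Bool :=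
  Nat.rec (fun _ _ _ _ => false) (fun _ ih c rem Q mask =>
    force (Nat.land c 63) fun d => force (Nat.shiftRight c 6) fun c' =>
    sel (Nat.beq d 0)
      (sel (lower Q P (n - 1))
        (force (Nat.xor rem (Nat.land rem mask)) fun rem' =>
          sel (Nat.beq rem' 0) true (ih c' rem' P rem'))
        false)
      (force (Nat.shiftRight d 3) fun x => force (Nat.land d 7) fun y =>
       force (par Q x) fun b => force (par Q b) fun pb => force (par Q y) fun py =>
        sel (Nat.beq x 0 || Nat.beq x y || Nat.beq pb x || Nat.ble n x || Nat.ble n y) false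
        (sel ((!Nat.beq b 0 && !Nat.beq b y && Nat.beq pb y) ||
            (!Nat.beq y 0 && !Nat.beq y b && Nat.beq py b))
          (force (put Q x y) fun Q' => sel (isCat Q' (n - 1))
            (force (planeMask Q x y (Nat.land mask (emptyMask n x b y)) (n - 1)) fun mask' =>
              ih c' rem Q' mask') false)
          (sel (!Nat.beq y 0 && Nat.beq b y && !Nat.beq py y && !Nat.beq (par Q py) y)
            (force (put (put Q x py) y x) fun Q' => sel (isCat Q' (n - 1))
              (force (planeMask Q x py (Nat.land mask (emptyMask n x b py)) (n - 1)) fun mask' =>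
                ih c' rem Q' mask') false)
            false)))) fuel

/-- In every configuration of `mask` the tree `P` is the star, or can be improved by a slide up or by
a path from `L`. -/
noncomputable def leaf (n P mask : ℕ) (L : List ℕ) (cont : List ℕ → Bool) : Bool :=
  sel (Nat.beq P 0) (cont L)
    (force (upRem n P mask (n - 1)) fun rem => sel (Nat.beq rem 0) (cont L)
      (List.rec false (fun c L' _ => sel (walk n P 200 c rem P rem) (cont L') false) L))

/-- The ancestor of a vertex after `fuel` steps. -/
noncomputable def root (P fuel : ℕ) : ℕ → ℕ :=
  Nat.rec (fun v => v) (fun _ ih v => force (par P v) fun u => ih u) fuel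

/-- Continue with the parent `u` for `v`, unless this closes a cycle or creates a crossing. -/
noncomputable def branch (v P mask u : ℕ)
    (go : ℕ → ℕ → List ℕ → (List ℕ → Bool) → Bool) (L : List ℕ) (cont : List ℕ → Bool) : Bool :=
  sel (Nat.beq (root P v u) v) (cont L)
    (force (planeMask P v u mask (v - 1)) fun mask' => sel (Nat.beq mask' 0) (cont L)
      (force (put P v u) fun P' => go P' mask' L cont))

/-- Continue with each of the parents `u < k` for `v`. -/
noncomputable def branches (v P mask : ℕ) (go : ℕ → ℕ → List ℕ → (List ℕ → Bool) → Bool) (k : ℕ) :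
    List ℕ → (List ℕ → Bool) → Bool :=
  Nat.rec (fun L cont => cont L)
    (fun u ih L cont => branch v P mask u go L fun L' => ih L' cont) k

/-- Check all plane trees that extend `P`, in which the last `k` vertices have no parent yet. -/
noncomputable def search (n k : ℕ) : ℕ → ℕ → List ℕ → (List ℕ → Bool) → Bool :=
  Nat.rec (fun P mask L cont => leaf n P mask L cont)
    (fun k go P mask => force (n - Nat.succ k) fun v => branches v P mask go n) k

/-- The code in which every vertex is its own parent. -/
noncomputable def selfLoops (n : ℕ) : ℕ := Nat.rec 0 (fun v P => put P v v) n

/-! ### Bits of masks and octal digits of codes -/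

theorem force_eq {β : Type} (x : ℕ) (k : ℕ → β) : force x k = k x := by
  cases x <;> rfl

theorem sel_eq {β : Type} (b : Bool) (x y : β) : sel b x y = if b = true then x else y := by
  cases b <;> rfl

theorem testBit_land (a b i : ℕ) : (Nat.land a b).testBit i = (a.testBit i && b.testBit i) :=
  Nat.testBit_and a b i

theorem testBit_lor (a b i : ℕ) : (Nat.lor a b).testBit i = (a.testBit i || b.testBit i) :=
  Nat.testBit_or a b i

theorem testBit_xor (a b i : ℕ) :
    (Nat.xor a b).testBit i = (a.testBit i ^^ b.testBit i) :=
  Nat.testBit_xor a b i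

theorem testBit_allOnes (k m : ℕ) : (allOnes k).testBit m = decide (m < k) :=
  Nat.testBit_two_pow_sub_one k m

theorem testBit_fullMask {m : ℕ} : fullMask.testBit m = decide (m < 908) := by
  unfold fullMask
  rw [testBit_allOnes]

theorem testBit_par (P v i : ℕ) :
    (par P v).testBit i = (P.testBit (3 * v + i) && decide (i < 3)) := by
  unfold par
  rw [testBit_land, show (7 : ℕ) = 2 ^ 3 - 1 from rfl, Nat.testBit_two_pow_sub_one]
  congr 1
  exact Nat.testBit_shiftRight P

theorem par_lt (P v : ℕ) : par P v < 8 := by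
  apply Nat.lt_pow_two_of_testBit (n := 3)
  intro i hi
  rw [testBit_par]
  simp [hi]

/-- The exclusive or with `par P x` and `y`, moved to digit `x`, replaces that digit; both numbers
have only three bits, so no other digit is touched. -/
theorem par_put (P x : ℕ) {y : ℕ} (hy : y < 8) (w : ℕ) :
    par (put P x y) w = if w = x then y else par P w := by
  have hbig : ∀ z < 8, ∀ i, 3 ≤ i → z.testBit i = false := by
    intro z hz i hi
    exact Nat.testBit_lt_two_pow
      (lt_of_lt_of_le hz (Nat.pow_le_pow_right (n := 2) (by norm_num) hi))
  have hput : ∀ j, (put P x y).testBit j =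
      (P.testBit j ^^ (decide (3 * x ≤ j) &&
        ((par P x).testBit (j - 3 * x) ^^ y.testBit (j - 3 * x)))) := by
    intro j
    unfold put
    rw [testBit_xor]
    congr 1
    rw [← testBit_xor]
    exact Nat.testBit_shiftLeft _
  apply Nat.eq_of_testBit_eq
  intro i
  rw [testBit_par, hput]
  by_cases hi : i < 3
  · split_ifs with hw
    · subst hw
      rw [show 3 * w + i - 3 * w = i by omega, testBit_par]
      simp [hi]
    · rw [testBit_par P w]
      rcases lt_or_gt_of_ne hw with h | h
      · rw [decide_eq_false (show ¬ 3 * x ≤ 3 * w + i by omega)]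
        simp [hi]
      · rw [hbig _ (par_lt P x) _ (by omega), hbig y hy _ (by omega)]
        simp [hi]
  · split_ifs with hw
    · rw [hbig y hy i (by omega)]
      simp [hi]
    · rw [hbig _ (par_lt P w) i (by omega)]
      simp [hi]

theorem eq_of_par_eq {P Q : ℕ} (h : ∀ v, par P v = par Q v) : P = Q := by
  apply Nat.eq_of_testBit_eq
  intro j
  have := congrArg (fun z => z.testBit (j % 3)) (h (j / 3))
  simp only [testBit_par] at this
  rw [show 3 * (j / 3) + j % 3 = j by omega, decide_eq_true (Nat.mod_lt j (by norm_num))] at this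
  simpa using this

theorem par_zero (v : ℕ) : par 0 v = 0 := by
  apply Nat.eq_of_testBit_eq
  intro i
  rw [testBit_par]
  simp

theorem par_selfLoops {n : ℕ} (hn : n ≤ 8) (v : ℕ) :
    par (selfLoops n) v = if v < n then v else 0 := by
  induction n with
  | zero => exact par_zero v
  | succ k ih =>
    change par (put (selfLoops k) k k) v = _
    rw [par_put _ _ (by omega), ih (by omega)]
    split_ifs <;> omega

/-! ### Masks and the positions of points -/

/-- The points `f 0, …, f (n - 1)` have the orientations of the `m`-th configuration. -/
structure Realizes (n m : ℕ) (f : ℕ → Plane) : Prop where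
  lt : m < 908
  le_seven : n ≤ 7
  inj : ∀ i j, i < n → j < n → f i = f j → i = j
  ne_zero : ∀ i j k, i < n → j < n → k < n → i ≠ j → i ≠ k → j ≠ k →
    det (f i) (f j) (f k) ≠ 0
  bit : ∀ i j k, i < j → j < k → k < n →
    (sortedMask i j k).testBit m = decide (0 < det (f i) (f j) (f k))

variable {n m : ℕ} {f : ℕ → Plane}

theorem decide_neg_det {x : ℝ} (hx : x ≠ 0) : (true ^^ decide (0 < x)) = decide (0 < -x) := by
  rcases lt_or_gt_of_ne hx with h | h
  · rw [decide_eq_false (by linarith), decide_eq_true (by linarith)]; rfl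
  · rw [decide_eq_true h, decide_eq_false (by linarith)]; rfl

/-- The table lists increasing triples only. An even permutation of the points keeps the
orientation, and an odd one reverses it, which complements the mask. -/
theorem Realizes.orientation (h : Realizes n m f) {a b c : ℕ} (ha : a < n) (hb : b < n)
    (hc : c < n) (hab : a ≠ b) (hac : a ≠ c) (hbc : b ≠ c) :
    (orientationMask a b c).testBit m = decide (0 < det (f a) (f b) (f c)) := by
  have hneg : ∀ i j k, i < j → j < k → k < n →
      (Nat.xor fullMask (sortedMask i j k)).testBit m = decide (0 < -det (f i) (f j) (f k)) := by
    intro i j k hij hjk hk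
    rw [testBit_xor, testBit_fullMask, decide_eq_true h.lt, h.bit i j k hij hjk hk,
      decide_neg_det (h.ne_zero i j k (by omega) (by omega) hk (by omega) (by omega) (by omega))]
  unfold orientationMask
  simp only [sel_eq, Nat.blt_eq]
  split_ifs with h1 h2 h3 h4 h5
  · rw [h.bit _ _ _ h1 h2 hc]
  · rw [hneg _ _ _ h3 (by omega) hb, ← det_swap_right]
  · rw [h.bit _ _ _ (by omega) h1 hb, ← det_rotate (f c)]
  · rw [hneg _ _ _ (by omega) h4 hc, ← det_swap_left]
  · rw [h.bit _ _ _ h5 (by omega) ha, det_rotate]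
  · rw [hneg _ _ _ (by omega) (by omega) ha, det_swap_left, det_rotate, neg_neg]

/-- Two edges meet at most in a common endpoint. -/
def Compatible (f : ℕ → Plane) (a b c d : ℕ) : Prop :=
  segment ℝ (f a) (f b) ∩ segment ℝ (f c) (f d) ⊆ {f a, f b} ∩ {f c, f d}

theorem Compatible.symm {a b c d : ℕ} (h : Compatible f a b c d) : Compatible f c d a b := by
  unfold Compatible at *
  rwa [Set.inter_comm, Set.inter_comm {f c, f d}]

theorem Compatible.swap_left {a b c d : ℕ} (h : Compatible f a b c d) : Compatible f b a c d := by
  unfold Compatible at *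
  rwa [segment_symm, Set.pair_comm]

theorem Compatible.swap_right {a b c d : ℕ} (h : Compatible f a b c d) :
    Compatible f a b d c := h.symm.swap_left.symm

theorem Realizes.compatible_of_common (h : Realizes n m f) {a b d : ℕ} (ha : a < n) (hb : b < n)
    (hd : d < n) (hab : a ≠ b) (had : a ≠ d) (hbd : b ≠ d) : Compatible f a b a d := by
  rintro x ⟨hx, hy⟩
  rw [eq_of_mem_segment_inter hx hy (h.ne_zero a b d ha hb hd hab had hbd)]
  simp

theorem mul_neg_iff_decide {x y : ℝ} (hx : x ≠ 0) (hy : y ≠ 0) :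
    x * y < 0 ↔ (decide (0 < x) ^^ decide (0 < y)) = true := by
  rcases lt_or_gt_of_ne hx with h | h <;> rcases lt_or_gt_of_ne hy with h' | h'
  · simp [h.not_gt, h'.not_gt, (mul_pos_of_neg_of_neg h h').le]
  · simp [h.not_gt, h', mul_neg_of_neg_of_pos h h']
  · simp [h, h'.not_gt, mul_neg_of_pos_of_neg h h']
  · simp [h, h', (mul_pos h h').le]

/-- Edges with one common endpoint never overlap in general position. Disjoint edges meet exactly if
each separates the endpoints of the other. Equal edges have to be excluded: their mask is full,
although the segments overlap. -/
theorem Realizes.noncross_iff (h : Realizes n m f) {a b c d : ℕ} (ha : a < n) (hb : b < n)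
    (hc : c < n) (hd : d < n) (hab : a ≠ b) (hcd : c ≠ d)
    (hne : ¬ ((a = c ∧ b = d) ∨ (a = d ∧ b = c))) :
    (noncrossMask a b c d).testBit m = true ↔ Compatible f a b c d := by
  unfold noncrossMask
  rw [sel_eq]
  split_ifs with hs
  · rw [testBit_fullMask, decide_eq_true h.lt]
    simp only [true_iff]
    simp only [Bool.or_eq_true, Nat.beq_eq] at hs
    rcases hs with ((rfl | rfl) | rfl) | rfl
    · exact h.compatible_of_common ha hb hd hab hcd (by tauto)
    · exact (h.compatible_of_common ha hb hc hab (by tauto) (by tauto)).swap_right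
    · exact (h.compatible_of_common hb ha hd (by tauto) hcd (by tauto)).swap_left
    · exact (h.compatible_of_common hb ha hc (by tauto) (by tauto) (by tauto)).swap_left.swap_right
  · simp only [Bool.or_eq_true, Nat.beq_eq, not_or] at hs
    obtain ⟨⟨⟨hac, had⟩, hbc⟩, hbd⟩ := hs
    have n1 := h.ne_zero a b c ha hb hc hab hac hbc
    have n2 := h.ne_zero a b d ha hb hd hab had hbd
    have n3 := h.ne_zero c d a hc hd ha hcd (Ne.symm hac) (Ne.symm had)
    have n4 := h.ne_zero c d b hc hd hb hcd (Ne.symm hbc) (Ne.symm hbd)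
    rw [testBit_xor, testBit_land, testBit_xor, testBit_xor, testBit_fullMask,
      decide_eq_true h.lt, h.orientation ha hb hc hab hac hbc, h.orientation ha hb hd hab had hbd,
      h.orientation hc hd ha hcd (Ne.symm hac) (Ne.symm had),
      h.orientation hc hd hb hcd (Ne.symm hbc) (Ne.symm hbd)]
    simp only [Bool.true_xor, Bool.not_eq_true', Bool.and_eq_false_iff]
    rw [← Bool.not_eq_true, ← Bool.not_eq_true, ← mul_neg_iff_decide n1 n2,
      ← mul_neg_iff_decide n3 n4]
    constructor
    · rintro hno x ⟨hx, hy⟩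
      exfalso
      rcases hno with hno | hno
      · exact hno (det_mul_neg_of_segment_inter hx hy n1 n2)
      · exact hno (det_mul_neg_of_segment_inter hy hx n3 n4)
    · intro hcomp
      by_contra hcon
      push Not at hcon
      obtain ⟨x, hx, hy⟩ := exists_mem_segment_inter hcon.1 hcon.2
      obtain ⟨h1, h2⟩ := hcomp ⟨hx, hy⟩
      simp only [Set.mem_insert_iff, Set.mem_singleton_iff] at h1 h2
      rcases h1 with rfl | rfl <;> rcases h2 with h2 | h2
      · exact hac (h.inj _ _ ha hc h2)
      · exact had (h.inj _ _ ha hd h2)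
      · exact hbc (h.inj _ _ hb hc h2)
      · exact hbd (h.inj _ _ hb hd h2)

/-- The triangle `abc` contains no further point. -/
def EmptyAt (n : ℕ) (f : ℕ → Plane) (a b c : ℕ) : Prop :=
  ∀ p < n, f p ∈ convexHull ℝ ({f a, f b, f c} : Set Plane) → p = a ∨ p = b ∨ p = c

theorem testBit_emptyMask {a b c k : ℕ} (hb : (emptyMask k a b c).testBit m = true) (p : ℕ)
    (hp : p < k) (hpa : p ≠ a) (hpb : p ≠ b) (hpc : p ≠ c) :
    ((orientationMask a b p).testBit m ^^ (orientationMask b c p).testBit m) = true ∨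
      ((orientationMask b c p).testBit m ^^ (orientationMask c a p).testBit m) = true := by
  induction k with
  | zero => omega
  | succ k ih =>
    change (sel (Nat.beq k a || Nat.beq k b || Nat.beq k c) (emptyMask k a b c)
      (Nat.land (emptyMask k a b c)
        (Nat.lor (Nat.xor (orientationMask a b k) (orientationMask b c k))
        (Nat.xor (orientationMask b c k) (orientationMask c a k))))).testBit m = true at hb
    rw [sel_eq] at hb
    by_cases hpk : p = k
    · subst hpk
      rw [if_neg (by simp [hpa, hpb, hpc]), testBit_land, testBit_lor, testBit_xor,
        testBit_xor] at hb
      simp only [Bool.and_eq_true, Bool.or_eq_true] at hb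
      exact hb.2
    · apply ih _ (by omega)
      split_ifs at hb
      · exact hb
      · rw [testBit_land, Bool.and_eq_true] at hb
        exact hb.1

/-- A point of the triangle is on the same side of the three directed sides, whereas the mask
records two sides on which it differs. -/
theorem Realizes.emptyAt (h : Realizes n m f) {a b c : ℕ} (ha : a < n) (hb : b < n) (hc : c < n)
    (hab : a ≠ b) (hac : a ≠ c) (hbc : b ≠ c) (hbit : (emptyMask n a b c).testBit m = true) :
    EmptyAt n f a b c := by
  intro p hp hmem
  by_contra hcon
  push Not at hcon
  obtain ⟨hpa, hpb, hpc⟩ := hcon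
  have hbit' := testBit_emptyMask hbit p hp hpa hpb hpc
  rw [h.orientation ha hb hp hab hpa.symm hpb.symm, h.orientation hb hc hp hbc hpb.symm hpc.symm,
    h.orientation hc ha hp hac.symm hpc.symm hpa.symm] at hbit'
  have n1 := h.ne_zero a b p ha hb hp hab hpa.symm hpb.symm
  have n2 := h.ne_zero b c p hb hc hp hbc hpb.symm hpc.symm
  have n3 := h.ne_zero c a p hc ha hp hac.symm hpc.symm hpa.symm
  rw [← mul_neg_iff_decide n1 n2, ← mul_neg_iff_decide n2 n3] at hbit'
  have hD := h.ne_zero a b c ha hb hc hab hac hbc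
  have d1 := det_nonneg_of_mem_convexHull hmem
  have d2 : 0 ≤ det (f b) (f c) (f a) * det (f b) (f c) (f p) :=
    det_nonneg_of_mem_convexHull (by
      convert hmem using 2
      ext; simp; tauto)
  have d3 : 0 ≤ det (f c) (f a) (f b) * det (f c) (f a) (f p) :=
    det_nonneg_of_mem_convexHull (by
      convert hmem using 2
      ext; simp; tauto)
  rw [det_rotate] at d2
  rw [← det_rotate] at d3
  have key : ∀ D x y : ℝ, D ≠ 0 → 0 ≤ D * x → 0 ≤ D * y → x * y < 0 → False := by
    intro D x y hD hx hy hxy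
    have h1 : 0 ≤ (D * x) * (D * y) := mul_nonneg hx hy
    have h2 : 0 < D * D := mul_self_pos.2 hD
    nlinarith [mul_pos h2 (neg_pos.2 hxy)]
  rcases hbit' with h1 | h1
  · exact key _ _ _ hD d1 d2 h1
  · exact key _ _ _ hD d2 d3 h1

/-! ### The caterpillar test -/

theorem testBit_shiftLeft_one (i j : ℕ) : (Nat.shiftLeft 1 i).testBit j = decide (i = j) := by
  have : Nat.shiftLeft 1 i = 2 ^ i := by
    change 1 <<< i = 2 ^ i
    rw [Nat.shiftLeft_eq, one_mul]
  rw [this, Nat.testBit_two_pow]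

/-- Only this inclusion is needed: superfluous bits could only make the test `isCat` harder to pass.
-/
theorem testBit_childCode {P k w : ℕ} (hw : 0 < w) (hwk : w ≤ k) :
    (childCode P k).testBit (8 * par P w + w) = true := by
  induction k with
  | zero => omega
  | succ k ih =>
    change (Nat.lor (childCode P k)
      (Nat.shiftLeft 1 (8 * par P (k + 1) + (k + 1)))).testBit _ = true
    rw [testBit_lor, testBit_shiftLeft_one, Bool.or_eq_true]
    rcases Nat.lt_or_ge k w with h | h
    · obtain rfl : w = k + 1 := by omega
      simp
    · exact Or.inl (ih h)

theorem testBit_children (C v w : ℕ) :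
    (children C v).testBit w = (C.testBit (8 * v + w) && decide (w < 8)) := by
  unfold children
  rw [testBit_land, show (255 : ℕ) = 2 ^ 8 - 1 from rfl, Nat.testBit_two_pow_sub_one]
  congr 1
  exact Nat.testBit_shiftRight C

theorem testBit_children_childCode {P k w : ℕ} (hw : 0 < w) (hwk : w ≤ k) (hw8 : w < 8) :
    (children (childCode P k) (par P w)).testBit w = true := by
  rw [testBit_children, testBit_childCode hw hwk, decide_eq_true hw8]
  rfl

theorem children_lt (C v : ℕ) : children C v < 256 := by
  apply Nat.lt_pow_two_of_testBit (n := 8)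
  intro i hi
  rw [testBit_children]
  simp [hi]

/-- Clearing the lowest set bit keeps one of any two set bits. -/
theorem testBit_dropBit (r : ℕ) (hr : r < 256) (i : ℕ) (hi : i < 8) (j : ℕ) (hj : j < 8)
    (hij : i ≠ j) (bi : r.testBit i = true) (bj : r.testBit j = true) :
    (dropBit r).testBit i = true ∨ (dropBit r).testBit j = true := by
  have key : ∀ (r : Fin 256) (i j : Fin 8), i ≠ j → r.val.testBit i = true →
      r.val.testBit j = true →
      (dropBit r).testBit i = true ∨ (dropBit r).testBit j = true := by
    decide +kernel
  exact key ⟨r, hr⟩ ⟨i, hi⟩ ⟨j, hj⟩ (fun e => hij (congrArg Fin.val e)) bi bj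

theorem dropBit_ne_zero (r : ℕ) (hr : r < 256) (i : ℕ) (hi : i < 8) (j : ℕ) (hj : j < 8)
    (hij : i ≠ j) (bi : r.testBit i = true) (bj : r.testBit j = true) : dropBit r ≠ 0 := by
  intro h0
  have := testBit_dropBit r hr i hi j hj hij bi bj
  simp [h0] at this

theorem dropBit_lt (r : ℕ) (hr : r < 256) : dropBit r < 256 :=
  lt_of_le_of_lt Nat.and_le_left hr

/-- Clearing the lowest bit keeps one of any two of the three bits, hence at least two of them;
clearing once more keeps at least one. -/
theorem dropBit_dropBit_ne_zero {r : ℕ} (hr : r < 256) {i j k : ℕ} (hi : i < 8) (hj : j < 8)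
    (hk : k < 8) (hij : i ≠ j) (hik : i ≠ k) (hjk : j ≠ k) (bi : r.testBit i = true)
    (bj : r.testBit j = true) (bk : r.testBit k = true) : dropBit (dropBit r) ≠ 0 := by
  have h1 := testBit_dropBit r hr i hi j hj hij bi bj
  have h2 := testBit_dropBit r hr i hi k hk hik bi bk
  have h3 := testBit_dropBit r hr j hj k hk hjk bj bk
  have key := dropBit_ne_zero _ (dropBit_lt r hr)
  rcases h1 with h1 | h1
  · rcases h3 with h3 | h3
    · exact key i hi j hj hij h1 h3
    · exact key i hi k hk hik h1 h3
  · rcases h2 with h2 | h2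
    · exact key i hi j hj hij h2 h1
    · exact key j hj k hk hjk h1 h2

/-- The root has no parent, so it takes two children to make it a non-leaf; elsewhere one child is
enough. -/
theorem testBit_innerMask_zero {C k : ℕ} (h : dropBit (children C 0) ≠ 0) :
    (innerMask C k).testBit 0 = true := by
  induction k with
  | zero =>
    change (sel (Nat.beq (force (children C 0) dropBit) 0) 0 1).testBit 0 = true
    rw [sel_eq, force_eq, if_neg (by simpa using h)]
    rfl
  | succ k ih =>
    change (sel (Nat.beq (children C (k + 1)) 0) (innerMask C k)
      (Nat.lor (innerMask C k) (Nat.shiftLeft 1 (k + 1)))).testBit 0 = true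
    rw [sel_eq]
    split_ifs
    · exact ih
    · rw [testBit_lor, ih]
      rfl

theorem testBit_innerMask {C k v : ℕ} (hv : 0 < v) (hvk : v ≤ k) (h : children C v ≠ 0) :
    (innerMask C k).testBit v = true := by
  induction k with
  | zero => omega
  | succ k ih =>
    change (sel (Nat.beq (children C (k + 1)) 0) (innerMask C k)
      (Nat.lor (innerMask C k) (Nat.shiftLeft 1 (k + 1)))).testBit v = true
    rw [sel_eq]
    rcases Nat.lt_or_ge k v with hk | hk
    · obtain rfl : v = k + 1 := by omega
      rw [if_neg (by simpa using h), testBit_lor, testBit_shiftLeft_one]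
      simp
    · split_ifs
      · exact ih hk
      · rw [testBit_lor, ih hk]
        rfl

/-- The neighbours of `v` in the tree with code `P`, as a bit mask. -/
noncomputable def neighbourMask (P k v : ℕ) : ℕ :=
  if v = 0 then children (childCode P k) 0
  else Nat.lor (children (childCode P k) v) (Nat.shiftLeft 1 (par P v))

theorem dropBit_of_isCat {P k : ℕ} (h : isCat P k = true) {v : ℕ} (hv : v ≤ k) :
    dropBit (dropBit (Nat.land (innerMask (childCode P k) k) (neighbourMask P k v))) = 0 := by
  unfold isCat at h
  rw [force_eq, force_eq] at h
  have key : ∀ j, (Nat.rec (atMostTwo (Nat.land (innerMask (childCode P k) k)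
      (children (childCode P k) 0)))
      (fun w acc => sel acc (atMostTwo (Nat.land (innerMask (childCode P k) k)
        (Nat.lor (children (childCode P k) (Nat.succ w))
        (Nat.shiftLeft 1 (par P (Nat.succ w)))))) false) j : Bool) = true → ∀ v ≤ j,
      dropBit (dropBit (Nat.land (innerMask (childCode P k) k) (neighbourMask P k v))) = 0 := by
    intro j
    induction j with
    | zero =>
      intro h v hv
      obtain rfl : v = 0 := by omega
      change atMostTwo _ = true at h
      unfold atMostTwo at h
      rw [force_eq, force_eq, Nat.beq_eq] at h
      exact h
    | succ j ih =>
      intro h v hv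
      change sel _ _ _ = true at h
      rw [sel_eq] at h
      split_ifs at h with h1
      · rcases Nat.lt_or_ge j v with hj | hj
        · obtain rfl : v = j + 1 := by omega
          unfold atMostTwo at h
          rw [force_eq, force_eq, Nat.beq_eq] at h
          rw [neighbourMask, if_neg (Nat.succ_ne_zero j)]
          exact h
        · exact ih h1 v hj
  exact key k h v hv

theorem testBit_neighbourMask {n P : ℕ} (hn : n ≤ 7) {v x : Fin n}
    (h : (parentGraph n (par P)).Adj v x) : (neighbourMask P (n - 1) v).testBit x = true := by
  obtain ⟨-, ⟨h0, e⟩ | ⟨h0, e⟩⟩ := h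
  · rw [neighbourMask, if_neg h0, testBit_lor, testBit_shiftLeft_one, decide_eq_true e]
    simp
  · have := testBit_children_childCode (P := P) (k := n - 1) (w := x) (by omega) (by omega)
      (by omega)
    rw [e] at this
    unfold neighbourMask
    split_ifs with hv
    · rw [← hv]; exact this
    · rw [testBit_lor, this]; rfl

/-- Besides `v`, the non-leaf `x` has another neighbour. At the root both are children of `x`;
elsewhere at least one of them is, because the parent of `x` is unique. -/
theorem testBit_innerMask_of_not_isLeaf {n P : ℕ} (hn : n ≤ 7) {v x : Fin n}
    (h : (parentGraph n (par P)).Adj v x) (hx : ¬ IsLeaf (parentGraph n (par P)) x) :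
    (innerMask (childCode P (n - 1)) (n - 1)).testBit x = true := by
  have hother : ∃ y, (parentGraph n (par P)).Adj x y ∧ y ≠ v := by
    by_contra hcon
    push Not at hcon
    exact hx ⟨v, h.symm, hcon⟩
  obtain ⟨y, hxy, hyv⟩ := hother
  have hchild : ∀ w : Fin n, w.val ≠ 0 → par P w = x →
      (children (childCode P (n - 1)) x).testBit w = true := by
    intro w h0 e
    rw [← e]
    exact testBit_children_childCode (by omega) (by omega) (by omega)
  by_cases hx0 : x.val = 0
  · have h1 := h.symm.2
    have h2 := hxy.2
    simp only [hx0, ne_eq, not_true_eq_false, false_and, false_or] at h1 h2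
    have b1 := hchild v h1.1 (by omega)
    have b2 := hchild y h2.1 (by omega)
    rw [hx0] at b1 b2 ⊢
    exact testBit_innerMask_zero (dropBit_ne_zero _ (children_lt _ _) v (by omega) y (by omega)
      (fun e => hyv (Fin.ext e.symm)) b1 b2)
  · have hw : ∃ w : Fin n, w.val ≠ 0 ∧ par P w = x := by
      rcases h.symm.2 with ⟨-, e1⟩ | h1
      · rcases hxy.2 with ⟨-, e2⟩ | h2
        · exact absurd (Fin.ext (e2.symm.trans e1)) hyv
        · exact ⟨y, h2⟩
      · exact ⟨v, h1⟩
    obtain ⟨w, hw0, hw⟩ := hw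
    refine testBit_innerMask (by omega) (by omega) ?_
    intro h0
    have := hchild w hw0 hw
    rw [h0] at this
    simp at this

theorem isCaterpillar_of_isCat {n P : ℕ} (hn : n ≤ 7) (ht : (parentGraph n (par P)).IsTree)
    (h : isCat P (n - 1) = true) : IsCaterpillar (parentGraph n (par P)) := by
  refine isCaterpillar_of_forall ht fun v x y z hx hy hz hxy hxz hyz => ?_
  by_contra hcon
  push Not at hcon
  obtain ⟨lx, ly, lz⟩ := hcon
  have hbit : ∀ u, (parentGraph n (par P)).Adj v u → ¬ IsLeaf (parentGraph n (par P)) u →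
      (Nat.land (innerMask (childCode P (n - 1)) (n - 1))
        (neighbourMask P (n - 1) v)).testBit u = true := by
    intro u hu hl
    rw [testBit_land, testBit_innerMask_of_not_isLeaf hn hu hl, testBit_neighbourMask hn hu]
    rfl
  have hlt : Nat.land (innerMask (childCode P (n - 1)) (n - 1)) (neighbourMask P (n - 1) v)
      < 256 := by
    refine lt_of_le_of_lt Nat.and_le_right ?_
    unfold neighbourMask
    split_ifs
    · exact children_lt _ _
    · refine Nat.or_lt_two_pow (n := 8) (children_lt _ _) ?_
      change 1 <<< _ < _
      rw [Nat.shiftLeft_eq, one_mul]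
      exact Nat.pow_lt_pow_right (by norm_num) (par_lt P v)
  exact dropBit_dropBit_ne_zero hlt (i := x) (j := y) (k := z) (by omega) (by omega) (by omega)
    (fun e => hxy (Fin.ext e)) (fun e => hxz (Fin.ext e)) (fun e => hyz (Fin.ext e))
    (hbit x hx lx) (hbit y hy ly) (hbit z hz lz) (dropBit_of_isCat h (by omega))

/-! ### Slides between coded trees -/

/-- The drawing of `G` with vertex `i` at `f i` has no crossings. -/
def PlaneAt {n : ℕ} (f : ℕ → Plane) (G : SimpleGraph (Fin n)) : Prop :=
  ∀ a b c d : Fin n, G.Adj a b → G.Adj c d → s(a, b) ≠ s(c, d) → Compatible f a b c d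

/-- `H` arises from `G` by a slide, vertex `i` being placed at `f i`. -/
def SlideAt {n : ℕ} (f : ℕ → Plane) (G H : SimpleGraph (Fin n)) : Prop :=
  ∃ a b c : Fin n, G.Adj a b ∧ ¬ G.Adj a c ∧
    H.edgeSet = (G.edgeSet \ {s(a, b)}) ∪ {s(a, c)} ∧
    G.Adj b c ∧ H.Adj b c ∧ EmptyAt n f a b c

/-- A slide that leads to a plane caterpillar. -/
def Step {n : ℕ} (f : ℕ → Plane) (G H : SimpleGraph (Fin n)) : Prop :=
  SlideAt f G H ∧ PlaneAt f H ∧ IsCaterpillar H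

theorem edgeSet_ext_iff {V : Type*} {G H : SimpleGraph V} {a b c : V} :
    H.edgeSet = (G.edgeSet \ {s(a, b)}) ∪ {s(a, c)} ↔
      ∀ u v, H.Adj u v ↔ (G.Adj u v ∧ s(u, v) ≠ s(a, b)) ∨ s(u, v) = s(a, c) := by
  constructor
  · intro h u v
    rw [← mem_edgeSet, h]
    rfl
  · intro h
    ext e
    induction e with
    | h u v => exact h u v

/-- Hanging `x` from `y` instead of its parent `b` exchanges the edge `xb` for `xy`. -/
theorem edgeSet_of_update {n : ℕ} {q q' : ℕ → ℕ} {x b y : Fin n} (hx0 : x.val ≠ 0)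
    (hxb : x ≠ b) (hxy : x ≠ y) (hb : q x = b) (hbx : q b ≠ x) (hy : q' x = y)
    (hq : ∀ w, w ≠ x.val → q' w = q w) :
    (parentGraph n q').edgeSet = ((parentGraph n q).edgeSet \ {s(x, b)}) ∪ {s(x, y)} := by
  rw [edgeSet_ext_iff]
  intro u v
  simp only [parentGraph_adj, ne_eq, Sym2.eq_iff]
  have e : ∀ i j : Fin n, i = j ↔ i.val = j.val := fun i j => Fin.ext_iff
  simp only [e] at *
  have hu := hq u
  have hv := hq v
  by_cases h1 : u.val = x.val <;> by_cases h2 : v.val = x.val <;> grind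

/-- The rotation that makes `y`, the parent of `x`, a child of `x` exchanges `zy` for `zx`. -/
theorem edgeSet_of_rotate {n : ℕ} {q q' : ℕ → ℕ} {x y z : Fin n} (hx0 : x.val ≠ 0)
    (hy0 : y.val ≠ 0) (hxy : x ≠ y) (hxz : x ≠ z) (hyz : y ≠ z) (hx : q x = y) (hy : q y = z)
    (hz : q z ≠ y) (hx' : q' x = z) (hy' : q' y = x)
    (hq : ∀ w, w ≠ x.val → w ≠ y.val → q' w = q w) :
    (parentGraph n q').edgeSet = ((parentGraph n q).edgeSet \ {s(z, y)}) ∪ {s(z, x)} := by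
  rw [edgeSet_ext_iff]
  intro u v
  simp only [parentGraph_adj, ne_eq, Sym2.eq_iff]
  have e : ∀ i j : Fin n, i = j ↔ i.val = j.val := fun i j => Fin.ext_iff
  simp only [e] at *
  have hu := hq u
  have hv := hq v
  by_cases h1 : u.val = x.val <;> by_cases h2 : v.val = x.val <;>
    by_cases h3 : u.val = y.val <;> by_cases h4 : v.val = y.val <;> grind

/-- Every new edge that is compatible with the old ones keeps the drawing plane. -/
theorem planeAt_of_exchange {G H : SimpleGraph (Fin n)} (hG : PlaneAt f G) {a b c : Fin n}
    (hE : H.edgeSet = (G.edgeSet \ {s(a, b)}) ∪ {s(a, c)})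
    (hnew : ∀ u v, G.Adj u v → s(u, v) ≠ s(a, c) → Compatible f a c u v) : PlaneAt f H := by
  rw [edgeSet_ext_iff] at hE
  have hnew' : ∀ p q u v, s(p, q) = s(a, c) → G.Adj u v → s(u, v) ≠ s(a, c) →
      Compatible f p q u v := by
    intro p q u v e huv hne
    rcases Sym2.eq_iff.1 e with ⟨rfl, rfl⟩ | ⟨rfl, rfl⟩
    · exact hnew u v huv hne
    · exact (hnew u v huv hne).swap_left
  intro p q r s hpq hrs hne
  rcases (hE p q).1 hpq with ⟨h1, -⟩ | h1 <;> rcases (hE r s).1 hrs with ⟨h2, -⟩ | h2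
  · exact hG p q r s h1 h2 hne
  · exact (hnew' r s p q h2 h1 (h2 ▸ hne)).symm
  · exact hnew' p q r s h1 h2 (h1 ▸ hne.symm)
  · exact absurd (h1.trans h2.symm) hne

theorem testBit_planeMask (P x y mask k : ℕ) : (planeMask P x y mask k).testBit m = true ↔
    mask.testBit m = true ∧ ∀ w, 0 < w → w ≤ k →
      (noncrossMask x y w (par P w)).testBit m = true := by
  induction k with
  | zero =>
    change mask.testBit m = true ↔ _
    constructor
    · exact fun h => ⟨h, fun w h1 h2 => by omega⟩
    · exact fun h => h.1
  | succ k ih =>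
    change (force (par P (Nat.succ k)) fun u =>
      Nat.land (planeMask P x y mask k) (noncrossMask x y (Nat.succ k) u)).testBit m = true ↔ _
    rw [force_eq, testBit_land, Bool.and_eq_true, ih]
    constructor
    · rintro ⟨⟨h1, h2⟩, h3⟩
      refine ⟨h1, fun w hw hwk => ?_⟩
      rcases Nat.lt_or_ge k w with h | h
      · obtain rfl : w = k + 1 := by omega
        exact h3
      · exact h2 w hw h
    · rintro ⟨h1, h2⟩
      exact ⟨⟨h1, fun w hw hwk => h2 w hw (by omega)⟩, h2 _ (Nat.succ_pos k) le_rfl⟩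

/-- Every edge is recorded as the parent edge of one of its ends, and that end is one of `1, …, n -
1`. The edge that is about to be removed is tested as well, but this costs nothing since it shares
an endpoint with the new edge. -/
theorem Realizes.compatible_of_planeMask (h : Realizes n m f) {P : ℕ} {a c : Fin n} (hac : a ≠ c)
    (hbit : ∀ w, 0 < w → w ≤ n - 1 → (noncrossMask a c w (par P w)).testBit m = true)
    (u v : Fin n) (huv : (parentGraph n (par P)).Adj u v) (hne : s(u, v) ≠ s(a, c)) :
    Compatible f a c u v := by
  have key : ∀ u v : Fin n, u ≠ v → s(u, v) ≠ s(a, c) → u.val ≠ 0 → par P u = v →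
      Compatible f a c u v := by
    intro u v huv hne h0 e
    have := hbit u (by omega) (by omega)
    rw [e, h.noncross_iff a.2 c.2 u.2 v.2 (fun e => hac (Fin.ext e))
      (fun e => huv (Fin.ext e))] at this
    · exact this
    · rintro (⟨h1, h2⟩ | ⟨h1, h2⟩)
      · exact hne (by rw [Fin.ext h1, Fin.ext h2])
      · exact hne (by rw [Fin.ext h1, Fin.ext h2, Sym2.eq_swap])
  obtain ⟨h1, ⟨h0, e⟩ | ⟨h0, e⟩⟩ := huv
  · exact key u v h1 hne h0 e
  · exact (key v u h1.symm (by rwa [Sym2.eq_swap]) h0 e).swap_right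

/-- A slide between coded trees that is allowed in the `m`-th configuration. -/
theorem Realizes.step (h : Realizes n m f) {P P' : ℕ} {a b c : Fin n}
    (hT : (parentGraph n (par P)).IsTree) (hP : PlaneAt f (parentGraph n (par P)))
    (hab : (parentGraph n (par P)).Adj a b) (hbc : (parentGraph n (par P)).Adj b c) (hac : a ≠ c)
    (hE : (parentGraph n (par P')).edgeSet =
      ((parentGraph n (par P)).edgeSet \ {s(a, b)}) ∪ {s(a, c)})
    (hempty : EmptyAt n f a b c)
    (hnew : ∀ u v, (parentGraph n (par P)).Adj u v → s(u, v) ≠ s(a, c) → Compatible f a c u v)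
    (hcat : isCat P' (n - 1) = true) :
    Step f (parentGraph n (par P)) (parentGraph n (par P')) ∧
      (parentGraph n (par P')).IsTree ∧ PlaneAt f (parentGraph n (par P')) := by
  have hT' := isTree_of_exchange hT hab hbc hac hE
  have hP' := planeAt_of_exchange hP hE hnew
  refine ⟨⟨⟨a, b, c, hab, not_adj_of_isTree hT hab hbc, hE, hbc, ?_, hempty⟩, hP',
    isCaterpillar_of_isCat h.le_seven hT' hcat⟩, hT', hP'⟩
  rw [edgeSet_ext_iff] at hE
  refine (hE b c).2 (Or.inl ⟨hbc, fun e => ?_⟩)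
  rcases Sym2.eq_iff.1 e with ⟨rfl, -⟩ | ⟨-, rfl⟩
  · exact hab.ne rfl
  · exact hac rfl

theorem EmptyAt.swap {a b c : ℕ} (h : EmptyAt n f a b c) : EmptyAt n f c b a := by
  intro p hp hmem
  have := h p hp (by
    convert hmem using 2
    ext; simp; tauto)
  tauto

/-- `x` is hung from a neighbour `y` of its parent. -/
theorem Realizes.step_put (h : Realizes n m f) {P : ℕ} {x b y : ℕ} (hx : x < n) (hy : y < n)
    (hbn : b < n)
    (hT : (parentGraph n (par P)).IsTree) (hP : PlaneAt f (parentGraph n (par P)))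
    (hx0 : x ≠ 0) (hb : par P x = b) (hxb : x ≠ b) (hxy : x ≠ y) (hby : b ≠ y)
    (hbx : par P b ≠ x) (hadj : (b ≠ 0 ∧ par P b = y) ∨ (y ≠ 0 ∧ par P y = b))
    (hempty : (emptyMask n x b y).testBit m = true)
    (hbit : ∀ w, 0 < w → w ≤ n - 1 → (noncrossMask x y w (par P w)).testBit m = true)
    (hcat : isCat (put P x y) (n - 1) = true) :
    Step f (parentGraph n (par P)) (parentGraph n (par (put P x y))) ∧
      (parentGraph n (par (put P x y))).IsTree ∧
      PlaneAt f (parentGraph n (par (put P x y))) := by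
  have h7 := h.le_seven
  have hne : ∀ {i j : ℕ} (hi : i < n) (hj : j < n), i ≠ j → (⟨i, hi⟩ : Fin n) ≠ ⟨j, hj⟩ :=
    fun _ _ hij e => hij (congrArg Fin.val e)
  refine h.step (a := ⟨x, hx⟩) (b := ⟨b, hbn⟩) (c := ⟨y, hy⟩) hT hP
    ⟨hne _ _ hxb, Or.inl ⟨hx0, hb⟩⟩ ⟨hne _ _ hby, hadj⟩ (hne _ _ hxy) ?_
    (h.emptyAt hx hbn hy hxb hxy hby hempty)
    (h.compatible_of_planeMask (a := ⟨x, hx⟩) (c := ⟨y, hy⟩) (hne _ _ hxy) hbit) hcat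
  refine edgeSet_of_update hx0 (hne _ _ hxb) (hne _ _ hxy) hb hbx ?_ ?_
  · rw [par_put _ _ (by omega), if_pos rfl]
  · intro w hw
    rw [par_put _ _ (by omega), if_neg hw]

/-- The parent `y` of `x` becomes a child of `x`. -/
theorem Realizes.step_rotate (h : Realizes n m f) {P : ℕ} {x y z : ℕ} (hx : x < n) (hy : y < n)
    (hz : z < n)
    (hT : (parentGraph n (par P)).IsTree) (hP : PlaneAt f (parentGraph n (par P)))
    (hx0 : x ≠ 0) (hy0 : y ≠ 0) (hxy : x ≠ y) (hxz : x ≠ z) (hyz : y ≠ z)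
    (hpx : par P x = y) (hpy : par P y = z) (hpz : par P z ≠ y)
    (hempty : (emptyMask n x y z).testBit m = true)
    (hbit : ∀ w, 0 < w → w ≤ n - 1 → (noncrossMask x z w (par P w)).testBit m = true)
    (hcat : isCat (put (put P x z) y x) (n - 1) = true) :
    Step f (parentGraph n (par P)) (parentGraph n (par (put (put P x z) y x))) ∧
      (parentGraph n (par (put (put P x z) y x))).IsTree ∧
      PlaneAt f (parentGraph n (par (put (put P x z) y x))) := by
  have h7 := h.le_seven
  have hne : ∀ {i j : ℕ} (hi : i < n) (hj : j < n), i ≠ j → (⟨i, hi⟩ : Fin n) ≠ ⟨j, hj⟩ :=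
    fun _ _ hij e => hij (congrArg Fin.val e)
  have hE : (parentGraph n (par (put (put P x z) y x))).edgeSet =
      ((parentGraph n (par P)).edgeSet \ {s(⟨z, hz⟩, ⟨y, hy⟩)}) ∪ {s(⟨z, hz⟩, ⟨x, hx⟩)} := by
    refine edgeSet_of_rotate (x := ⟨x, hx⟩) (y := ⟨y, hy⟩) (z := ⟨z, hz⟩) hx0 hy0 (hne _ _ hxy)
      (hne _ _ hxz) (hne _ _ hyz) hpx hpy hpz ?_ ?_ ?_
    · rw [par_put _ _ (by omega), if_neg hxy, par_put _ _ (by omega), if_pos rfl]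
    · rw [par_put _ _ (by omega), if_pos rfl]
    · intro w hwx hwy
      rw [par_put _ _ (by omega), if_neg hwy, par_put _ _ (by omega), if_neg hwx]
  refine h.step hT hP ⟨hne _ _ hyz.symm, Or.inr ⟨hy0, hpy⟩⟩ ⟨hne _ _ hxy.symm, Or.inr ⟨hx0, hpx⟩⟩
    (hne _ _ hxz.symm) hE (h.emptyAt hx hy hz hxy hxz hyz hempty).swap (fun u v huv huv' => ?_) hcat
  exact (h.compatible_of_planeMask (a := ⟨x, hx⟩) (c := ⟨z, hz⟩) (hne _ _ hxz) hbit u v huv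
    (by rwa [Sym2.eq_swap (a := (⟨x, hx⟩ : Fin n))])).swap_left

/-! ### The measure -/

theorem depth_zero (P v : ℕ) : depth P 0 v = 1000 := rfl

theorem depth_succ (P k v : ℕ) :
    depth P (k + 1) v = if v = 0 then 0 else depth P k (par P v) + 1 := by
  change sel (Nat.beq v 0) 0 (force (par P v) fun u => Nat.succ (depth P k u)) = _
  rw [sel_eq, force_eq]
  simp only [Nat.beq_eq, Nat.succ_eq_add_one]

theorem depth_le {P k v : ℕ} (h : (par P)^[k] v = 0) : depth P (k + 1) v ≤ k := by
  induction k generalizing v with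
  | zero =>
    rw [depth_succ, if_pos (show v = 0 from h)]
  | succ k ih =>
    rw [depth_succ]
    split_ifs
    · exact Nat.zero_le _
    · exact Nat.succ_le_succ (ih h)

/-- If the root is not met before the fuel runs out, the default value 1000 enters the sum. -/
theorem iterate_eq_zero_of_depth {P k v : ℕ} (h0 : par P 0 = 0) (h : depth P (k + 1) v < 1000) :
    (par P)^[k] v = 0 := by
  induction k generalizing v with
  | zero =>
    rw [depth_succ] at h
    split_ifs at h with hv
    · exact hv
    · rw [depth_zero] at h
      omega
  | succ k ih =>
    rw [depth_succ] at h
    split_ifs at h with hv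
    · rw [hv]
      exact Function.iterate_fixed h0 _
    · exact ih (by omega)

theorem depth_succ_eq {P k v : ℕ} (h : depth P k v < 1000) : depth P (k + 1) v = depth P k v := by
  induction k generalizing v with
  | zero => exact absurd h (lt_irrefl 1000)
  | succ k ih =>
    rw [depth_succ] at h
    rw [depth_succ P (k + 1) v, depth_succ P k v]
    split_ifs at h ⊢
    · rfl
    · rw [ih (by omega)]

theorem depth_succ_le (P k v : ℕ) : depth P (k + 1) v ≤ depth P k v + 1 := by
  induction k generalizing v with
  | zero =>
    rw [depth_succ, depth_zero, depth_zero]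
    split_ifs <;> omega
  | succ k ih =>
    rw [depth_succ P (k + 1) v, depth_succ P k v]
    split_ifs
    · omega
    · exact Nat.succ_le_succ (ih _)

theorem depthSum_succ (P k : ℕ) : depthSum P (k + 1) = depthSum P k + depth P 7 (k + 1) := rfl

theorem depthSum_le {P k : ℕ} (h : ∀ v ≤ k, (par P)^[6] v = 0) : depthSum P k ≤ 6 * k := by
  induction k with
  | zero => exact le_rfl
  | succ k ih =>
    rw [depthSum_succ]
    have := ih fun v hv => h v (by omega)
    have : depth P 7 (k + 1) ≤ 6 := depth_le (h (k + 1) le_rfl)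
    omega

theorem depth_le_depthSum {P k v : ℕ} (hv : 0 < v) (hvk : v ≤ k) : depth P 7 v ≤ depthSum P k := by
  induction k with
  | zero => omega
  | succ k ih =>
    rw [depthSum_succ]
    rcases Nat.lt_or_ge k v with h | h
    · obtain rfl : v = k + 1 := by omega
      omega
    · have := ih h
      omega

theorem depthSum_mono {P Q k : ℕ} (h : ∀ v, depth Q 7 v ≤ depth P 7 v) :
    depthSum Q k ≤ depthSum P k := by
  induction k with
  | zero => exact le_rfl
  | succ k ih =>
    rw [depthSum_succ, depthSum_succ]
    have := h (k + 1)
    omega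

theorem depthSum_lt {P Q k x : ℕ} (h : ∀ v, depth Q 7 v ≤ depth P 7 v) (hx : 0 < x) (hxk : x ≤ k)
    (hlt : depth Q 7 x < depth P 7 x) : depthSum Q k < depthSum P k := by
  induction k with
  | zero => omega
  | succ k ih =>
    rw [depthSum_succ, depthSum_succ]
    rcases Nat.lt_or_ge k x with hk | hk
    · obtain rfl : x = k + 1 := by omega
      have := depthSum_mono (k := k) h
      omega
    · have := ih hk
      have := h (k + 1)
      omega

/-- Hanging `x` from its grandparent shortens the way to the root for `x` and the vertices below it.
The comparison is made at equal fuel. At `x` one side saves a step and so has one unit of fuel more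
left, which by `depth_succ_le` raises the value by at most one. -/
theorem depth_le_of_shortcut {P Q x : ℕ} (hbx : par P x ≠ 0) (hx : par Q x = par P (par P x))
    (hw : ∀ w, w ≠ x → par Q w = par P w) (k v : ℕ) : depth Q k v ≤ depth P k v := by
  induction k generalizing v with
  | zero => exact le_rfl
  | succ k ih =>
    rw [depth_succ, depth_succ]
    split_ifs with hv
    · exact le_rfl
    by_cases hvx : v = x
    · subst hvx
      rw [hx]
      refine Nat.succ_le_succ ((ih _).trans ?_)
      cases k with
      | zero => exact le_rfl
      | succ k =>
        rw [depth_succ P k (par P v), if_neg hbx]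
        exact depth_succ_le _ _ _
    · rw [hw v hvx]
      exact Nat.succ_le_succ (ih _)

theorem depth_lt_of_shortcut {P Q x : ℕ} (hx0 : x ≠ 0) (hbx : par P x ≠ 0)
    (hx : par Q x = par P (par P x)) (hw : ∀ w, w ≠ x → par Q w = par P w)
    (hd : depth P 7 x < 1000) : depth Q 7 x < depth P 7 x := by
  rw [depth_succ, if_neg hx0, depth_succ, if_neg hbx] at hd
  rw [depth_succ, if_neg hx0, depth_succ P 6 x, if_neg hx0, depth_succ P 5 (par P x),
    if_neg hbx, hx]
  have h1 := depth_le_of_shortcut hbx hx hw 6 (par P (par P x))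
  -- Below 1000 the value is a true depth and does not depend on the fuel.
  have h2 : depth P 6 (par P (par P x)) = depth P 5 (par P (par P x)) := depth_succ_eq (by omega)
  omega

/-! ### Coded trees -/

/-- `P` is the code of a parent function on `{0, …, n - 1}`. -/
structure IsCode (n P : ℕ) : Prop where
  parent : IsParent n 6 (par P)
  high : ∀ v, n ≤ v → par P v = 0

theorem lower_iff {P Q k : ℕ} : lower Q P k = true ↔
    depthSum Q k < depthSum P k ∨ (depthSum Q k = depthSum P k ∧ Q < P) := by
  unfold lower
  rw [force_eq, force_eq, sel_eq, sel_eq]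
  simp only [Nat.blt_eq, Nat.beq_eq]
  split_ifs <;> simp_all

/-- From the tree with code `P` a tree with a smaller code can be reached. -/
def Improvable (n : ℕ) (f : ℕ → Plane) (P : ℕ) : Prop :=
  ∃ Q, IsCode n Q ∧ lower Q P (n - 1) = true ∧ PlaneAt f (parentGraph n (par Q)) ∧
    Relation.ReflTransGen (Step f) (parentGraph n (par P)) (parentGraph n (par Q))

/-- That `Q` has no cycle need not be tested. The depth sum of `P` is at most `6 * (n - 1)`, so that
of `Q` is below 1000, and the default depth 1000 cannot occur for any vertex. -/
theorem IsCode.of_lower {P Q : ℕ} (hn : n ≤ 7) (hP : IsCode n P) (hlt : ∀ v < n, par Q v < n)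
    (h0 : par Q 0 = 0) (hhigh : ∀ v, n ≤ v → par Q v = 0) (hl : lower Q P (n - 1) = true) :
    IsCode n Q := by
  refine ⟨⟨hlt, h0, fun v hv => ?_⟩, hhigh⟩
  have h1 : depthSum P (n - 1) ≤ 6 * (n - 1) :=
    depthSum_le fun v hv => by
      by_cases h : v < n
      · exact hP.parent.rooted v h
      · obtain rfl : v = 0 := by omega
        exact Function.iterate_fixed hP.parent.zero 6
  by_cases hv0 : v = 0
  · rw [hv0]
    exact Function.iterate_fixed h0 6
  have h2 := depth_le_depthSum (P := Q) (k := n - 1) (v := v) (by omega) (by omega)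
  rw [lower_iff] at hl
  exact iterate_eq_zero_of_depth (k := 6) h0 (show depth Q 7 v < 1000 by omega)

theorem testBit_diff (r s : ℕ) :
    (Nat.xor r (Nat.land r s)).testBit m = (r.testBit m && !s.testBit m) := by
  rw [testBit_xor, testBit_land]
  cases r.testBit m <;> cases s.testBit m <;> rfl

theorem upRem_succ (P mask k : ℕ) : upRem n P mask (k + 1) =
    if upRem n P mask k = 0 then 0 else
      if par P (k + 1) = 0 then upRem n P mask k else
        Nat.xor (upRem n P mask k) (Nat.land (upRem n P mask k)
          (upMask n P (k + 1) (par P (k + 1)) (upRem n P mask k))) := by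
  change (force (upRem n P mask k) fun r => sel (Nat.beq r 0) 0
    (force (par P (Nat.succ k)) fun b => sel (Nat.beq b 0) r
      (Nat.xor r (Nat.land r (upMask n P (Nat.succ k) b r))))) = _
  rw [force_eq, sel_eq, force_eq, sel_eq]
  simp only [Nat.beq_eq]

theorem upMask_sound {P x b mask : ℕ} (h : (upMask n P x b mask).testBit m = true) :
    (emptyMask n x b (par P b)).testBit m = true ∧
    (∀ w, 0 < w → w ≤ n - 1 → (noncrossMask x (par P b) w (par P w)).testBit m = true) ∧
    isCat (put P x (par P b)) (n - 1) = true := by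
  unfold upMask at h
  simp only [force_eq, sel_eq] at h
  split_ifs at h with h1 h2
  · simp at h
  · rw [testBit_planeMask, testBit_land, Bool.and_eq_true] at h
    exact ⟨h.1.2, h.2, h2⟩
  · simp at h

/-- A configuration that has disappeared from the mask was removed at some vertex, and that vertex
can slide up in it. -/
theorem upRem_sound {P mask k : ℕ} (hmask : mask.testBit m = true)
    (h : (upRem n P mask k).testBit m = false) : ∃ x, 0 < x ∧ x ≤ k ∧ par P x ≠ 0 ∧
      (emptyMask n x (par P x) (par P (par P x))).testBit m = true ∧
      (∀ w, 0 < w → w ≤ n - 1 →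
        (noncrossMask x (par P (par P x)) w (par P w)).testBit m = true) ∧
      isCat (put P x (par P (par P x))) (n - 1) = true := by
  induction k with
  | zero =>
    change mask.testBit m = false at h
    rw [hmask] at h
    exact absurd h (by simp)
  | succ k ih =>
    by_cases hk : (upRem n P mask k).testBit m = false
    · obtain ⟨x, h1, h2, h3⟩ := ih hk
      exact ⟨x, h1, by omega, h3⟩
    rw [Bool.not_eq_false] at hk
    rw [upRem_succ] at h
    split_ifs at h with h1 h2
    · rw [h1] at hk
      simp at hk
    · rw [hk] at h
      exact absurd h (by simp)
    · rw [testBit_diff, hk, Bool.true_and, Bool.not_eq_false'] at h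
      exact ⟨k + 1, Nat.succ_pos k, le_rfl, h2, upMask_sound h⟩

theorem Realizes.improvable_of_up (h : Realizes n m f) {P x : ℕ} (hP : IsCode n P)
    (hplane : PlaneAt f (parentGraph n (par P))) (hx0 : 0 < x) (hx : x ≤ n - 1)
    (hb : par P x ≠ 0) (hempty : (emptyMask n x (par P x) (par P (par P x))).testBit m = true)
    (hbit : ∀ w, 0 < w → w ≤ n - 1 →
      (noncrossMask x (par P (par P x)) w (par P w)).testBit m = true)
    (hcat : isCat (put P x (par P (par P x))) (n - 1) = true) : Improvable n f P := by
  have h7 := h.le_seven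
  have hxn : x < n := by omega
  have hbn := hP.parent.lt x hxn
  have hcn := hP.parent.lt _ hbn
  -- A vertex, its parent and its grandparent are distinct, since a parent function has no cycle
  -- away from the root.
  have c1 : par P x ≠ x := hP.parent.iterate_ne hxn (by omega) 0
  have c2 : par P (par P x) ≠ x := hP.parent.iterate_ne hxn (by omega) 1
  have c3 : par P (par P x) ≠ par P x := hP.parent.iterate_ne hbn hb 0
  obtain ⟨s1, -, s3⟩ := h.step_put hxn hcn hbn (hP.parent.isTree (by omega)) hplane (by omega) rfl
    c1.symm c2.symm c3.symm c2 (Or.inl ⟨hb, rfl⟩) hempty hbit hcat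
  have e1 : par (put P x (par P (par P x))) x = par P (par P x) := by
    rw [par_put _ _ (by omega), if_pos rfl]
  have e2 : ∀ w, w ≠ x → par (put P x (par P (par P x))) w = par P w := by
    intro w hw
    rw [par_put _ _ (by omega), if_neg hw]
  have hd : depth P 7 x < 1000 := lt_of_le_of_lt (depth_le (hP.parent.rooted x hxn)) (by norm_num)
  have hl : lower (put P x (par P (par P x))) P (n - 1) = true :=
    lower_iff.2 (Or.inl (depthSum_lt (depth_le_of_shortcut hb e1 e2 7) hx0 hx
      (depth_lt_of_shortcut (by omega) hb e1 e2 hd)))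
  refine ⟨_, IsCode.of_lower h7 hP ?_ ?_ ?_ hl, hl, s3, Relation.ReflTransGen.single s1⟩
  · intro v hv
    rw [par_put _ _ (by omega)]
    split_ifs
    · exact hcn
    · exact hP.parent.lt v hv
  · rw [e2 0 (by omega), hP.parent.zero]
  · intro v hv
    rw [e2 v (by omega), hP.high v hv]

/-- The tree with code `Q` has been reached from that with code `P`. -/
structure Reached (n : ℕ) (f : ℕ → Plane) (P Q : ℕ) : Prop where
  path : Relation.ReflTransGen (Step f) (parentGraph n (par P)) (parentGraph n (par Q))
  tree : (parentGraph n (par Q)).IsTree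
  plane : PlaneAt f (parentGraph n (par Q))
  lt : ∀ v < n, par Q v < n
  zero : par Q 0 = 0
  high : ∀ v, n ≤ v → par Q v = 0

theorem Reached.put {P Q x y : ℕ} (h : Reached n f P Q) (hn : n ≤ 7) (hx : x < n) (hx0 : x ≠ 0)
    (hy : y < n) : (∀ v < n, par (put Q x y) v < n) ∧ par (put Q x y) 0 = 0 ∧
      ∀ v, n ≤ v → par (put Q x y) v = 0 := by
  refine ⟨fun v hv => ?_, ?_, fun v hv => ?_⟩
  · rw [par_put _ _ (by omega)]
    split_ifs
    · exact hy
    · exact h.lt v hv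
  · rw [par_put _ _ (by omega), if_neg (by omega), h.zero]
  · rw [par_put _ _ (by omega), if_neg (by omega), h.high v hv]

/-! ### Soundness of the search -/

theorem walk_succ (P k c rem Q mask : ℕ) : walk n P (k + 1) c rem Q mask =
    force (Nat.land c 63) fun d => force (Nat.shiftRight c 6) fun c' =>
    sel (Nat.beq d 0)
      (sel (lower Q P (n - 1))
        (force (Nat.xor rem (Nat.land rem mask)) fun rem' =>
          sel (Nat.beq rem' 0) true (walk n P k c' rem' P rem'))
        false)
      (force (Nat.shiftRight d 3) fun x => force (Nat.land d 7) fun y =>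
       force (par Q x) fun b => force (par Q b) fun pb => force (par Q y) fun py =>
        sel (Nat.beq x 0 || Nat.beq x y || Nat.beq pb x || Nat.ble n x || Nat.ble n y) false
        (sel ((!Nat.beq b 0 && !Nat.beq b y && Nat.beq pb y) ||
            (!Nat.beq y 0 && !Nat.beq y b && Nat.beq py b))
          (force (put Q x y) fun Q' => sel (isCat Q' (n - 1))
            (force (planeMask Q x y (Nat.land mask (emptyMask n x b y)) (n - 1)) fun mask' =>
              walk n P k c' rem Q' mask') false)
          (sel (!Nat.beq y 0 && Nat.beq b y && !Nat.beq py y && !Nat.beq (par Q py) y)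
            (force (put (put Q x py) y x) fun Q' => sel (isCat Q' (n - 1))
              (force (planeMask Q x py (Nat.land mask (emptyMask n x b py)) (n - 1)) fun mask' =>
                walk n P k c' rem Q' mask') false)
            false))) := rfl

/-- The invariant concerns the configuration `m` alone: `m` is still to be treated, and as long as
`mask` contains it the current tree `Q` has been reached from `P` by legal slides. At the end of a
path, `m` is either settled or remains in the new `rem`, and the next path starts again from `P`. -/
theorem walk_sound (h : Realizes n m f) (hn : 0 < n) {P : ℕ} (hP : IsCode n P)
    (hplane : PlaneAt f (parentGraph n (par P))) (fuel : ℕ) : ∀ c rem Q mask,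
    rem.testBit m = true → (mask.testBit m = true → Reached n f P Q) →
    walk n P fuel c rem Q mask = true → Improvable n f P := by
  have h7 := h.le_seven
  induction fuel with
  | zero =>
    intro c rem Q mask _ _ hw
    exact absurd hw (by change ¬ false = true; simp)
  | succ k ih =>
    intro c rem Q mask hrem hQ hw
    rw [walk_succ] at hw
    simp only [force_eq, sel_eq] at hw
    by_cases hm : mask.testBit m = true
    · have hR := hQ hm
      split_ifs at hw with h1 h2 h3 h4 h5 h6 h8 h9
      · exact ⟨Q, IsCode.of_lower h7 hP hR.lt hR.zero hR.high h2, h2, hR.plane, hR.path⟩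
      · exact ⟨Q, IsCode.of_lower h7 hP hR.lt hR.zero hR.high h2, h2, hR.plane, hR.path⟩
      -- Here `y` is the parent or a child of the parent `b` of `x`, and `x` slides along the edge
      -- `by`.
      · refine ih _ _ _ _ hrem (fun hm' => ?_) hw
        rw [testBit_planeMask, testBit_land, Bool.and_eq_true] at hm'
        obtain ⟨⟨-, hempty⟩, hbit⟩ := hm'
        generalize Nat.shiftRight (Nat.land c 63) 3 = x at *
        generalize Nat.land (Nat.land c 63) 7 = y at *
        simp only [Bool.or_eq_true, Bool.and_eq_true, Nat.beq_eq, Nat.ble_eq, Bool.not_eq_true',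
          not_or, ← Bool.not_eq_true] at h4 h5
        obtain ⟨⟨⟨⟨x0, xy⟩, bx⟩, xn⟩, yn⟩ := h4
        have hbn := hR.lt x (by omega)
        have hxb : x ≠ par Q x := by
          intro e
          rw [← e, ← e] at bx
          exact bx rfl
        have hby : par Q x ≠ y := by
          rcases h5 with h5 | h5
          · exact h5.1.2
          · exact fun e => h5.1.2 e.symm
        obtain ⟨s1, s2, s3⟩ := h.step_put (x := x) (b := par Q x) (y := y) (by omega) (by omega)
          hbn hR.tree hR.plane x0 rfl hxb xy hby bx
          (h5.imp (fun e => ⟨e.1.1, e.2⟩) (fun e => ⟨e.1.1, e.2⟩)) hempty hbit h6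
        obtain ⟨t1, t2, t3⟩ := hR.put (x := x) (y := y) h7 (by omega) x0 (by omega)
        exact ⟨hR.path.tail s1, s2, s3, t1, t2, t3⟩
      -- Here `y` is the parent of `x`. The edge from `y` to its own parent slides along `yx`, so
      -- two digits of the code change.
      · refine ih _ _ _ _ hrem (fun hm' => ?_) hw
        rw [testBit_planeMask, testBit_land, Bool.and_eq_true] at hm'
        obtain ⟨⟨-, hempty⟩, hbit⟩ := hm'
        generalize Nat.shiftRight (Nat.land c 63) 3 = x at *
        generalize Nat.land (Nat.land c 63) 7 = y at *
        simp only [Bool.or_eq_true, Bool.and_eq_true, Nat.beq_eq, Nat.ble_eq, Bool.not_eq_true',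
          not_or, ← Bool.not_eq_true] at h4 h8
        obtain ⟨⟨⟨⟨x0, xy⟩, bx⟩, xn⟩, yn⟩ := h4
        obtain ⟨⟨⟨y0, hb⟩, hyz⟩, hpz⟩ := h8
        rw [hb] at hempty bx
        have hzn := hR.lt y (by omega)
        obtain ⟨s1, s2, s3⟩ := h.step_rotate (x := x) (y := y) (z := par Q y) (by omega)
          (by omega) hzn hR.tree hR.plane x0 y0 xy (Ne.symm bx) (Ne.symm hyz) hb rfl hpz hempty
          hbit h9
        obtain ⟨t1, t2, t3⟩ := hR.put (x := x) (y := par Q y) h7 (by omega) x0 hzn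
        refine ⟨hR.path.tail s1, s2, s3, fun v hv => ?_, ?_, fun v hv => ?_⟩
        · rw [par_put _ _ (by omega)]
          split_ifs
          · omega
          · exact t1 v hv
        · rw [par_put _ _ (by omega), if_neg (by omega), t2]
        · rw [par_put _ _ (by omega), if_neg (by omega), t3 v hv]
    -- A previous step of this path was illegal for `m`. Nothing is claimed about `Q` then; what
    -- matters is only that the end of the path does not remove `m` from `rem`.
    · split_ifs at hw with h1 h2 h3 h4 h5 h6 h8 h9
      · exfalso
        have := congrArg (fun z => z.testBit m) (Nat.eq_of_beq_eq_true h3)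
        simp only [testBit_diff, hrem, hm, Nat.zero_testBit] at this
        simp at this
      · refine ih _ _ _ _ ?_ (fun _ => ?_) hw
        · rw [testBit_diff, hrem]
          simpa using hm
        · exact ⟨Relation.ReflTransGen.refl, hP.parent.isTree hn, hplane, hP.parent.lt,
            hP.parent.zero, hP.high⟩
      · refine ih _ _ _ _ hrem (fun hm' => ?_) hw
        rw [testBit_planeMask, testBit_land, Bool.and_eq_true] at hm'
        exact absurd hm'.1.1 hm
      · refine ih _ _ _ _ hrem (fun hm' => ?_) hw
        rw [testBit_planeMask, testBit_land, Bool.and_eq_true] at hm'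
        exact absurd hm'.1.1 hm

theorem leaf_sound (h : Realizes n m f) {P mask : ℕ} {L : List ℕ} {cont : List ℕ → Bool}
    (hP : IsCode n P) (hplane : PlaneAt f (parentGraph n (par P))) (hn : 0 < n)
    (hmask : mask.testBit m = true) (hl : leaf n P mask L cont = true) :
    P = 0 ∨ Improvable n f P := by
  unfold leaf at hl
  simp only [force_eq, sel_eq, Nat.beq_eq] at hl
  by_cases hrem : (upRem n P mask (n - 1)).testBit m = true
  · split_ifs at hl with h1 h2
    · exact Or.inl h1
    · rw [h2] at hrem
      simp at hrem
    · cases L with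
      | nil => exact absurd hl (by simp)
      | cons c L =>
        simp only at hl
        split_ifs at hl with h3
        exact Or.inr (walk_sound h hn hP hplane 200 _ _ _ _ hrem
          (fun _ => ⟨Relation.ReflTransGen.refl, hP.parent.isTree hn, hplane, hP.parent.lt,
            hP.parent.zero, hP.high⟩) h3)
  · obtain ⟨x, h1, h2, h3, h4, h5, h6⟩ := upRem_sound hmask (by simpa using hrem)
    exact Or.inr (h.improvable_of_up hP hplane h1 h2 h3 h4 h5 h6)

/-- The unused slide paths are handed on through continuations. A successful check has called its
continuation successfully, and this shows that the remaining branches of the search were checked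
too. -/
theorem leaf_cont {P mask : ℕ} {L : List ℕ} {cont : List ℕ → Bool}
    (hl : leaf n P mask L cont = true) : ∃ L', cont L' = true := by
  unfold leaf at hl
  simp only [force_eq, sel_eq, Nat.beq_eq] at hl
  split_ifs at hl
  · exact ⟨_, hl⟩
  · exact ⟨_, hl⟩
  · cases L with
    | nil => exact absurd hl (by simp)
    | cons c L =>
      simp only at hl
      split_ifs at hl
      exact ⟨_, hl⟩

theorem search_succ (k P mask : ℕ) :
    search n (k + 1) P mask = branches (n - (k + 1)) P mask (search n k) n := by
  change (force (n - Nat.succ k) fun v => branches v P mask (search n k) n) = _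
  rw [force_eq]

theorem branches_succ (v P mask : ℕ) (go : ℕ → ℕ → List ℕ → (List ℕ → Bool) → Bool) (j : ℕ)
    (L : List ℕ) (cont : List ℕ → Bool) : branches v P mask go (j + 1) L cont =
      branch v P mask j go L fun L' => branches v P mask go j L' cont := rfl

theorem branch_cont {v P mask u : ℕ} {go : ℕ → ℕ → List ℕ → (List ℕ → Bool) → Bool}
    {L : List ℕ} {cont : List ℕ → Bool}
    (hgo : ∀ P mask L cont, go P mask L cont = true → ∃ L', cont L' = true)
    (h : branch v P mask u go L cont = true) : ∃ L', cont L' = true := by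
  unfold branch at h
  simp only [force_eq, sel_eq] at h
  split_ifs at h
  · exact ⟨_, h⟩
  · exact ⟨_, h⟩
  · exact hgo _ _ _ _ h

theorem branches_cont {v P mask j : ℕ} {go : ℕ → ℕ → List ℕ → (List ℕ → Bool) → Bool}
    {L : List ℕ} {cont : List ℕ → Bool}
    (hgo : ∀ P mask L cont, go P mask L cont = true → ∃ L', cont L' = true)
    (h : branches v P mask go j L cont = true) : ∃ L', cont L' = true := by
  induction j generalizing L with
  | zero => exact ⟨L, h⟩
  | succ j ih =>
    rw [branches_succ] at h
    obtain ⟨L', hL'⟩ := branch_cont hgo h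
    exact ih hL'

theorem search_cont (k : ℕ) : ∀ P mask L cont, search n k P mask L cont = true →
    ∃ L', cont L' = true := by
  induction k with
  | zero => exact fun P mask L cont h => leaf_cont h
  | succ k ih =>
    intro P mask L cont h
    rw [search_succ] at h
    exact branches_cont ih h

/-- Every branch of a successful search succeeds. -/
theorem exists_branch {v P mask j u : ℕ} {go : ℕ → ℕ → List ℕ → (List ℕ → Bool) → Bool}
    {L : List ℕ} {cont : List ℕ → Bool}
    (hgo : ∀ P mask L cont, go P mask L cont = true → ∃ L', cont L' = true)
    (h : branches v P mask go j L cont = true) (hu : u < j) :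
    ∃ L' cont', branch v P mask u go L' cont' = true := by
  induction j generalizing L with
  | zero => omega
  | succ j ih =>
    rw [branches_succ] at h
    rcases Nat.lt_or_ge u j with huj | huj
    · obtain ⟨L', hL'⟩ := branch_cont hgo h
      exact ih hL' huj
    · obtain rfl : u = j := by omega
      exact ⟨_, _, h⟩

theorem root_eq (P fuel v : ℕ) : root P fuel v = (par P)^[fuel] v := by
  induction fuel generalizing v with
  | zero => rfl
  | succ k ih =>
    change force (par P v) (fun u => root P k u) = _
    rw [force_eq, ih]
    rfl

/-- The parents of `1, …, n - k - 1` in `P` are those in `R`; the others are not yet chosen. -/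
def Agrees (n k R P : ℕ) : Prop :=
  ∀ v, par P v = if v < n - k then par R v else if v < n then v else 0

theorem Agrees.put {k R P : ℕ} (h : Agrees n (k + 1) R P) (hk : k + 1 < n) :
    Agrees n k R (put P (n - (k + 1)) (par R (n - (k + 1)))) := by
  intro v
  rw [par_put _ _ (par_lt _ _), h v]
  split_ifs with h1 h2 h3 h4 <;> first | rfl | omega | skip
  · rw [h1]

/-- A step in `P` is a step in `R`, or stays at a vertex whose parent is not yet chosen. -/
theorem Agrees.exists_iterate {k R P : ℕ} (h : Agrees n k R P) (hR : IsParent n 6 (par R))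
    (fuel u : ℕ) (hu : u < n) : ∃ j, (par P)^[fuel] u = (par R)^[j] u := by
  induction fuel generalizing u with
  | zero => exact ⟨0, rfl⟩
  | succ i ih =>
    rw [Function.iterate_succ_apply, h u]
    split_ifs with h1
    · obtain ⟨j, hj⟩ := ih (par R u) (hR.lt u hu)
      exact ⟨j + 1, hj⟩
    · exact ih u hu

/-- The proof follows the branch in which each vertex receives its parent in `R`. This branch is
never pruned: a cycle in the partial tree would be a cycle of `R`, and `m` survives in the mask
because `R` is drawn without crossings. It ends at the leaf `R`. -/
theorem search_sound (h : Realizes n m f) {R : ℕ} (hR : IsCode n R)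
    (hplane : PlaneAt f (parentGraph n (par R))) (k : ℕ) (hk : k < n) : ∀ P mask L cont,
    Agrees n k R P → mask.testBit m = true → search n k P mask L cont = true →
    R = 0 ∨ Improvable n f R := by
  induction k with
  | zero =>
    intro P mask L cont hP hmask hs
    obtain rfl : P = R := by
      apply eq_of_par_eq
      intro v
      rw [hP v]
      split_ifs with h1 h2
      · rfl
      · omega
      · exact (hR.high v (by omega)).symm
    exact leaf_sound h hR hplane hk hmask hs
  | succ k ih =>
    intro P mask L cont hP hmask hs
    rw [search_succ] at hs
    have hv : n - (k + 1) < n := by omega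
    have hv0 : n - (k + 1) ≠ 0 := by omega
    obtain ⟨L', cont', hb⟩ := exists_branch (search_cont k) hs (hR.parent.lt _ hv)
    unfold branch at hb
    simp only [force_eq, sel_eq, Nat.beq_eq] at hb
    have hbit : (planeMask P (n - (k + 1)) (par R (n - (k + 1))) mask
        (n - (k + 1) - 1)).testBit m = true := by
      rw [testBit_planeMask]
      refine ⟨hmask, fun w hw0 hw => ?_⟩
      have hwn : w < n := by omega
      rw [hP w, if_pos (by omega), h.noncross_iff hv (hR.parent.lt _ hv) hwn (hR.parent.lt _ hwn)
        (Ne.symm (hR.parent.iterate_ne hv hv0 0))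
        (Ne.symm (hR.parent.iterate_ne hwn (by omega) 0))]
      · refine hplane ⟨_, hv⟩ ⟨_, hR.parent.lt _ hv⟩ ⟨w, hwn⟩ ⟨_, hR.parent.lt _ hwn⟩
          ⟨fun e => hR.parent.iterate_ne hv hv0 0 (congrArg Fin.val e).symm, Or.inl ⟨hv0, rfl⟩⟩
          ⟨fun e => hR.parent.iterate_ne hwn (by omega) 0 (congrArg Fin.val e).symm,
            Or.inl ⟨by change w ≠ 0; omega, rfl⟩⟩ ?_
        intro e
        rcases Sym2.eq_iff.1 e with ⟨e1, -⟩ | ⟨e1, e2⟩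
        · have := congrArg Fin.val e1
          simp only at this
          omega
        -- If the two parent edges coincided with their ends interchanged, `w` would be its own
        -- grandparent.
        · have e1' := congrArg Fin.val e1
          have e2' := congrArg Fin.val e2
          simp only at e1' e2'
          refine hR.parent.iterate_ne hwn (by omega) 1 ?_
          rw [Function.iterate_succ_apply, Function.iterate_one, ← e1', e2']
      · rintro (⟨e1, -⟩ | ⟨e1, e2⟩)
        · omega
        · refine hR.parent.iterate_ne hwn (by omega) 1 ?_
          rw [Function.iterate_succ_apply, Function.iterate_one, ← e1, e2]
    split_ifs at hb with h1 h2
    · exfalso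
      rw [root_eq] at h1
      obtain ⟨j, hj⟩ := hP.exists_iterate hR.parent (n - (k + 1)) _ (hR.parent.lt _ hv)
      rw [hj] at h1
      exact hR.parent.iterate_ne hv hv0 j (by rw [Function.iterate_succ_apply]; exact h1)
    · rw [h2] at hbit
      simp at hbit
    · exact ih (by omega) _ _ _ _ (hP.put hk) hbit hb

/-! ### The searches -/

/-- With `n - 1` vertices to place, the search starts from the code of self-loops. The final test
that all slide paths have been used up is convenient rather than essential, as soundness holds for
any continuation. -/
theorem search_one : search 1 0 (selfLoops 1) fullMask [] (fun L => L.isEmpty) = true := by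
  decide +kernel

theorem search_two : search 2 1 (selfLoops 2) fullMask [] (fun L => L.isEmpty) = true := by
  decide +kernel

theorem search_three : search 3 2 (selfLoops 3) fullMask [] (fun L => L.isEmpty) = true := by
  decide +kernel

theorem search_four : search 4 3 (selfLoops 4) fullMask pathsFour (fun L => L.isEmpty) = true := by
  decide +kernel

theorem search_five : search 5 4 (selfLoops 5) fullMask pathsFive (fun L => L.isEmpty) = true := by
  decide +kernel

theorem search_six : search 6 5 (selfLoops 6) fullMask pathsSix (fun L => L.isEmpty) = true := by
  decide +kernel

/-- For seven points the computation is divided according to the parent of `1`, which leaves five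
vertices to place. -/
theorem search_seven_zero : search 7 5 (put (selfLoops 7) 1 0) fullMask pathsSevenZero
    (fun L => L.isEmpty) = true := by
  decide +kernel

theorem search_seven_two : search 7 5 (put (selfLoops 7) 1 2) fullMask pathsSevenTwo
    (fun L => L.isEmpty) = true := by
  decide +kernel

theorem search_seven_three : search 7 5 (put (selfLoops 7) 1 3) fullMask pathsSevenThree
    (fun L => L.isEmpty) = true := by
  decide +kernel

theorem search_seven_four : search 7 5 (put (selfLoops 7) 1 4) fullMask pathsSevenFour
    (fun L => L.isEmpty) = true := by
  decide +kernel

theorem search_seven_five : search 7 5 (put (selfLoops 7) 1 5) fullMask pathsSevenFive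
    (fun L => L.isEmpty) = true := by
  decide +kernel

theorem search_seven_six : search 7 5 (put (selfLoops 7) 1 6) fullMask pathsSevenSix
    (fun L => L.isEmpty) = true := by
  decide +kernel

/-! ### Every point set is represented in the orientation table -/

/-- The triples `i < j < k` from `{1, …, 6}`, ordered by `tripleIndex`. -/
def triples : List (ℕ × ℕ × ℕ) := [
  (1, 2, 3), (1, 2, 4), (1, 3, 4), (2, 3, 4), (1, 2, 5), (1, 3, 5), (2, 3, 5), (1, 4, 5),
  (2, 4, 5), (3, 4, 5), (1, 2, 6), (1, 3, 6), (2, 3, 6), (1, 4, 6), (2, 4, 6), (3, 4, 6),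
  (1, 5, 6), (2, 5, 6), (3, 5, 6), (4, 5, 6)]

/-- The triples of indices `p, q, r` of three of the triples `ijk, ijl, ikl, jkl` in this order,
where `i < j < k < l`, listed by their maximum. -/
def alternations : List (List (ℕ × ℕ × ℕ)) := [
  [], [], [(0, 1, 2)], [(0, 1, 3), (0, 2, 3), (1, 2, 3)], [], [(0, 4, 5)],
  [(0, 4, 6), (0, 5, 6), (4, 5, 6)], [(1, 4, 7), (2, 5, 7)],
  [(1, 4, 8), (1, 7, 8), (4, 7, 8), (3, 6, 8)],
  [(2, 5, 9), (2, 7, 9), (5, 7, 9), (3, 6, 9), (3, 8, 9), (6, 8, 9)], [], [(0, 10, 11)],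
  [(0, 10, 12), (0, 11, 12), (10, 11, 12)], [(1, 10, 13), (2, 11, 13)],
  [(1, 10, 14), (1, 13, 14), (10, 13, 14), (3, 12, 14)],
  [(2, 11, 15), (2, 13, 15), (11, 13, 15), (3, 12, 15), (3, 14, 15), (12, 14, 15)],
  [(4, 10, 16), (5, 11, 16), (7, 13, 16)],
  [(4, 10, 17), (4, 16, 17), (10, 16, 17), (6, 12, 17), (8, 14, 17)],
  [(5, 11, 18), (5, 16, 18), (11, 16, 18), (6, 12, 18), (6, 17, 18), (12, 17, 18), (9, 15, 18)],
  [(7, 13, 19), (7, 16, 19), (13, 16, 19), (8, 14, 19), (8, 17, 19), (14, 17, 19), (9, 15, 19),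
    (9, 18, 19), (15, 18, 19)]]

/-- Some entry `(p, q, r)` of `L` has equal bits `p`, `r` of `A` and a different bit `q`. -/
def alternates (L : List (ℕ × ℕ × ℕ)) (A : ℕ) : Bool :=
  L.any fun e => A.testBit e.1 == A.testBit e.2.2 && A.testBit e.1 != A.testBit e.2.1

/-- Every extension of the signs in `A` that avoids the alternations in `levels` is the sign pattern
of a configuration in `mask`. -/
noncomputable def cover (levels : List (List (ℕ × ℕ × ℕ))) : ℕ → ℕ → ℕ → Bool :=
  List.rec (fun _ _ mask => !Nat.beq mask 0) (fun L _ ih i A mask =>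
    force (Nat.lor A (Nat.shiftLeft 1 i)) fun A' =>
    force (Nat.land mask (nth orientationTable i)) fun mask' =>
    force (Nat.xor mask mask') fun mask'' =>
      sel (sel (alternates L A) true (ih (Nat.succ i) A mask''))
        (sel (alternates L A') true (ih (Nat.succ i) A' mask')) false) levels

theorem cover_cons (L : List (ℕ × ℕ × ℕ)) (levels : List (List (ℕ × ℕ × ℕ))) (i A mask : ℕ) :
    cover (L :: levels) i A mask =
      ((alternates L A ||
        cover levels (i + 1) A (Nat.xor mask (Nat.land mask (nth orientationTable i)))) &&
      (alternates L (Nat.lor A (Nat.shiftLeft 1 i)) ||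
        cover levels (i + 1) (Nat.lor A (Nat.shiftLeft 1 i))
          (Nat.land mask (nth orientationTable i)))) := by
  unfold cover
  simp only [force_eq, sel_eq]
  cases alternates L A <;> cases alternates L (Nat.lor A (Nat.shiftLeft 1 i)) <;>
    simp [Bool.and_comm]

theorem alternates_eq_false {χ : ℕ → Bool} {L : List (ℕ × ℕ × ℕ)} {i A : ℕ}
    (hA : ∀ j ≤ i, A.testBit j = χ j)
    (hL : ∀ p q r, (p, q, r) ∈ L →
      p ≤ i ∧ q ≤ i ∧ r ≤ i ∧ ¬ (χ p = χ r ∧ χ p ≠ χ q)) : alternates L A = false := by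
  unfold alternates
  rw [List.any_eq_false]
  rintro ⟨p, q, r⟩ he
  obtain ⟨hp, hq, hr, h⟩ := hL p q r he
  simp only [hA p hp, hA q hq, hA r hr]
  simpa using h

/-- Signs are decided in the order of the indices, and at each level the branch given by `χ` is
followed. It is not cut off since `χ` has no forbidden alternation; the mask at its end is nonempty,
and each of its bits is a configuration with the signs `χ`. -/
theorem cover_sound {χ : ℕ → Bool} (levels : List (List (ℕ × ℕ × ℕ))) :
    ∀ i A mask, (∀ j, A.testBit j = (decide (j < i) && χ j)) →
      (∀ t < levels.length, ∀ p q r, (p, q, r) ∈ levels.getD t [] →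
        p ≤ i + t ∧ q ≤ i + t ∧ r ≤ i + t ∧ ¬ (χ p = χ r ∧ χ p ≠ χ q)) →
      cover levels i A mask = true →
      ∃ m, mask.testBit m = true ∧
        ∀ j, i ≤ j → j < i + levels.length → (nth orientationTable j).testBit m = χ j := by
  induction levels with
  | nil =>
    intro i A mask _ _ h
    have hm : mask ≠ 0 := by
      rintro rfl
      exact Bool.noConfusion h
    obtain ⟨m, hm⟩ := Nat.exists_testBit_of_ne_zero hm
    exact ⟨m, hm, fun j h1 h2 => absurd h2 (by simpa using h1)⟩
  | cons L levels ih =>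
    intro i A mask hA hlev h
    rw [cover_cons, Bool.and_eq_true, Bool.or_eq_true, Bool.or_eq_true] at h
    have hL : ∀ p q r, (p, q, r) ∈ L →
        p ≤ i ∧ q ≤ i ∧ r ≤ i ∧ ¬ (χ p = χ r ∧ χ p ≠ χ q) := hlev 0 (by simp)
    have hlev' : ∀ t < levels.length, ∀ p q r, (p, q, r) ∈ levels.getD t [] →
        p ≤ i + 1 + t ∧ q ≤ i + 1 + t ∧ r ≤ i + 1 + t ∧ ¬ (χ p = χ r ∧ χ p ≠ χ q) := by
      intro t ht p q r he
      have := hlev (t + 1) (by simpa using ht) p q r (by simpa using he)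
      rwa [show i + 1 + t = i + (t + 1) by ring]
    have hA' : ∀ j, (Nat.lor A (Nat.shiftLeft 1 i)).testBit j =
        (A.testBit j || decide (j = i)) := by
      intro j
      rw [testBit_lor]
      congr 1
      have : (Nat.shiftLeft 1 i).testBit j = (decide (j ≥ i) && Nat.testBit 1 (j - i)) :=
        Nat.testBit_shiftLeft 1
      rw [this, Bool.eq_iff_iff]
      simp only [Bool.and_eq_true, decide_eq_true_eq, Nat.testBit_one_eq_true_iff_self_eq_zero]
      omega
    cases hχ : χ i with
    | false =>
      have hb : ∀ j, A.testBit j = (decide (j < i + 1) && χ j) := by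
        intro j
        rw [hA j]
        rcases lt_trichotomy j i with h | h | h
        · simp [h, h.trans (Nat.lt_succ_self i)]
        · simp [h, hχ]
        · simp [h.not_gt, show ¬ j < i + 1 by omega]
      have h' := h.1.resolve_left (by
        rw [alternates_eq_false (fun j hj => (hb j).trans (by simp; omega)) hL]
        simp)
      obtain ⟨m, hm, hj⟩ := ih _ _ _ hb hlev' h'
      rw [testBit_diff, Bool.and_eq_true, Bool.not_eq_true'] at hm
      refine ⟨m, hm.1, fun j h1 h2 => ?_⟩
      rcases h1.eq_or_lt with rfl | h1
      · rw [hm.2, hχ]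
      · exact hj j h1 (by simp at h2; omega)
    | true =>
      have hb : ∀ j, (Nat.lor A (Nat.shiftLeft 1 i)).testBit j = (decide (j < i + 1) && χ j) := by
        intro j
        rw [hA' j, hA j]
        rcases lt_trichotomy j i with h | h | h
        · simp [h, h.ne, h.trans (Nat.lt_succ_self i)]
        · simp [h, hχ]
        · simp [h.not_gt, h.ne', show ¬ j < i + 1 by omega]
      have h' := h.2.resolve_left (by
        rw [alternates_eq_false (fun j hj => (hb j).trans (by simp; omega)) hL]
        simp)
      obtain ⟨m, hm, hj⟩ := ih _ _ _ hb hlev' h'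
      rw [testBit_land, Bool.and_eq_true] at hm
      refine ⟨m, hm.1, fun j h1 h2 => ?_⟩
      rcases h1.eq_or_lt with rfl | h1
      · rw [hm.2, hχ]
      · exact hj j h1 (by simp at h2; omega)

/-- The triples from `1, …, n - 1` come first in the colexicographic order, and there are `(n - 1) *
(n - 2) * (n - 3) / 6` of them. Hence one table serves all `n`. -/
theorem cover_alternations : ∀ n < 8,
    cover (alternations.take ((n - 1) * (n - 2) * (n - 3) / 6)) 0 0 fullMask = true := by
  decide +kernel

set_option synthInstance.maxSize 1000 in
set_option synthInstance.maxHeartbeats 200000 in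
theorem mem_alternations : ∀ n < 8, ∀ t < (n - 1) * (n - 2) * (n - 3) / 6,
    ∀ e ∈ alternations.getD t [], e.1 ≤ t ∧ e.2.1 ≤ t ∧ e.2.2 ≤ t ∧
      ∃ l < n, ∃ k < l, ∃ j < k, ∃ i < j, 0 < i ∧
        (e = (tripleIndex i j k, tripleIndex i j l, tripleIndex i k l) ∨
          e = (tripleIndex i j k, tripleIndex i j l, tripleIndex j k l) ∨
          e = (tripleIndex i j k, tripleIndex i k l, tripleIndex j k l) ∨
          e = (tripleIndex i j l, tripleIndex i k l, tripleIndex j k l)) := by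
  decide +kernel

set_option synthInstance.maxSize 1000 in
set_option synthInstance.maxHeartbeats 200000 in
theorem getD_triples : ∀ n < 8, ∀ k < n, ∀ j < k, ∀ i < j, 0 < i →
    tripleIndex i j k < (n - 1) * (n - 2) * (n - 3) / 6 ∧
      triples.getD (tripleIndex i j k) (0, 0, 0) = (i, j, k) := by
  decide +kernel

theorem length_alternations : ∀ n < 8,
    (alternations.take ((n - 1) * (n - 2) * (n - 3) / 6)).length =
      (n - 1) * (n - 2) * (n - 3) / 6 := by
  decide +kernel

/-- The middle value `q` is a positive combination of `p` and `r`, so it cannot differ in sign from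
both. -/
theorem not_alternating {x y z p q r : ℝ} (hx : 0 < x) (hy : 0 < y) (hz : 0 < z)
    (h : x * p + z * r = y * q) :
    ¬ (decide (0 < p) = decide (0 < r) ∧ decide (0 < p) ≠ decide (0 < q)) := by
  rintro ⟨h1, h2⟩
  simp only [decide_eq_decide, ne_eq] at h1 h2
  by_cases hp : 0 < p
  · have hq : q ≤ 0 := not_lt.1 fun hq => h2 (by simp [hp, hq])
    linarith [mul_pos hx hp, mul_pos hz (h1.1 hp), mul_nonpos_of_nonneg_of_nonpos hy.le hq]
  · have hr : ¬ 0 < r := fun hr => hp (h1.2 hr)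
    have hq : 0 < q := by
      by_contra hq
      exact h2 (by simp [hp, hq])
    push Not at hp hr
    linarith [mul_pos hy hq, mul_nonpos_of_nonneg_of_nonpos hx.le hp,
      mul_nonpos_of_nonneg_of_nonpos hz.le hr]

/-- The orientations of `f 0, …, f (n - 1)`, sorted by angle around the extreme point `f 0`, are
those of one of the tabulated configurations. -/
theorem exists_realizes {n : ℕ} {f : ℕ → Plane} (hn : n ≤ 7)
    (inj : ∀ i j, i < n → j < n → f i = f j → i = j)
    (ne_zero : ∀ i j k, i < n → j < n → k < n → i ≠ j → i ≠ k → j ≠ k →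
      det (f i) (f j) (f k) ≠ 0)
    (sorted : ∀ i j, 0 < i → i < j → j < n → 0 < det (f 0) (f i) (f j)) :
    ∃ m, Realizes n m f := by
  let χ : ℕ → Bool := fun t =>
    decide (0 < det (f (triples.getD t (0, 0, 0)).1) (f (triples.getD t (0, 0, 0)).2.1)
      (f (triples.getD t (0, 0, 0)).2.2))
  have hχ : ∀ i j k, 0 < i → i < j → j < k → k < n →
      χ (tripleIndex i j k) = decide (0 < det (f i) (f j) (f k)) := by
    intro i j k h0 hij hjk hk
    simp only [χ, (getD_triples n (by omega) k hk j hjk i hij h0).2]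
  obtain ⟨m, hm, hbit⟩ := cover_sound (χ := χ) (alternations.take ((n - 1) * (n - 2) * (n - 3) / 6))
    0 0 fullMask (by simp) (by
      intro t ht p q r he
      rw [length_alternations n (by omega)] at ht
      rw [List.getD_eq_getElem?_getD, List.getElem?_take_of_lt ht,
        ← List.getD_eq_getElem?_getD] at he
      obtain ⟨hp, hq, hr, l, hl, k, hk, j, hj, i, hi, hi0, h⟩ :=
        mem_alternations n (by omega) t ht _ he
      simp only at hp hq hr
      refine ⟨by omega, by omega, by omega, ?_⟩
      have sij := sorted i j hi0 hi (by omega)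
      have sik := sorted i k hi0 (by omega) (by omega)
      have sil := sorted i l hi0 (by omega) hl
      have sjk := sorted j k (by omega) hj (by omega)
      have sjl := sorted j l (by omega) (by omega) hl
      have skl := sorted k l (by omega) hk hl
      have cijk := hχ i j k hi0 hi hj (by omega)
      have cijl := hχ i j l hi0 hi (by omega) hl
      have cikl := hχ i k l hi0 (by omega) hk hl
      have cjkl := hχ j k l (by omega) hj hk hl
      simp only [Prod.mk.injEq] at h
      -- In each case the required identity is the three-term relation between determinants in which
      -- all coefficients have the first point `f 0` and are positive by the angular order.
      rcases h with ⟨rfl, rfl, rfl⟩ | ⟨rfl, rfl, rfl⟩ | ⟨rfl, rfl, rfl⟩ | ⟨rfl, rfl, rfl⟩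
      · rw [cijk, cijl, cikl]
        exact not_alternating sil sik sij (by unfold det; ring)
      · rw [cijk, cijl, cjkl]
        exact not_alternating sjl sjk sij (by unfold det; ring)
      · rw [cijk, cikl, cjkl]
        exact not_alternating skl sjk sik (by unfold det; ring)
      · rw [cijl, cikl, cjkl]
        exact not_alternating skl sjl sil (by unfold det; ring))
    (cover_alternations n (by omega))
  rw [length_alternations n (by omega)] at hbit
  refine ⟨m, by simpa [testBit_fullMask] using hm, hn, inj, ne_zero, fun i j k hij hjk hk => ?_⟩
  unfold sortedMask
  rw [sel_eq]
  split_ifs with h0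
  · rw [hm, eq_comm, decide_eq_true_eq]
    rw [Nat.beq_eq] at h0
    rw [h0]
    exact sorted j k (by omega) hjk hk
  · rw [Nat.beq_eq] at h0
    rw [hbit _ (Nat.zero_le _) (by
      have := (getD_triples n (by omega) k hk j hjk i hij (by omega)).1
      omega), hχ i j k (by omega) hij hjk hk]

/-! ### Reaching the star -/

theorem agrees_selfLoops {R : ℕ} (hn : 0 < n) (hn7 : n ≤ 7) (hR : IsCode n R) :
    Agrees n (n - 1) R (selfLoops n) := by
  intro v
  rw [par_selfLoops (by omega)]
  by_cases hv : v = 0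
  · subst hv
    rw [hR.parent.zero]
    simp
  · rw [if_neg (show ¬ v < n - (n - 1) by omega)]

theorem Realizes.eq_zero_or_improvable (h : Realizes n m f) {R : ℕ} (hn : 0 < n) (hR : IsCode n R)
    (hplane : PlaneAt f (parentGraph n (par R))) : R = 0 ∨ Improvable n f R := by
  have hm : fullMask.testBit m = true := by rw [testBit_fullMask, decide_eq_true h.lt]
  have hs := agrees_selfLoops hn h.le_seven hR
  have hn7 := h.le_seven
  by_cases h7 : n = 7
  · subst h7
    have h1 : par R 1 ≠ 1 := hR.parent.iterate_ne (by norm_num) one_ne_zero 0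
    have h2 : par R 1 < 7 := hR.parent.lt 1 (by norm_num)
    have key := fun L hsearch => search_sound h hR hplane 5 (by norm_num)
      (put (selfLoops 7) 1 (par R 1)) fullMask L (fun L => L.isEmpty) (hs.put (by norm_num)) hm
      hsearch
    generalize par R 1 = u at h1 h2 key
    interval_cases u
    · exact key _ search_seven_zero
    · exact absurd rfl h1
    · exact key _ search_seven_two
    · exact key _ search_seven_three
    · exact key _ search_seven_four
    · exact key _ search_seven_five
    · exact key _ search_seven_six
  · have key := fun L hsearch => search_sound h hR hplane (n - 1) (by omega) _ fullMask L
      (fun L => L.isEmpty) hs hm hsearch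
    have hn6 : n ≤ 6 := by omega
    clear hs hn7 h7 hR hplane h
    interval_cases n
    · exact key _ search_one
    · exact key _ search_two
    · exact key _ search_three
    · exact key _ search_four
    · exact key _ search_five
    · exact key _ search_six

/-- Every plane caterpillar on at most seven points is connected by slides to the star centred at
`f 0`. -/
theorem Realizes.reaches_star (h : Realizes n m f) (hn : 0 < n) (R : ℕ) (hR : IsCode n R)
    (hplane : PlaneAt f (parentGraph n (par R))) :
    Relation.ReflTransGen (Step f) (parentGraph n (par R)) (parentGraph n (par 0)) := by
  -- The order `lower` is the lexicographic order on depth sum and code.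
  have wf : WellFounded (InvImage (Prod.Lex (· < ·) (· < ·))
      fun P : ℕ => (depthSum P (n - 1), P)) :=
    InvImage.wf _ (WellFounded.prod_lex wellFounded_lt wellFounded_lt)
  induction R using wf.induction with
  | _ R ih =>
    rcases h.eq_zero_or_improvable hn hR hplane with rfl | ⟨Q, hQ, hlow, hpl, hpath⟩
    · exact Relation.ReflTransGen.refl
    · refine hpath.trans (ih Q ?_ hQ hpl)
      simp only [InvImage, Prod.lex_def]
      exact lower_iff.1 hlow

/-! ### Numbering the points by angle -/

/-- `q` is lexicographically larger than `p`. -/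
def LexLT (p q : Plane) : Prop := p 0 < q 0 ∨ (p 0 = q 0 ∧ p 1 < q 1)

theorem exists_lex_min {S : Finset Plane} (hS : S.Nonempty) :
    ∃ p ∈ S, ∀ q ∈ S, q ≠ p → LexLT p q := by
  obtain ⟨p, hp, hmin⟩ := S.exists_min_image (fun q => toLex (q 0, q 1)) hS
  refine ⟨p, hp, fun q hq hqp => ?_⟩
  have h := hmin q hq
  rw [Prod.Lex.le_iff] at h
  rcases h with h | ⟨h0, h1⟩
  · exact Or.inl h
  · exact Or.inr ⟨h0, lt_of_le_of_ne h1 fun h => hqp (plane_ext h0.symm h.symm)⟩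

/-- All three vectors from `p` lie in a half-plane, closed on one side only, and there the angular
order is transitive: `v - p`, multiplied by `det p u w`, is a combination of `w - p` and `u - p`
with positive coefficients. First coordinates suffice, as a vertical `u - p` or `v - p` would be the
last direction and contradict `huv` or `hvw`. -/
theorem det_pos_trans {p u v w : Plane} (hu : LexLT p u) (hv : LexLT p v) (hw : LexLT p w)
    (huv : 0 < det p u v) (hvw : 0 < det p v w) : 0 < det p u w := by
  have hx : (v 0 - p 0) * det p u w = (w 0 - p 0) * det p u v + (u 0 - p 0) * det p v w := by
    unfold det; ring
  have hy : (v 1 - p 1) * det p u w = (w 1 - p 1) * det p u v + (u 1 - p 1) * det p v w := by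
    unfold det; ring
  have hxu : 0 ≤ u 0 - p 0 := by rcases hu with h | h <;> linarith [h]
  have hxw : 0 ≤ w 0 - p 0 := by rcases hw with h | h <;> linarith [h]
  rcases hv with hv | ⟨hv0, hv1⟩
  · have hpos : 0 < (v 0 - p 0) * det p u w := by
      rw [hx]
      rcases hu with hu | ⟨hu0, hu1⟩
      · nlinarith [mul_pos (sub_pos.2 hu) hvw, mul_nonneg hxw huv.le]
      · exfalso
        unfold det at huv
        rw [← hu0] at huv
        nlinarith [mul_pos (sub_pos.2 hv) (sub_pos.2 hu1)]
    exact (pos_iff_pos_of_mul_pos hpos).1 (sub_pos.2 hv)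
  · exfalso
    unfold det at hvw
    rw [← hv0] at hvw
    nlinarith [mul_nonneg hxw (sub_pos.2 hv1).le]

theorem GeneralPosition.det_ne_zero {S : Finset Plane} (hS : GeneralPosition S) {a b c : Plane}
    (ha : a ∈ S) (hb : b ∈ S) (hc : c ∈ S) (hab : a ≠ b) (hac : a ≠ c) (hbc : b ≠ c) :
    det a b c ≠ 0 :=
  fun h => hS a ha b hb c hc hab hac hbc (collinear_of_det_eq_zero hab h)

/-- The points of `S` can be numbered such that all points but the first are sorted by angle around
the first. -/
theorem exists_labelling {S : Finset Plane} (hS : GeneralPosition S) {n : ℕ} (hn : 0 < n)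
    (hcard : S.card = n) : ∃ (f : ℕ → Plane) (e : Fin n ≃ S), (∀ i, (e i : Plane) = f i) ∧
      ∀ i j, 0 < i → i < j → j < n → 0 < det (f 0) (f i) (f j) := by
  classical
  obtain ⟨p, hp, hmin⟩ := exists_lex_min (Finset.card_pos.1 (hcard ▸ hn))
  let T := {q : S // (q : Plane) ≠ p}
  have hT : ∀ u : T, LexLT p u.1 := fun u => hmin u.1 u.1.2 u.2
  let r : T → T → Prop := fun u v => 0 < det p u.1 v.1
  have hr : IsStrictTotalOrder T r := {
    trichotomous := fun u v h1 h2 => by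
      by_contra hne
      have h3 : det p u.1 v.1 ≠ 0 := hS.det_ne_zero hp u.1.2 v.1.2 u.2.symm v.2.symm
        fun h => hne (Subtype.ext (Subtype.ext h))
      rcases lt_or_gt_of_ne h3 with h3 | h3
      · refine h2 ?_
        change 0 < det p v.1 u.1
        rw [det_swap_right]
        linarith
      · exact h1 h3
    irrefl := fun u h => by
      have : det p u.1 u.1 = 0 := by unfold det; ring
      exact absurd h (by simp [r, this])
    trans := fun u v w h1 h2 => det_pos_trans (hT u) (hT v) (hT w) h1 h2 }
  let _ : LinearOrder T := linearOrderOfSTO r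
  have hcT : Fintype.card T = n - 1 := by
    have := Fintype.card_subtype_compl (fun q : S => (q : Plane) = p)
    have h1 : Fintype.card {q : S // (q : Plane) = p} = 1 :=
      Fintype.card_eq_one_iff.2 ⟨⟨⟨p, hp⟩, rfl⟩, fun y => Subtype.ext (Subtype.ext y.2)⟩
    rw [h1, Fintype.card_coe, hcard] at this
    convert this
  let g : Fin (n - 1) ≃o T := Fintype.orderIsoFinOfCardEq T hcT
  -- The numbering of the other points is shifted by one to make room for the extreme point `p`,
  -- which also serves as the value beyond `n - 1`.
  let f : ℕ → Plane := fun k => if h : 0 < k ∧ k - 1 < n - 1 then (g ⟨k - 1, h.2⟩).1 else p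
  have f0 : f 0 = p := dif_neg (by simp)
  have fpos : ∀ k (h0 : 0 < k) (hk : k < n), f k = (g ⟨k - 1, by omega⟩).1 :=
    fun k h0 hk => dif_pos ⟨h0, by omega⟩
  have hmem : ∀ k, f k ∈ S := by
    intro k
    by_cases h : 0 < k ∧ k - 1 < n - 1
    · simp only [f, dif_pos h]
      exact (g _).1.2
    · simp only [f, dif_neg h]
      exact hp
  have hinj : ∀ i j, i < n → j < n → f i = f j → i = j := by
    intro i j hi hj h
    rcases Nat.eq_zero_or_pos i with rfl | hi0 <;> rcases Nat.eq_zero_or_pos j with rfl | hj0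
    · rfl
    · rw [f0, fpos j hj0 hj] at h
      exact absurd h.symm (g _).2
    · rw [f0, fpos i hi0 hi] at h
      exact absurd h (g _).2
    · rw [fpos i hi0 hi, fpos j hj0 hj] at h
      have := g.injective (Subtype.ext (Subtype.ext h))
      simp only [Fin.mk.injEq] at this
      omega
  have hbij : Function.Bijective fun i : Fin n => (⟨f i, hmem i⟩ : S) := by
    rw [Fintype.bijective_iff_injective_and_card]
    refine ⟨fun i j h => Fin.ext (hinj i j i.2 j.2 (congrArg Subtype.val h)), ?_⟩
    rw [Fintype.card_fin, Fintype.card_coe, hcard]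
  refine ⟨f, Equiv.ofBijective _ hbij, fun i => rfl, fun i j hi hij hj => ?_⟩
  rw [f0, fpos i hi (hij.trans hj), fpos j (hi.trans hij) hj]
  exact g.strictMono (show (⟨i - 1, _⟩ : Fin (n - 1)) < ⟨j - 1, _⟩ from Fin.mk_lt_mk.2 (by omega))

/-! ### Transport between the point set and its numbering -/

theorem isLeaf_iso_iff {V W : Type*} {G : SimpleGraph V} {H : SimpleGraph W} (φ : G ≃g H) {v : V} :
    IsLeaf H (φ v) ↔ IsLeaf G v := by
  constructor
  · rintro ⟨w, hw, huniq⟩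
    refine ⟨φ.symm w, ?_, fun y hy => ?_⟩
    · beta_reduce
      rw [← φ.map_adj_iff]
      simpa using hw
    · rw [← huniq (φ y) (φ.map_adj_iff.2 hy)]
      simp
  · rintro ⟨w, hw, huniq⟩
    refine ⟨φ w, φ.map_adj_iff.2 hw, fun y hy => ?_⟩
    have h : G.Adj v (φ.symm y) := by
      rw [← φ.map_adj_iff]
      simpa using hy
    rw [← huniq _ h]
    simp

theorem IsCaterpillar.of_iso {V W : Type*} {G : SimpleGraph V} {H : SimpleGraph W} (φ : G ≃g H)
    (h : IsCaterpillar G) : IsCaterpillar H := by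
  obtain ⟨ht, l, hnd, hch, hl⟩ := h
  refine ⟨φ.isTree_iff.1 ht, l.map φ, hnd.map φ.injective, ?_, fun v => ?_⟩
  · rw [List.isChain_map]
    exact hch.imp fun _ _ h => φ.map_adj_iff.2 h
  · obtain ⟨v, rfl⟩ := φ.surjective v
    rw [isLeaf_iso_iff, ← hl, List.mem_map_of_injective φ.injective]

section Transport

variable {S : Finset Plane} {n : ℕ} {f : ℕ → Plane} {e : Fin n ≃ S}

theorem planeAt_comap_iff (he : ∀ i, (e i : Plane) = f i) {G : SimpleGraph S} :
    PlaneAt f (G.comap e) ↔ IsPlane G := by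
  have key : ∀ a b c d : Fin n, s(a, b) ≠ s(c, d) ↔ s(e a, e b) ≠ s(e c, e d) := by
    intro a b c d
    simp
  constructor
  · intro h a b c d hab hcd hne
    obtain ⟨a, rfl⟩ := e.surjective a
    obtain ⟨b, rfl⟩ := e.surjective b
    obtain ⟨c, rfl⟩ := e.surjective c
    obtain ⟨d, rfl⟩ := e.surjective d
    simpa only [he, Compatible] using h a b c d hab hcd ((key a b c d).2 hne)
  · intro h a b c d hab hcd hne
    have := h _ _ _ _ hab hcd ((key a b c d).1 hne)
    simpa only [he, Compatible] using this

theorem slideAt_comap_iff (he : ∀ i, (e i : Plane) = f i) {G H : SimpleGraph S} :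
    SlideAt f (G.comap e) (H.comap e) ↔ IsSlide G H := by
  have hedge : ∀ a b c : Fin n, (H.comap e).edgeSet =
      ((G.comap e).edgeSet \ {s(a, b)}) ∪ {s(a, c)} ↔
      H.edgeSet = (G.edgeSet \ {s(e a, e b)}) ∪ {s(e a, e c)} := by
    intro a b c
    rw [edgeSet_ext_iff, edgeSet_ext_iff, ← e.forall_congr_right]
    refine forall_congr' fun u => ?_
    rw [← e.forall_congr_right]
    simp
  have hempty : ∀ a b c : Fin n, EmptyAt n f a b c ↔ EmptyTriangle S (e a) (e b) (e c) := by
    intro a b c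
    simp only [he]
    constructor
    · intro hT p hp hmem
      obtain ⟨i, hi⟩ := e.surjective ⟨p, hp⟩
      obtain rfl : f i = p := by rw [← he, hi]
      rcases hT i i.2 hmem with h | h | h <;> simp [h]
    · intro hT i hi hmem
      have hval : ∀ x : Fin n, f i = f x → i = x := fun x h => by
        have h' : (e ⟨i, hi⟩ : Plane) = e x := by rw [he, he, h]
        exact congrArg Fin.val (e.injective (Subtype.ext h'))
      have := hT (f i) (by rw [← he ⟨i, hi⟩]; exact (e _).2) hmem
      exact this.imp (hval a) (Or.imp (hval b) (hval c))
  constructor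
  · rintro ⟨a, b, c, hab, hac, hE, hbc, hbc', hT⟩
    exact ⟨e a, e b, e c, hab, hac, (hedge a b c).1 hE, hbc, hbc', (hempty a b c).1 hT⟩
  · rintro ⟨a, b, c, hab, hac, hE, hbc, hbc', hT⟩
    obtain ⟨a, rfl⟩ := e.surjective a
    obtain ⟨b, rfl⟩ := e.surjective b
    obtain ⟨c, rfl⟩ := e.surjective c
    exact ⟨a, b, c, hab, hac, (hedge a b c).2 hE, hbc, hbc', (hempty a b c).2 hT⟩

theorem exists_adj_of_step (he : ∀ i, (e i : Plane) = f i) {C : PlaneCaterpillar S}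
    {H : SimpleGraph (Fin n)} (h : Step f (C.1.comap e) H) :
    ∃ D : PlaneCaterpillar S, D.1.comap e = H ∧ (slideGraph S).Adj C D := by
  obtain ⟨hs, hp, hc⟩ := h
  have hH : (H.comap e.symm).comap e = H := by
    ext u v
    simp
  have hp' : IsPlane (H.comap e.symm) := by rwa [← planeAt_comap_iff he, hH]
  have hc' : IsCaterpillar (H.comap e.symm) := hc.of_iso (Iso.comap e.symm H).symm
  refine ⟨⟨H.comap e.symm, hp', hc'⟩, hH, (slideAt_comap_iff he).1 ?_⟩
  rwa [hH]

theorem exists_reachable (he : ∀ i, (e i : Plane) = f i) {C : PlaneCaterpillar S}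
    {H : SimpleGraph (Fin n)} (h : Relation.ReflTransGen (Step f) (C.1.comap e) H) :
    ∃ D : PlaneCaterpillar S, D.1.comap e = H ∧ (slideGraph S).Reachable C D := by
  induction h with
  | refl => exact ⟨C, rfl, Reachable.refl C⟩
  | tail _ hs ih =>
    obtain ⟨D, rfl, hD⟩ := ih
    obtain ⟨D', hD', hadj⟩ := exists_adj_of_step he hs
    exact ⟨D', hD', hD.trans hadj.reachable⟩

end Transport

/-! ### Connectedness for at most seven points -/

theorem exists_par_eq (n : ℕ) {q : ℕ → ℕ} (hq : ∀ v < n, q v < 8) :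
    ∃ R, ∀ v, par R v = if v < n then q v else 0 := by
  induction n with
  | zero => exact ⟨0, fun v => by simp [par_zero]⟩
  | succ k ih =>
    obtain ⟨R, hR⟩ := ih fun v hv => hq v (hv.trans (Nat.lt_succ_self k))
    refine ⟨put R k (q k), fun v => ?_⟩
    rw [par_put _ _ (hq k (Nat.lt_succ_self k)), hR v]
    rcases lt_trichotomy v k with h | h | h
    · simp [h, h.ne, h.trans (Nat.lt_succ_self k)]
    · simp [h]
    · simp [h.ne', h.not_gt, show ¬ v < k + 1 by omega]

theorem exists_isCode {n : ℕ} (hn : 0 < n) (hn7 : n ≤ 7) {G : SimpleGraph (Fin n)}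
    (hG : G.IsTree) : ∃ R, IsCode n R ∧ G = parentGraph n (par R) := by
  obtain ⟨q, hq, rfl⟩ := exists_isParent hn hG
  obtain ⟨R, hR⟩ := exists_par_eq n (q := q) fun v hv => (hq.lt v hv).trans_le (by omega)
  have hR' : ∀ v < n, par R v = q v := fun v hv => (hR v).trans (if_pos hv)
  have hit : ∀ k, ∀ v < n, (par R)^[k] v = q^[k] v := by
    intro k
    induction k with
    | zero => exact fun v _ => rfl
    | succ k ih =>
      intro v hv
      rw [Function.iterate_succ_apply, Function.iterate_succ_apply, hR' v hv,
        ih _ (hq.lt v hv)]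
  refine ⟨R, ⟨⟨fun v hv => ?_, ?_, fun v hv => ?_⟩, fun v hv => ?_⟩, ?_⟩
  · rw [hR' v hv]
    exact hq.lt v hv
  · rw [hR' 0 hn, hq.zero]
  · rw [hit 6 v hv]
    -- The depth is at most `n - 1`, hence at most 6.
    exact iterate_eq_zero_of_le hq.zero (hq.rooted v hv) (by omega)
  · rw [hR v, if_neg (by omega)]
  · ext u v
    rw [parentGraph_adj, parentGraph_adj, hR' u u.2, hR' v v.2]

theorem isCaterpillar_star {n : ℕ} (hn : 0 < n) : IsCaterpillar (parentGraph n (par 0)) := by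
  have hp : IsParent n 1 (par 0) := ⟨fun v _ => by rwa [par_zero], par_zero 0,
    fun v _ => by simp [par_zero]⟩
  refine isCaterpillar_of_forall (hp.isTree hn) fun v x y z hx hy hz hxy hxz hyz => ?_
  have hadj : ∀ u w : Fin n, (parentGraph n (par 0)).Adj u w ↔
      (u.val ≠ 0 ∧ w.val = 0) ∨ (w.val ≠ 0 ∧ u.val = 0) := by
    intro u w
    rw [parentGraph_adj, par_zero, par_zero]
    constructor
    · rintro ⟨-, h | h⟩
      · exact Or.inl ⟨h.1, h.2.symm⟩
      · exact Or.inr ⟨h.1, h.2.symm⟩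
    · rintro (h | h)
      · exact ⟨fun h' => h.1 (h' ▸ h.2), Or.inl ⟨h.1, h.2.symm⟩⟩
      · exact ⟨fun h' => h.1 (h' ▸ h.2), Or.inr ⟨h.1, h.2.symm⟩⟩
  rw [hadj] at hx hy
  -- Having two different neighbours, `v` must be the centre, so `x` is a leaf.
  left
  refine ⟨⟨0, hn⟩, ?_, fun w hw => ?_⟩
  · beta_reduce
    rw [hadj]
    exact Or.inl ⟨fun h => by omega, rfl⟩
  · beta_reduce at hw
    rw [hadj] at hw
    exact Fin.ext (by simp; omega)

theorem Realizes.planeAt_star {n m : ℕ} {f : ℕ → Plane} (h : Realizes n m f) :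
    PlaneAt f (parentGraph n (par 0)) := by
  have key : ∀ a b : Fin n, (parentGraph n (par 0)).Adj a b →
      ∃ c : Fin n, c.val ≠ 0 ∧ ((a.val = 0 ∧ b = c) ∨ (b.val = 0 ∧ a = c)) := by
    intro a b hab
    rw [parentGraph_adj, par_zero, par_zero] at hab
    rcases hab.2 with h | h
    · exact ⟨a, h.1, Or.inr ⟨h.2.symm, rfl⟩⟩
    · exact ⟨b, h.1, Or.inl ⟨h.2.symm, rfl⟩⟩
  have base : ∀ c d : Fin n, c.val ≠ 0 → d.val ≠ 0 → c ≠ d → Compatible f 0 c 0 d := by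
    intro c d hc hd hcd
    exact h.compatible_of_common (by omega) c.2 d.2 hc.symm hd.symm fun h => hcd (Fin.ext h)
  intro a b c d hab hcd hne
  obtain ⟨x, hx, h1⟩ := key a b hab
  obtain ⟨y, hy, h2⟩ := key c d hcd
  have hxy : x ≠ y := by
    rintro rfl
    apply hne
    rcases h1 with ⟨h1, rfl⟩ | ⟨h1, rfl⟩ <;> rcases h2 with ⟨h2, rfl⟩ | ⟨h2, rfl⟩
    · rw [Fin.ext (h1.trans h2.symm)]
    · rw [Fin.ext (h1.trans h2.symm), Sym2.eq_swap]
    · rw [Fin.ext (h1.trans h2.symm), Sym2.eq_swap]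
    · rw [Fin.ext (h1.trans h2.symm)]
  have hb := base x y hx hy hxy
  rcases h1 with ⟨h1, rfl⟩ | ⟨h1, rfl⟩ <;> rcases h2 with ⟨h2, rfl⟩ | ⟨h2, rfl⟩ <;> rw [h1, h2]
  · exact hb
  · exact hb.swap_right
  · exact hb.swap_left
  · exact hb.swap_left.swap_right

/-- Slides can be reversed, so it is enough that every caterpillar reaches the same star. The star
itself is a plane caterpillar, which makes the slide graph nonempty. -/
theorem slideGraph_connected {n : ℕ} (hn : 0 < n) (hn7 : n ≤ 7) {S : Finset Plane}
    (hcard : S.card = n) (hS : GeneralPosition S) : (slideGraph S).Connected := by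
  obtain ⟨f, e, he, hsorted⟩ := exists_labelling hS hn hcard
  have hmem : ∀ i < n, f i ∈ S := fun i hi => by
    rw [← he ⟨i, hi⟩]
    exact (e _).2
  have hinj : ∀ i j, i < n → j < n → f i = f j → i = j := fun i j hi hj h => by
    rw [← he ⟨i, hi⟩, ← he ⟨j, hj⟩] at h
    exact congrArg Fin.val (e.injective (Subtype.ext h))
  obtain ⟨m, hm⟩ := exists_realizes hn7 hinj
    (fun i j k hi hj hk hij hik hjk => hS.det_ne_zero (hmem i hi) (hmem j hj) (hmem k hk)
      (fun h => hij (hinj i j hi hj h)) (fun h => hik (hinj i k hi hk h))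
      fun h => hjk (hinj j k hj hk h)) hsorted
  have hreach : ∀ C : PlaneCaterpillar S, ∃ D : PlaneCaterpillar S,
      D.1.comap e = parentGraph n (par 0) ∧ (slideGraph S).Reachable C D := by
    intro C
    obtain ⟨R, hR, hG⟩ := exists_isCode hn hn7 ((Iso.comap e C.1).isTree_iff.2 C.2.2.1)
    have hp : PlaneAt f (C.1.comap e) := (planeAt_comap_iff he).2 C.2.1
    refine exists_reachable he ?_
    rw [hG] at hp ⊢
    exact hm.reaches_star hn R hR hp
  have hH : ((parentGraph n (par 0)).comap e.symm).comap e = parentGraph n (par 0) := by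
    ext u v
    simp
  have hne : Nonempty (PlaneCaterpillar S) :=
    ⟨⟨(parentGraph n (par 0)).comap e.symm,
      (planeAt_comap_iff he).1 (by rw [hH]; exact hm.planeAt_star),
      (isCaterpillar_star hn).of_iso (Iso.comap e.symm _).symm⟩⟩
  refine ⟨fun C C' => ?_⟩
  obtain ⟨D, hD, hCD⟩ := hreach C
  obtain ⟨D', hD', hCD'⟩ := hreach C'
  obtain rfl : D = D' := by
    apply Subtype.ext
    ext u v
    obtain ⟨u, rfl⟩ := e.surjective u
    obtain ⟨v, rfl⟩ := e.surjective v
    rw [← comap_adj, hD, ← hD', comap_adj]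
  exact hCD.trans hCD'.symm

/-! ### An isolated caterpillar on eight or more points -/

/-- First coordinates of the points. -/
noncomputable def pointX : ℕ → ℝ
  | 0 => 0
  | 1 => 2
  | 2 => 5
  | 3 => 4
  | 4 => 9
  | 5 => 1
  | 6 => 3
  | k + 7 => 1 / ((k : ℝ) + 1000)

/-- Second coordinates of the points. -/
noncomputable def pointY : ℕ → ℝ
  | 0 => 0
  | 1 => 0
  | 2 => 2
  | 3 => 3
  | 4 => -4
  | 5 => 14
  | 6 => 1
  | k + 7 => (k : ℝ) + 1000

/-- Seven fixed points, followed by points on a branch of a hyperbola far above them. -/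
noncomputable def point (k : ℕ) : Plane := !₂[pointX k, pointY k]

theorem det_point (i j k : ℕ) : det (point i) (point j) (point k) =
    (pointX j - pointX i) * (pointY k - pointY i) -
      (pointX k - pointX i) * (pointY j - pointY i) := by
  simp [det, point]

theorem exists_far {k : ℕ} (hk : 7 ≤ k) : 1000 ≤ pointY k ∧ pointX k * pointY k = 1 ∧
    0 < pointX k ∧ pointX k ≤ 1 / 1000 := by
  obtain ⟨k, rfl⟩ := Nat.exists_eq_add_of_le' hk
  have hk' : (0 : ℝ) ≤ k := Nat.cast_nonneg k
  have hpos : (0 : ℝ) < (k : ℝ) + 1000 := by linarith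
  refine ⟨by simp [pointY], ?_, ?_, ?_⟩
  · simp only [pointX, pointY]
    field_simp
  · simp only [pointX]
    positivity
  · simp only [pointX]
    exact one_div_le_one_div_of_le (by norm_num) (by linarith)

theorem pointY_lt {j k : ℕ} (hj : 7 ≤ j) (hjk : j < k) : pointY j < pointY k := by
  obtain ⟨j, rfl⟩ := Nat.exists_eq_add_of_le' hj
  obtain ⟨k, rfl⟩ := Nat.exists_eq_add_of_le' (hj.trans hjk.le)
  simp only [pointY]
  have : (j : ℝ) < k := by exact_mod_cast (by omega : j < k)
  linarith

theorem near_bounds {i : ℕ} (hi : i < 7) (h0 : i ≠ 0) : 1 ≤ pointX i ∧ -4 ≤ pointY i ∧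
    pointY i ≤ 14 := by
  interval_cases i <;> first | exact absurd rfl h0 | norm_num [pointX, pointY]

/-- Lines through two of the first seven points are checked against the far points one by one. For
two far points `j`, `k` the equation of their line is cleared of denominators by `x * y = 1`. -/
theorem det_point_ne_zero_of_lt {i j k : ℕ} (hij : i < j) (hjk : j < k) :
    det (point i) (point j) (point k) ≠ 0 := by
  rw [det_point]
  by_cases hk : k < 7
  · interval_cases k <;> interval_cases j <;> interval_cases i <;> norm_num [pointX, pointY]
  obtain ⟨ht, htu, hu, hu'⟩ := exists_far (not_lt.1 hk)
  by_cases hj : j < 7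
  · intro h
    generalize pointY k = t at *
    generalize pointX k = u at *
    interval_cases j <;> interval_cases i <;> simp only [pointX, pointY] at h <;> linarith
  obtain ⟨hs, hsv, hv, hv'⟩ := exists_far (not_lt.1 hj)
  have hst := pointY_lt (not_lt.1 hj) hjk
  intro h
  -- A third point on the chord would satisfy `y + x * (s * t) = s + t`, where `s` and `t` are the
  -- second coordinates of the two far points. The origin fails, and so does every near point with
  -- `x ≥ 1`, because `s * t` is far larger than `s + t`.
  have key : (pointY k - pointY j) *
      (pointY j + pointY k - pointY i - pointX i * (pointY j * pointY k)) = 0 := by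
    linear_combination (pointY j * pointY k) * h -
      (pointY k * (pointY k - pointY i)) * hsv + (pointY j * (pointY j - pointY i)) * htu
  have key' := (mul_eq_zero.1 key).resolve_left (by linarith)
  by_cases hi : i < 7
  · by_cases hi0 : i = 0
    · subst hi0
      simp only [show pointX 0 = 0 from rfl, show pointY 0 = 0 from rfl] at key'
      linarith
    · obtain ⟨b1, b2, -⟩ := near_bounds hi hi0
      nlinarith [mul_le_mul_of_nonneg_right b1 (by positivity : 0 ≤ pointY j * pointY k)]
  · obtain ⟨hr, hrw, hw, -⟩ := exists_far (not_lt.1 hi)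
    have hrs := pointY_lt (not_lt.1 hi) hij
    -- A line meets the hyperbola in at most two points.
    have : (pointY j - pointY i) * (pointY k - pointY i) = 0 := by
      linear_combination (-pointY i) * key' - (pointY j * pointY k) * hrw
    nlinarith [mul_pos (sub_pos.2 hrs) (sub_pos.2 (hrs.trans hst))]

theorem det_point_ne_zero {i j k : ℕ} (hij : i ≠ j) (hik : i ≠ k) (hjk : j ≠ k) :
    det (point i) (point j) (point k) ≠ 0 := by
  rcases lt_or_gt_of_ne hij with h1 | h1 <;> rcases lt_or_gt_of_ne hik with h2 | h2 <;>
    rcases lt_or_gt_of_ne hjk with h3 | h3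
  · exact det_point_ne_zero_of_lt h1 h3
  · rw [det_swap_right, neg_ne_zero]
    exact det_point_ne_zero_of_lt h2 h3
  · omega
  · rw [det_rotate]
    exact det_point_ne_zero_of_lt h2 h1
  · rw [det_swap_left, neg_ne_zero]
    exact det_point_ne_zero_of_lt h1 h2
  · omega
  · rw [← det_rotate]
    exact det_point_ne_zero_of_lt h3 h2
  · rw [det_rotate, det_swap_right, neg_ne_zero]
    exact det_point_ne_zero_of_lt h3 h1

theorem point_injective : Function.Injective point := by
  intro i j h
  by_contra hij
  obtain ⟨k, hk⟩ := Infinite.exists_notMem_finset ({i, j} : Finset ℕ)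
  simp only [Finset.mem_insert, Finset.mem_singleton, not_or] at hk
  -- Two equal points would be collinear with any third one.
  apply det_point_ne_zero hij (Ne.symm hk.1) (Ne.symm hk.2)
  rw [h]
  unfold det
  ring

/-- Parents in the caterpillar. -/
def spineParent (v : ℕ) : ℕ :=
  if v = 2 then 1 else if v = 3 then 2 else if v = 5 then 4 else if v = 6 then 5 else 0

theorem isParent_spineParent {n : ℕ} (hn : 8 ≤ n) : IsParent n 3 spineParent := by
  refine ⟨fun v _ => ?_, rfl, fun v _ => ?_⟩
  · unfold spineParent
    split_ifs <;> omega
  · simp only [Function.iterate_succ, Function.iterate_zero, Function.comp_apply, id_eq]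
    have h : ∀ u, u ≠ 2 → u ≠ 3 → u ≠ 5 → u ≠ 6 → spineParent u = 0 := by
      intro u h2 h3 h5 h6
      simp [spineParent, h2, h3, h5, h6]
    by_cases h2 : v = 2
    · subst h2; rfl
    by_cases h3 : v = 3
    · subst h3; rfl
    by_cases h5 : v = 5
    · subst h5; rfl
    by_cases h6 : v = 6
    · subst h6; rfl
    rw [h v h2 h3 h5 h6]
    rfl

/-- The caterpillar with spine `2, 1, 0, 4, 5`, in which all but the first seven vertices hang
from `0`. -/
def spineGraph (n : ℕ) : SimpleGraph (Fin n) := parentGraph n spineParent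

theorem spineParent_eq_iff {u v : ℕ} : spineParent u = v ↔
    (u = 2 ∧ v = 1) ∨ (u = 3 ∧ v = 2) ∨ (u = 5 ∧ v = 4) ∨ (u = 6 ∧ v = 5) ∨
      ((u ≤ 1 ∨ u = 4 ∨ 7 ≤ u) ∧ v = 0) := by
  unfold spineParent
  split_ifs <;> omega

theorem spineGraph_adj {n : ℕ} {u v : Fin n} : (spineGraph n).Adj u v ↔
    (u.val ≠ 0 ∧ spineParent u = v) ∨ (v.val ≠ 0 ∧ spineParent v = u) := by
  unfold spineGraph
  rw [parentGraph_adj]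
  refine ⟨fun h => h.2, fun h => ⟨?_, h⟩⟩
  rintro rfl
  rw [spineParent_eq_iff] at h
  omega

/-- The non-leaf neighbours of `0` are among `1` and `4`; those of any other `v` are among its
parent and its only possible child `v + 1`. So there are never three of them. -/
theorem isCaterpillar_spineGraph {n : ℕ} (hn : 8 ≤ n) : IsCaterpillar (spineGraph n) := by
  have ht : (spineGraph n).IsTree := (isParent_spineParent hn).isTree (by omega)
  refine isCaterpillar_of_forall ht fun v x y z hx hy hz hxy hxz hyz => ?_
  have hleaf : ∀ u : Fin n, u.val ≠ 0 → (∀ w : Fin n, spineParent w ≠ u) →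
      IsLeaf (spineGraph n) u := by
    intro u hu0 hu
    refine ⟨⟨spineParent u, (isParent_spineParent hn).lt u u.2⟩,
      spineGraph_adj.2 (Or.inl ⟨hu0, rfl⟩), fun w hw => ?_⟩
    rcases spineGraph_adj.1 hw with h | h
    · exact Fin.ext h.2.symm
    · exact absurd h.2 (hu w)
  have key : ∀ u : Fin n, (spineGraph n).Adj v u → ¬ IsLeaf (spineGraph n) u →
      u.val = (if v.val = 0 then 1 else spineParent v) ∨
        u.val = (if v.val = 0 then 4 else v.val + 1) := by
    intro u hvu hu
    rcases spineGraph_adj.1 hvu with ⟨h0, h⟩ | ⟨h0, h⟩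
    · left
      rw [if_neg h0, h]
    · by_cases hv : v.val = 0
      · rw [if_pos hv, if_pos hv]
        by_contra hcon
        refine hu (hleaf u h0 fun w hw => ?_)
        rw [spineParent_eq_iff] at h hw
        omega
      · right
        rw [if_neg hv]
        rw [spineParent_eq_iff] at h
        omega
  by_contra hcon
  push Not at hcon
  have h1 := key x hx hcon.1
  have h2 := key y hy hcon.2.1
  have h3 := key z hz hcon.2.2
  rw [Ne, Fin.ext_iff] at hxy hxz hyz
  omega

/-! ### The caterpillar has no crossings -/

theorem compatible_of_det_mul_pos {f : ℕ → Plane} {a b c d : ℕ}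
    (h : 0 < det (f a) (f b) (f c) * det (f a) (f b) (f d)) : Compatible f a b c d := by
  rintro x ⟨hx, hy⟩
  have := det_mul_neg_of_segment_inter hx hy (left_ne_zero_of_mul h.ne')
    (right_ne_zero_of_mul h.ne')
  linarith

theorem compatible_point_of_common {a b c : ℕ} (hab : a ≠ b) (hac : a ≠ c) (hbc : b ≠ c) :
    Compatible point a b a c := by
  rintro x ⟨hx, hy⟩
  rw [eq_of_mem_segment_inter hx hy (det_point_ne_zero hab hac hbc)]
  simp

/-- The far points are almost vertically above `0`, so all other near points are to the right of the
lines that join them to `0`. -/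
theorem det_far_neg {i k : ℕ} (hi : i < 7) (h0 : i ≠ 0) (hk : 7 ≤ k) :
    det (point 0) (point k) (point i) < 0 := by
  obtain ⟨b1, -, b2⟩ := near_bounds hi h0
  obtain ⟨ht, -, hu, hu'⟩ := exists_far hk
  rw [det_point]
  simp only [show pointX 0 = 0 from rfl, show pointY 0 = 0 from rfl, sub_zero]
  nlinarith

/-- Two of the six edges either have a common endpoint or one of them lies strictly on one side of
the line through the other. -/
theorem compatible_near {v w : ℕ} (hv : 0 < v) (hvw : v < w) (hw : w < 7) :
    Compatible point v (spineParent v) w (spineParent w) := by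
  interval_cases w <;> interval_cases v
  · show Compatible point 1 0 2 1
    exact (compatible_point_of_common (by decide) (by decide) (by decide)).swap_right
  · show Compatible point 1 0 3 2
    exact compatible_of_det_mul_pos (by norm_num [det_point, pointX, pointY])
  · show Compatible point 2 1 3 2
    exact (compatible_point_of_common (by decide) (by decide) (by decide)).swap_right
  · show Compatible point 1 0 4 0
    exact (compatible_point_of_common (by decide) (by decide) (by decide)).swap_left.swap_right
  · show Compatible point 2 1 4 0
    exact (compatible_of_det_mul_pos (by norm_num [det_point, pointX, pointY])).symm
  · show Compatible point 3 2 4 0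
    exact compatible_of_det_mul_pos (by norm_num [det_point, pointX, pointY])
  · show Compatible point 1 0 5 4
    exact (compatible_of_det_mul_pos (by norm_num [det_point, pointX, pointY])).symm
  · show Compatible point 2 1 5 4
    exact (compatible_of_det_mul_pos (by norm_num [det_point, pointX, pointY])).symm
  · show Compatible point 3 2 5 4
    exact (compatible_of_det_mul_pos (by norm_num [det_point, pointX, pointY])).symm
  · show Compatible point 4 0 5 4
    exact (compatible_point_of_common (by decide) (by decide) (by decide)).swap_right
  · show Compatible point 1 0 6 5
    exact compatible_of_det_mul_pos (by norm_num [det_point, pointX, pointY])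
  · show Compatible point 2 1 6 5
    exact compatible_of_det_mul_pos (by norm_num [det_point, pointX, pointY])
  · show Compatible point 3 2 6 5
    exact (compatible_of_det_mul_pos (by norm_num [det_point, pointX, pointY])).symm
  · show Compatible point 4 0 6 5
    exact compatible_of_det_mul_pos (by norm_num [det_point, pointX, pointY])
  · show Compatible point 5 4 6 5
    exact (compatible_point_of_common (by decide) (by decide) (by decide)).swap_right

theorem compatible_spine {v w : ℕ} (hv : v ≠ 0) (hvw : v < w) :
    Compatible point v (spineParent v) w (spineParent w) := by
  by_cases hw : w < 7
  · exact compatible_near (Nat.pos_of_ne_zero hv) hvw hw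
  rw [show spineParent w = 0 from spineParent_eq_iff.2 (by omega)]
  have h1 := (spineParent_eq_iff (u := v)).1 rfl
  generalize spineParent v = p at *
  by_cases hp : p = 0
  · subst hp
    exact (compatible_point_of_common hv.symm (by omega) hvw.ne).swap_left.swap_right
  · exact (compatible_of_det_mul_pos (mul_pos_of_neg_of_neg
      (det_far_neg (by omega) (by omega) (by omega))
      (det_far_neg (by omega) (by omega) (by omega)))).symm.swap_right

theorem planeAt_spineGraph (n : ℕ) : PlaneAt point (spineGraph n) := by
  have main : ∀ v w : ℕ, v ≠ 0 → w ≠ 0 → v ≠ w →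
      Compatible point v (spineParent v) w (spineParent w) := by
    intro v w hv hw hvw
    rcases lt_or_gt_of_ne hvw with h | h
    · exact compatible_spine hv h
    · exact (compatible_spine hw h).symm
  intro a b c d hab hcd hne
  rw [spineGraph_adj] at hab hcd
  have hne' : ¬ (a = c ∧ b = d) ∧ ¬ (a = d ∧ b = c) := by
    simpa [Sym2.eq_iff, not_or] using hne
  simp only [Fin.ext_iff] at hne'
  rcases hab with ⟨h1, h2⟩ | ⟨h1, h2⟩ <;> rcases hcd with ⟨h3, h4⟩ | ⟨h3, h4⟩ <;> rw [← h2, ← h4]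
  · exact main a c h1 h3 fun h => hne'.1 ⟨h, by rw [← h2, ← h4, h]⟩
  · exact (main a d h1 h3 fun h => hne'.2 ⟨h, by rw [← h2, ← h4, h]⟩).swap_right
  · exact (main b c h1 h3 fun h => hne'.2 ⟨by rw [← h2, ← h4, h], h⟩).swap_left
  · exact (main b d h1 h3 fun h => hne'.1 ⟨by rw [← h2, ← h4, h], h⟩).swap_left.swap_right

/-! ### No slide leads to another plane caterpillar -/

theorem not_emptyAt {n a b c p : ℕ} (hp : p < n) (hpa : p ≠ a) (hpb : p ≠ b) (hpc : p ≠ c)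
    (h1 : 0 < det (point a) (point b) (point p)) (h2 : 0 < det (point b) (point c) (point p))
    (h3 : 0 < det (point c) (point a) (point p)) : ¬ EmptyAt n point a b c := by
  intro h
  have hsum : det (point a) (point b) (point c) = det (point a) (point b) (point p) +
      det (point b) (point c) (point p) + det (point c) (point a) (point p) := by
    unfold det
    ring
  have := h p hp (mem_convexHull_of_det_pos h1.le h2.le h3.le (by linarith))
  tauto

/-- The triangles `0 1 2` and `1 2 3` contain the point `6`, the triangle `0 4 5` contains `1`, and
the triangle `4 5 6` contains `2`. -/
theorem not_emptyAt_grandparent {n v : ℕ} (hn : 8 ≤ n) (hv : spineParent v ≠ 0) :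
    ¬ EmptyAt n point v (spineParent v) (spineParent (spineParent v)) := by
  have h := (spineParent_eq_iff (u := v)).1 rfl
  have : v = 2 ∨ v = 3 ∨ v = 5 ∨ v = 6 := by omega
  rcases this with rfl | rfl | rfl | rfl
  · exact fun h => not_emptyAt (a := 0) (b := 1) (c := 2) (p := 6) (by omega) (by decide)
      (by decide) (by decide) (by norm_num [det_point, pointX, pointY])
      (by norm_num [det_point, pointX, pointY]) (by norm_num [det_point, pointX, pointY]) h.swap
  · exact fun h => not_emptyAt (a := 1) (b := 2) (c := 3) (p := 6) (by omega) (by decide)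
      (by decide) (by decide) (by norm_num [det_point, pointX, pointY])
      (by norm_num [det_point, pointX, pointY]) (by norm_num [det_point, pointX, pointY]) h.swap
  · exact fun h => not_emptyAt (a := 0) (b := 4) (c := 5) (p := 1) (by omega) (by decide)
      (by decide) (by decide) (by norm_num [det_point, pointX, pointY])
      (by norm_num [det_point, pointX, pointY]) (by norm_num [det_point, pointX, pointY]) h.swap
  · exact fun h => not_emptyAt (a := 4) (b := 5) (c := 6) (p := 2) (by omega) (by decide)
      (by decide) (by decide) (by norm_num [det_point, pointX, pointY])
      (by norm_num [det_point, pointX, pointY]) (by norm_num [det_point, pointX, pointY]) h.swap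

/-- The point `5` lies in the triangle formed by `0`, `1` and a far point, and `1` in that formed by
`0`, `4` and a far point. -/
theorem not_emptyAt_far {n k : ℕ} (hn : 8 ≤ n) (hk : 7 ≤ k) :
    ¬ EmptyAt n point 1 0 k ∧ ¬ EmptyAt n point 4 0 k := by
  obtain ⟨ht, -, hu, hu'⟩ := exists_far hk
  have swap : ∀ a, EmptyAt n point a 0 k → EmptyAt n point 0 a k := by
    intro a h p hp hmem
    rw [Set.insert_comm] at hmem
    have := h p hp hmem
    tauto
  constructor
  · refine fun h => not_emptyAt (a := 0) (b := 1) (c := k) (p := 5) (by omega) (by decide)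
      (by decide) (by omega) (by norm_num [det_point, pointX, pointY]) ?_ ?_ (swap 1 h)
    all_goals
      rw [det_point]
      generalize pointX k = u at *
      generalize pointY k = t at *
      simp only [pointX, pointY]
      linarith
  · refine fun h => not_emptyAt (a := 0) (b := 4) (c := k) (p := 1) (by omega) (by decide)
      (by decide) (by omega) (by norm_num [det_point, pointX, pointY]) ?_ ?_ (swap 4 h)
    all_goals
      rw [det_point]
      generalize pointX k = u at *
      generalize pointY k = t at *
      simp only [pointX, pointY]
      linarith

/-- The edges `ab` and `bc` of a slide form a path of two edges. Either it descends from a vertex to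
a grandchild, and its triangle is not empty, or `a` and `c` are children of `b`, and then `b = 0`.
-/
theorem not_step_spineGraph {n : ℕ} (hn : 8 ≤ n) (H : SimpleGraph (Fin n)) :
    ¬ Step point (spineGraph n) H := by
  rintro ⟨⟨a, b, c, hab, -, hE, hbc, -, hT⟩, -, hcat⟩
  rw [edgeSet_ext_iff] at hE
  have hac : a ≠ c := ((hE a c).2 (Or.inr rfl)).ne
  have hadj : ∀ u v : Fin n, (spineGraph n).Adj u v → ¬ (u = a ∧ v = b) → ¬ (u = b ∧ v = a) →
      H.Adj u v := by
    intro u v huv h1 h2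
    refine (hE u v).2 (Or.inl ⟨huv, fun h => ?_⟩)
    rcases Sym2.eq_iff.1 h with h | h
    · exact h1 h
    · exact h2 ⟨h.1, h.2⟩
  have hnew : H.Adj a c := (hE a c).2 (Or.inr rfl)
  have hac' : a.val ≠ c.val := fun h => hac (Fin.ext h)
  rw [spineGraph_adj] at hab hbc
  rcases hab with ⟨ha0, hab⟩ | ⟨hb0, hab⟩ <;> rcases hbc with ⟨hb0, hbc⟩ | ⟨hc0, hbc⟩
  · rw [← hbc, ← hab] at hT
    exact not_emptyAt_grandparent hn (by rwa [hab]) hT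
  -- Only `0` has more than one child.
  · have hb : b.val = 0 := by
      rw [spineParent_eq_iff] at hab hbc
      omega
    have ha' : a.val = 1 ∨ a.val = 4 ∨ 7 ≤ a.val := by
      rw [spineParent_eq_iff] at hab
      omega
    have hc' : c.val = 1 ∨ c.val = 4 ∨ 7 ≤ c.val := by
      rw [spineParent_eq_iff] at hbc
      omega
    have hp : ∀ k < 8, ∃ p : Fin n, p.val = k := fun k hk => ⟨⟨k, by omega⟩, rfl⟩
    obtain ⟨p₁, h₁⟩ := hp 1 (by norm_num)
    obtain ⟨p₂, h₂⟩ := hp 2 (by norm_num)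
    obtain ⟨p₃, h₃⟩ := hp 3 (by norm_num)
    obtain ⟨p₄, h₄⟩ := hp 4 (by norm_num)
    obtain ⟨p₅, h₅⟩ := hp 5 (by norm_num)
    obtain ⟨p₆, h₆⟩ := hp 6 (by norm_num)
    obtain ⟨p₇, h₇⟩ := hp 7 (by norm_num)
    have ne : ∀ {u v : Fin n}, u.val ≠ v.val → u ≠ v := fun h h' => h (congrArg Fin.val h')
    have keep : ∀ u v : Fin n, u.val ≠ 0 → spineParent u = v → u.val ≠ a.val → H.Adj u v := by
      intro u v h0 huv hua
      refine hadj u v (spineGraph_adj.2 (Or.inl ⟨h0, huv⟩)) (fun h => hua (h.1 ▸ rfl))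
        fun h => h0 ?_
      rw [h.1, hb]
    have key : ∀ {v x y z x' y' z' : Fin n}, H.Adj x v → H.Adj y v → H.Adj z v → H.Adj x x' →
        H.Adj y y' → H.Adj z z' → x.val ≠ y.val → x.val ≠ z.val → y.val ≠ z.val →
        v.val ≠ x'.val → v.val ≠ y'.val → v.val ≠ z'.val → False := by
      intro v x y z x' y' z' hx hy hz hx' hy' hz' hxy hxz hyz nx ny nz
      rcases isLeaf_of_isCaterpillar hcat hx.symm hy.symm hz.symm (ne hxy) (ne hxz) (ne hyz)
        with h | h | h
      · exact not_isLeaf_of_adj hx hx' (ne nx) h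
      · exact not_isLeaf_of_adj hy hy' (ne ny) h
      · exact not_isLeaf_of_adj hz hz' (ne nz) h
    have a21 : H.Adj p₂ p₁ := keep p₂ p₁ (by omega) (by rw [h₂, h₁]; rfl) (by omega)
    have a32 : H.Adj p₃ p₂ := keep p₃ p₂ (by omega) (by rw [h₃, h₂]; rfl) (by omega)
    have a54 : H.Adj p₅ p₄ := keep p₅ p₄ (by omega) (by rw [h₅, h₄]; rfl) (by omega)
    have a65 : H.Adj p₆ p₅ := keep p₆ p₅ (by omega) (by rw [h₆, h₅]; rfl) (by omega)
    have acb : H.Adj c b := keep c b (by omega) hbc (by omega)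
    have a10 : a.val ≠ 1 → H.Adj p₁ b := fun h =>
      keep p₁ b (by omega) (by rw [h₁, hb]; rfl) (by omega)
    have a40 : a.val ≠ 4 → H.Adj p₄ b := fun h =>
      keep p₄ b (by omega) (by rw [h₄, hb]; rfl) (by omega)
    have a70 : a.val ≠ 7 → H.Adj p₇ b := fun h =>
      keep p₇ b (by omega) (by rw [h₇, hb]; rfl) (by omega)
    rw [hb] at hT
    rcases hc' with hc1 | hc4 | hc7
    · obtain rfl : c = p₁ := Fin.ext (hc1.trans h₁.symm)
      rcases ha' with ha1 | ha4 | ha7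
      · omega
      · obtain rfl : a = p₄ := Fin.ext (ha4.trans h₄.symm)
        -- After the slide, `1` is adjacent to `0`, `2` and `4`, which are further adjacent to `7`,
        -- `3` and `5`.
        exact key acb.symm a21 hnew (a70 (by omega)).symm a32.symm a54.symm (by omega) (by omega)
          (by omega) (by omega) (by omega) (by omega)
      · rw [hc1] at hT
        exact (not_emptyAt_far hn ha7).1 hT.swap
    · obtain rfl : c = p₄ := Fin.ext (hc4.trans h₄.symm)
      rcases ha' with ha1 | ha4 | ha7
      · obtain rfl : a = p₁ := Fin.ext (ha1.trans h₁.symm)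
        -- After the slide, `4` is adjacent to `0`, `5` and `1`, which are further adjacent to `7`,
        -- `6` and `2`.
        exact key acb.symm a54 hnew (a70 (by omega)).symm a65.symm a21.symm (by omega) (by omega)
          (by omega) (by omega) (by omega) (by omega)
      · omega
      · rw [hc4] at hT
        exact (not_emptyAt_far hn ha7).2 hT.swap
    · rcases ha' with ha1 | ha4 | ha7
      · rw [ha1] at hT
        exact (not_emptyAt_far hn hc7).1 hT
      · rw [ha4] at hT
        exact (not_emptyAt_far hn hc7).2 hT
      -- One leaf of `0` has been hung from another, `c`; now `0` has the non-leaf neighbours `1`,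
      -- `4` and `c`.
      · exact key (a10 (by omega)) (a40 (by omega)) acb a21.symm a54.symm hnew.symm (by omega)
          (by omega) (by omega) (by omega) (by omega) (by omega)
  · exact hac' (hab.symm.trans hbc)
  · rw [← hab, ← hbc] at hT
    exact not_emptyAt_grandparent hn (by rwa [hbc]) hT.swap

theorem exists_isolated {n : ℕ} (hn : 8 ≤ n) : ∃ S : Finset Plane, S.card = n ∧
    GeneralPosition S ∧ ∃ C : PlaneCaterpillar S, (slideGraph S).IsIsolated C := by
  classical
  let S : Finset Plane := (Finset.range n).image point
  have hcard : S.card = n := by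
    rw [Finset.card_image_of_injective _ point_injective, Finset.card_range]
  have hmem : ∀ i : Fin n, point i ∈ S := fun i =>
    Finset.mem_image_of_mem _ (Finset.mem_range.2 i.2)
  have hbij : Function.Bijective fun i : Fin n => (⟨point i, hmem i⟩ : S) := by
    rw [Fintype.bijective_iff_injective_and_card]
    refine ⟨fun i j h => Fin.ext (point_injective (congrArg Subtype.val h)), ?_⟩
    rw [Fintype.card_fin, Fintype.card_coe, hcard]
  let e : Fin n ≃ S := Equiv.ofBijective _ hbij
  have he : ∀ i, (e i : Plane) = point i := fun i => rfl
  have hG : ((spineGraph n).comap e.symm).comap e = spineGraph n := by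
    ext u v
    simp
  refine ⟨S, hcard, ?_, ⟨(spineGraph n).comap e.symm,
    (planeAt_comap_iff he).1 (by rw [hG]; exact planeAt_spineGraph n),
    (isCaterpillar_spineGraph hn).of_iso (Iso.comap e.symm _).symm⟩, fun D hD => ?_⟩
  · intro a ha b hb c hc hab hac hbc hcol
    obtain ⟨i, -, rfl⟩ := Finset.mem_image.1 ha
    obtain ⟨j, -, rfl⟩ := Finset.mem_image.1 hb
    obtain ⟨k, -, rfl⟩ := Finset.mem_image.1 hc
    exact det_point_ne_zero (fun h => hab (congrArg point h)) (fun h => hac (congrArg point h))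
      (fun h => hbc (congrArg point h)) (det_eq_zero_of_collinear hcol)
  · have hs := (slideAt_comap_iff he).2 hD
    rw [hG] at hs
    exact not_step_spineGraph hn _ ⟨hs, (planeAt_comap_iff he).2 D.2.1,
      D.2.2.of_iso (Iso.comap e D.1).symm⟩

end SlideGraph

theorem theorem5 :
    (∀ n : ℕ, 1 ≤ n → n ≤ 7 →
      ∀ S : Finset SlideGraph.Plane, S.card = n → SlideGraph.GeneralPosition S →
        (SlideGraph.slideGraph S).Connected) ∧
    (∀ n : ℕ, 8 ≤ n →
      ∃ S : Finset SlideGraph.Plane, S.card = n ∧ SlideGraph.GeneralPosition S ∧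
        ∃ C : SlideGraph.PlaneCaterpillar S, (SlideGraph.slideGraph S).IsIsolated C) :=
  ⟨fun _ hn hn7 _ hcard hS => SlideGraph.slideGraph_connected hn hn7 hcard hS,
    fun _ hn => SlideGraph.exists_isolated hn⟩
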